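/- **Setting.** Let $d\ge 2$, let $A_1,\dots,A_d$ be real $3\times 3$ matrices with $A_d$ invertible, and put $L(\tau,\eta,\xi):=\tau I+\sum_{i=1}^{d-1}\eta_iA_i+\xi A_d$. Let $\varphi,\psi\in\mathbb R\times\mathbb R^{d-1}$ be two frequencies such that, for $\zeta=(\tau,\eta)\in\{\varphi,\psi\}$, the equation $\det L(\tau,\eta,\xi)=0$ has three distinct real roots $\xi_1(\zeta),\xi_2(\zeta),\xi_3(\zeta)$; write $\zeta_j:=(\zeta,\xi_j(\zeta))$. Assume that there are $C>0$, $m_0>0$ with $$|\det L(\lambda_1\zeta_1+\lambda_3\zeta_3)|\ge C\,|(\lambda_1,\lambda_3)|^{-m_0}\qquad(\zeta=\varphi,\psi,\ \lambda_1,\lambda_3\in\mathbb Z\setminus\{0\}).$$ Put $\delta^1_\zeta:=\frac{\xi_1(\zeta)-\xi_2(\zeta)}{\xi_3(\zeta)-\xi_1(\zeta)}$, $\delta^3_\zeta:=\frac{\xi_3(\zeta)-\xi_2(\zeta)}{\xi_3(\zeta)-\xi_1(\zeta)}$. Let $\tilde m_0\ge 0$ be such that, for some $C>0$, $\frac1{|\lambda_1\delta^1_\zeta+\lambda_3\delta^3_\zeta|}\le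 C\min(|\lambda_1|^{\tilde m_0},|\lambda_3|^{\tilde m_0})$ for all $\lambda_1,\lambda_3\in\mathbb Z\setminus\{0\}$ and $\zeta=\varphi,\psi$ (under the preceding assumption such $\tilde m_0$ exist), and let $d^*$ be an integer with $d^*>\tilde m_0+2+\frac{d+1}2$. Finally let $\mathbf v_\zeta\in\mathbb R^{d-1}$, $D_\zeta\in\mathbb C$, $\mathbf w_\zeta,K_\zeta\in\mathbb R$ for $\zeta=\varphi,\psi$. All these data are fixed. **Spaces.** Write $\mathbb T=\mathbb R/2\pi\mathbb Z$ and $\langle X\rangle=(1+|X|^2)^{1/2}$. For $s\in(0,1)$, $Y_s$ is the space of complex-valued $u=\sum_{\lambda\in\mathbb Z}u_\lambda(y)e^{i\lambda\Theta}$ in $L^2(\mathbb R^{d-1}\times\mathbb T)$ with $$\|u\|_{Y_s}^2:=\int_{\mathbb R^{d-1}}\sum_{\lambda\in\mathbb Z}e^{2s|(\lambda,\xi)|}\langle(\lambda,\xi)\rangle^{2d^*}|\widehat{u_\lambda}(\xi)|^2\,d\xi<\infty,\qquad \widehat{u_\lambda}(\xi)=\int u_\lambda(y)e^{-i\xi\cdot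 y}\,dy .$$ For $\rho\in(0,1)$, $E_\rho$ is the space of functions $a$ on $(-\rho,\rho)$ which, for every $s\in(0,1)$, are analytic from $(-\rho(1-s),\rho(1-s))$ to $Y_s$, and for which there is $M>0$ with $$\|\partial_t^\nu a(0)\|_{Y_s}\le\frac{M}{(1-s)^{\nu+1}}\,\frac{(\nu+1)!\,\mathfrak c_\nu}{(4\rho)^\nu}\qquad\text{for all }s\in(0,1),\ \nu\ge 0,\qquad \mathfrak c_\nu=\tfrac1{\nu+1}\tbinom{2\nu}{\nu};$$ $\|a\|_{E_\rho}$ is the infimum of such $M$. $\mathbf E_\rho$ is the space of sequences $\mathbf a=(a^n)_{n\ge1}$ in $E_\rho$ with $\|\mathbf a\|_{\mathbf E_\rho}^2:=\sum_{n\ge1}e^{2\rho n}\langle n\rangle^{2d^*}\|a^n\|_{E_\rho}^2<\infty$, and $\mathbf E_\rho^2$ consists of the pairs $\mathbf a=(\mathbf a_\varphi,\mathbf a_\psi)$ of such sequences, with $\|\mathbf a\|_{\mathbf E_\rho^2}^2:=\|\mathbf a_\varphi\|_{\mathbf E_\rho}^2+\|\mathbf a_\psi\|_{\mathbf E_\rho}^2$.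 **Equation.** Put $$\mathbb F_\zeta[a,b]:=\sum_{\lambda\in\mathbb Z\setminus\{0\}}\ \sum_{\substack{\lambda_1+\lambda_3=\lambda\\ \lambda_1\lambda_3\ne0}}\frac{i\,a_{\lambda_1}b_{\lambda_3}}{\lambda_1\delta^1_\zeta+\lambda_3\delta^3_\zeta}\,e^{i\lambda\Theta}.$$ Given $\mathbf H=(H^n_\varphi,H^n_\psi)_{n\ge1}\in\mathbf E_\rho^2$, the integrated boundary system for the unknown $\mathbf b=(b^n_\varphi,b^n_\psi)_{n\ge1}$ is: for $\zeta=\varphi,\psi$, all $n\ge1$ and all $t\in(-\rho,\rho)$, $$b^n_\zeta=\mathbf v_\zeta\cdot\nabla_y a^n_\zeta-\partial_\Theta\big(D_\zeta\,a^1_\zeta a^n_\zeta\big)-\mathbf w_\zeta\,\mathbb F_\zeta[\partial_\Theta a^1_\zeta,\partial_\Theta a^n_\zeta]+K_\zeta\sum_{k=1}^{n-1}\partial_\Theta\big(a^k_\varphi a^{n-k}_\psi\big)+H^n_\zeta,\qquad a^n_\zeta(t):=\int_0^tb^n_\zeta(\sigma)\,d\sigma. \tag{$*$}$$ **Proposition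 3.22.** For every $M_0>0$ there exists $\rho\in(0,1)$ such that, for every $\mathbf H\in\mathbf E_\rho^2$ with $\|\mathbf H\|_{\mathbf E_\rho^2}<M_0$, the system $(*)$ admits a unique solution $\mathbf b$ in $\mathbf E_\rho^2$. -/

import Mathlib

open MeasureTheory Set Topology
open scoped ENNReal FourierTransform

noncomputable section

namespace WeaklyStable

/-! ### Functions on `ℝ^{d-1} × 𝕋` -/

/-- The tangential space `ℝ^{d-1}`. -/
abbrev Tan (d : ℕ) := EuclideanSpace ℝ (Fin (d - 1))

instance factTwoPiPos : Fact (0 < 2 * Real.pi) := ⟨Real.two_pi_pos⟩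

/-- The torus `𝕋 = ℝ / 2πℤ`. -/
abbrev Circ := AddCircle (2 * Real.pi)

/-- Lebesgue measure in `y` times the normalised Haar measure in `Θ`. -/
abbrev meas (d : ℕ) : Measure (Tan d × Circ) :=
  (volume : Measure (Tan d)).prod (AddCircle.haarAddCircle (T := 2 * Real.pi))

/-- The space `L²(ℝ^{d-1} × 𝕋)` of complex valued functions. -/
abbrev L2 (d : ℕ) := Lp ℂ 2 (meas d)

/-- The Fourier coefficient `u_l(y)` of the expansion `u(y, Θ) = ∑ u_l(y) e^{i l Θ}`. -/
def coeffFun {d : ℕ} (u : Tan d × Circ → ℂ) (l : ℤ) : Tan d → ℂ :=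
  fun y => fourierCoeff (fun θ : Circ => u (y, θ)) l

theorem coeffFun_aux {d : ℕ} {u : Tan d × Circ → ℂ} (hu : StronglyMeasurable u)
    (l : ℤ) : StronglyMeasurable (coeffFun u l) := by
  have h : StronglyMeasurable
      (fun p : Tan d × Circ => (fourier (-l) p.2 : ℂ) • u p) := by
    have h0 : StronglyMeasurable (fun p : Tan d × Circ => (fourier (-l) p.2 : ℂ)) :=
      ((map_continuous (fourier (T := 2 * Real.pi) (-l))).comp continuous_snd).stronglyMeasurable
    exact h0.smul hu
  exact h.integral_prod_right' (ν := AddCircle.haarAddCircle (T := 2 * Real.pi))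

theorem enorm_coeffFun_sq_le {d : ℕ} {u : Tan d × Circ → ℂ} (hu : StronglyMeasurable u)
    (l : ℤ) (y : Tan d) : ‖coeffFun u l y‖ₑ ^ (2 : ℝ) ≤
      ∫⁻ θ, ‖u (y, θ)‖ₑ ^ (2 : ℝ) ∂(AddCircle.haarAddCircle (T := 2 * Real.pi)) := by
  have hs : StronglyMeasurable (fun θ : Circ => u (y, θ)) :=
    hu.comp_measurable measurable_prodMk_left
  have h1 : ‖coeffFun u l y‖ₑ ≤
      eLpNorm (fun θ : Circ => u (y, θ)) 1 (AddCircle.haarAddCircle (T := 2 * Real.pi)) := by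
    rw [eLpNorm_one_eq_lintegral_enorm]
    refine (enorm_integral_le_lintegral_enorm _).trans (lintegral_mono fun θ => ?_)
    rw [enorm_smul]
    have : ‖(fourier (-l) θ : ℂ)‖ₑ = 1 := by
      rw [← ofReal_norm, fourier_apply, Circle.norm_coe, ENNReal.ofReal_one]
    rw [this, one_mul]
  have h2 := eLpNorm_le_eLpNorm_of_exponent_le (μ := AddCircle.haarAddCircle (T := 2 * Real.pi))
    (p := 1) (q := 2) (by norm_num) hs.aestronglyMeasurable
  calc ‖coeffFun u l y‖ₑ ^ (2 : ℝ)
      ≤ (eLpNorm (fun θ : Circ => u (y, θ)) 2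
          (AddCircle.haarAddCircle (T := 2 * Real.pi))) ^ (2 : ℝ) := by
        gcongr; exact h1.trans h2
    _ = _ := by
        rw [eLpNorm_eq_lintegral_rpow_enorm_toReal (by norm_num) (by norm_num), ← ENNReal.rpow_mul]
        simp

theorem memLp_coeffFun {d : ℕ} (u : L2 d) (l : ℤ) :
    MemLp (coeffFun (u : Tan d × Circ → ℂ) l) 2 volume := by
  have hu := Lp.stronglyMeasurable u
  refine ⟨(coeffFun_aux hu l).aestronglyMeasurable, ?_⟩
  have hfin := (Lp.memLp u).2
  rw [eLpNorm_lt_top_iff_lintegral_rpow_enorm_lt_top (by norm_num) (by norm_num)] at hfin ⊢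
  simp only [ENNReal.toReal_ofNat] at hfin ⊢
  refine lt_of_le_of_lt (lintegral_mono fun y => enorm_coeffFun_sq_le hu l y) ?_
  rw [lintegral_prod] at hfin
  · exact hfin
  · exact (hu.enorm.pow_const _).aemeasurable

/-- The Fourier coefficient `u_l` as an element of `L²(ℝ^{d-1})`. -/
def coeff {d : ℕ} (u : L2 d) (l : ℤ) : Lp ℂ 2 (volume : Measure (Tan d)) :=
  (memLp_coeffFun u l).toLp

theorem integrable_slice {d : ℕ} (u : L2 d) : ∀ᵐ y : Tan d,
    MemLp (fun θ : Circ => u (y, θ)) 2 (AddCircle.haarAddCircle (T := 2 * Real.pi)) := by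
  have hu := Lp.stronglyMeasurable u
  have hfin := (Lp.memLp u).2
  rw [eLpNorm_lt_top_iff_lintegral_rpow_enorm_lt_top (by norm_num) (by norm_num)] at hfin
  rw [lintegral_prod _ (hu.enorm.pow_const _).aemeasurable] at hfin
  have hm := (hu.enorm.pow_const (2 : ℝ≥0∞).toReal).lintegral_prod_right'
    (ν := AddCircle.haarAddCircle (T := 2 * Real.pi))
  filter_upwards [ae_lt_top hm hfin.ne] with y hy
  refine ⟨(hu.comp_measurable measurable_prodMk_left).aestronglyMeasurable, ?_⟩
  rwa [eLpNorm_lt_top_iff_lintegral_rpow_enorm_lt_top (by norm_num) (by norm_num)]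

theorem coeff_add {d : ℕ} (u v : L2 d) (l : ℤ) : coeff (u + v) l = coeff u l + coeff v l := by
  ext1
  have h := Measure.ae_ae_of_ae_prod (Lp.coeFn_add u v)
  filter_upwards [(memLp_coeffFun (u + v) l).coeFn_toLp, (memLp_coeffFun u l).coeFn_toLp,
    (memLp_coeffFun v l).coeFn_toLp, Lp.coeFn_add (coeff u l) (coeff v l), h,
    integrable_slice u, integrable_slice v] with y h1 h2 h3 h4 h5 h6 h7
  rw [h4, Pi.add_apply]
  unfold coeff
  rw [h1, h2, h3]
  unfold coeffFun
  rw [fourierCoeff_congr_ae h5]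
  exact congrFun (fourierCoeff.add (h6.integrable (by norm_num)) (h7.integrable (by norm_num))) l

theorem coeff_smul {d : ℕ} (c : ℂ) (u : L2 d) (l : ℤ) : coeff (c • u) l = c • coeff u l := by
  ext1
  have h := Measure.ae_ae_of_ae_prod (Lp.coeFn_smul c u)
  filter_upwards [(memLp_coeffFun (c • u) l).coeFn_toLp, (memLp_coeffFun u l).coeFn_toLp,
    Lp.coeFn_smul c (coeff u l), h] with y h1 h2 h4 h5
  rw [h4, Pi.smul_apply]
  unfold coeff
  rw [h1, h2]
  unfold coeffFun
  rw [fourierCoeff_congr_ae h5]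
  exact fourierCoeff.const_smul _ c l

theorem eq_zero_of_coeff {d : ℕ} (u : L2 d) (h : ∀ l, coeff u l = 0) : u = 0 := by
  have h1 : ∀ᵐ y : Tan d, ∀ l, coeffFun u l y = 0 := by
    rw [ae_all_iff]
    intro l
    have h2 := (memLp_coeffFun u l).coeFn_toLp
    have h3 : (coeff u l : Tan d → ℂ) =ᵐ[volume] 0 := by
      rw [h l]; exact Lp.coeFn_zero _ _ _
    filter_upwards [h2, h3] with y h4 h5
    rw [← h4]; exact h5
  rw [Lp.eq_zero_iff_ae_eq_zero]
  have hu := Lp.stronglyMeasurable u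
  refine (Measure.ae_prod_iff_ae_ae (p := fun z => u z = (0 : Tan d × Circ → ℂ) z) ?_).2 ?_
  · exact measurableSet_eq_fun hu.measurable measurable_const
  · filter_upwards [h1, integrable_slice u] with y h4 h5
    have h6 : h5.toLp = 0 := by
      apply (fourierBasis (T := 2 * Real.pi)).repr.injective
      ext i
      rw [fourierBasis_repr, fourierCoeff_congr_ae h5.coeFn_toLp, map_zero]
      exact h4 i
    have h7 := h5.coeFn_toLp
    rw [h6] at h7
    filter_upwards [h7, Lp.coeFn_zero ℂ 2 (AddCircle.haarAddCircle (T := 2 * Real.pi))]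
      with θ h8 h9
    rw [← h8]; exact h9

/-- The Fourier transform in `y` of `u_l`, with the convention `û(ξ) = ∫ u(y) e^{-i ξ·y} dy`
(Mathlib's transform uses `e^{-2πi ξ·y}`, hence the dilation). -/
def hat {d : ℕ} (u : L2 d) (l : ℤ) : Tan d → ℂ :=
  fun ξ => (𝓕 (coeff u l) : Lp ℂ 2 (volume : Measure (Tan d))) ((2 * Real.pi)⁻¹ • ξ)

theorem ae_dilate {d : ℕ} {p : Tan d → Prop} (h : ∀ᵐ ξ, p ξ) :
    ∀ᵐ ξ : Tan d, p ((2 * Real.pi)⁻¹ • ξ) := by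
  have hc : (2 * Real.pi)⁻¹ ≠ 0 := inv_ne_zero Real.two_pi_pos.ne'
  have hq : Measure.QuasiMeasurePreserving (fun ξ : Tan d => (2 * Real.pi)⁻¹ • ξ)
      volume volume := by
    refine ⟨measurable_const_smul _, ?_⟩
    rw [Measure.map_addHaar_smul _ hc]
    exact Measure.smul_absolutelyContinuous
  exact hq.ae h

theorem ae_undilate {d : ℕ} {p : Tan d → Prop} (h : ∀ᵐ ξ : Tan d, p ((2 * Real.pi)⁻¹ • ξ)) :
    ∀ᵐ ξ, p ξ := by
  have hc : (2 * Real.pi) ≠ 0 := Real.two_pi_pos.ne'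
  have hq : Measure.QuasiMeasurePreserving (fun ξ : Tan d => (2 * Real.pi) • ξ)
      volume volume := by
    refine ⟨measurable_const_smul _, ?_⟩
    rw [Measure.map_addHaar_smul _ hc]
    exact Measure.smul_absolutelyContinuous
  filter_upwards [hq.ae h] with ξ hξ
  rwa [inv_smul_smul₀ hc] at hξ

theorem measurable_hat {d : ℕ} (u : L2 d) (l : ℤ) : Measurable (hat u l) :=
  (Lp.stronglyMeasurable _).measurable.comp (measurable_const_smul _)

theorem hat_add {d : ℕ} (u v : L2 d) (l : ℤ) : hat (u + v) l =ᵐ[volume] hat u l + hat v l := by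
  have h := Lp.coeFn_add (𝓕 (coeff u l) : Lp ℂ 2 (volume : Measure (Tan d))) (𝓕 (coeff v l))
  rw [← FourierTransform.fourier_add, ← coeff_add] at h
  exact ae_dilate h

theorem hat_smul {d : ℕ} (c : ℂ) (u : L2 d) (l : ℤ) : hat (c • u) l =ᵐ[volume] c • hat u l := by
  have h := Lp.coeFn_smul c (𝓕 (coeff u l) : Lp ℂ 2 (volume : Measure (Tan d)))
  rw [← FourierTransform.fourier_smul, ← coeff_smul] at h
  exact ae_dilate h

/-! ### The spaces `Y_s` -/

/-- The Euclidean norm `|(l, ξ)|`. -/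
def freqNorm {d : ℕ} (l : ℤ) (ξ : Tan d) : ℝ := Real.sqrt ((l : ℝ) ^ 2 + ‖ξ‖ ^ 2)

/-- The weight `e^{2s|(l,ξ)|} ⟨(l,ξ)⟩^{2k}`. -/
def yWeight {d : ℕ} (k : ℕ) (s : ℝ) (l : ℤ) (ξ : Tan d) : ℝ :=
  Real.exp (2 * s * freqNorm l ξ) * (1 + freqNorm l ξ ^ 2) ^ k

/-- The square `∫ ∑_l e^{2s|(l,ξ)|} ⟨(l,ξ)⟩^{2k} |û_l(ξ)|² dξ` of the `Y_s` norm, which may be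
infinite. -/
def yNormSq {d : ℕ} (k : ℕ) (s : ℝ) (u : L2 d) : ℝ≥0∞ :=
  ∫⁻ ξ : Tan d, ∑' l : ℤ, ENNReal.ofReal (yWeight k s l ξ) * ‖hat u l ξ‖ₑ ^ 2

theorem yWeight_pos {d : ℕ} (k : ℕ) (s : ℝ) (l : ℤ) (ξ : Tan d) : 0 < yWeight k s l ξ := by
  unfold yWeight; positivity

/-- The weighted Fourier transform of `u`. -/
def wHat {d : ℕ} (k : ℕ) (s : ℝ) (u : L2 d) : Tan d × ℤ → ℂ :=
  fun p => (Real.sqrt (yWeight k s p.2 p.1) : ℂ) * hat u p.2 p.1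

theorem measurable_wHat {d : ℕ} (k : ℕ) (s : ℝ) (u : L2 d) : Measurable (wHat k s u) := by
  refine measurable_from_prod_countable_left fun l => ?_
  have : Continuous fun ξ : Tan d => (Real.sqrt (yWeight k s l ξ) : ℂ) := by
    unfold yWeight freqNorm; fun_prop
  exact this.measurable.mul (measurable_hat u l)

theorem ae_prod_int {d : ℕ} {p : Tan d × ℤ → Prop} (h : ∀ l, ∀ᵐ ξ : Tan d, p (ξ, l)) :
    ∀ᵐ z ∂((volume : Measure (Tan d)).prod Measure.count), p z := by
  have h2 : ∀ᵐ ξ : Tan d, ∀ l, p (ξ, l) := ae_all_iff.2 h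
  obtain ⟨t, ht, htm, ht0⟩ := exists_measurable_superset_of_null h2
  refine measure_mono_null (t := t ×ˢ univ) (fun z hz => ⟨ht ?_, mem_univ _⟩) ?_
  · intro hall; exact hz (hall z.2)
  · rw [Measure.prod_prod, ht0, zero_mul]

theorem yNormSq_eq {d : ℕ} (k : ℕ) (s : ℝ) (u : L2 d) :
    yNormSq k s u =
      eLpNorm (wHat k s u) 2 ((volume : Measure (Tan d)).prod Measure.count) ^ 2 := by
  rw [eLpNorm_eq_lintegral_rpow_enorm_toReal (by norm_num) (by norm_num), ← ENNReal.rpow_natCast,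
    ← ENNReal.rpow_mul]
  simp only [ENNReal.toReal_ofNat, Nat.cast_ofNat, one_div, ne_eq, OfNat.ofNat_ne_zero,
    not_false_eq_true, inv_mul_cancel₀, ENNReal.rpow_one]
  rw [lintegral_prod _ ((measurable_wHat k s u).enorm.pow_const _).aemeasurable]
  refine lintegral_congr fun ξ => ?_
  rw [lintegral_count]
  refine tsum_congr fun l => ?_
  have h : ‖((Real.sqrt (yWeight k s l ξ) : ℝ) : ℂ)‖ₑ ^ 2
      = ENNReal.ofReal (yWeight k s l ξ) := by
    rw [← ofReal_norm, ← ENNReal.ofReal_pow (norm_nonneg _), Complex.norm_real,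
      Real.norm_eq_abs, sq_abs, Real.sq_sqrt (yWeight_pos k s l ξ).le]
  have h2 : (2 : ℝ) = ((2 : ℕ) : ℝ) := by norm_num
  rw [h2, ENNReal.rpow_natCast, wHat, enorm_mul, mul_pow, h]

theorem wHat_add {d : ℕ} (k : ℕ) (s : ℝ) (u v : L2 d) :
    wHat k s (u + v) =ᵐ[(volume : Measure (Tan d)).prod Measure.count]
      wHat k s u + wHat k s v := by
  refine ae_prod_int fun l => ?_
  filter_upwards [hat_add u v l] with ξ h
  simp only [wHat, Pi.add_apply] at h ⊢
  rw [h, mul_add]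

theorem wHat_smul {d : ℕ} (k : ℕ) (s : ℝ) (c : ℂ) (u : L2 d) :
    wHat k s (c • u) =ᵐ[(volume : Measure (Tan d)).prod Measure.count] c • wHat k s u := by
  refine ae_prod_int fun l => ?_
  filter_upwards [hat_smul c u l] with ξ h
  simp only [wHat, Pi.smul_apply, smul_eq_mul] at h ⊢
  rw [h]; ring

theorem yNormSq_lt_top_iff {d : ℕ} (k : ℕ) (s : ℝ) (u : L2 d) : yNormSq k s u < ⊤ ↔
    eLpNorm (wHat k s u) 2 ((volume : Measure (Tan d)).prod Measure.count) < ⊤ := by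
  rw [yNormSq_eq]
  simp [ENNReal.pow_lt_top_iff]

theorem memLp_wHat_iff {d : ℕ} (k : ℕ) (s : ℝ) (u : L2 d) : yNormSq k s u < ⊤ ↔
    MemLp (wHat k s u) 2 ((volume : Measure (Tan d)).prod Measure.count) := by
  rw [yNormSq_lt_top_iff]
  exact ⟨fun h => ⟨(measurable_wHat k s u).aestronglyMeasurable, h⟩, fun h => h.2⟩

/-- The functions of `L²(ℝ^{d-1} × 𝕋)` with finite `Y_s` norm. -/
def ySub (d k : ℕ) (s : ℝ) : Submodule ℂ (L2 d) where
  carrier := {u | yNormSq k s u < ⊤}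
  add_mem' := by
    intro u v hu hv
    simp only [mem_ofPred_eq, memLp_wHat_iff] at hu hv ⊢
    exact (hu.add hv).ae_eq (wHat_add k s u v).symm
  zero_mem' := by
    have h := wHat_smul (d := d) k s 0 0
    simp only [zero_smul] at h
    simp only [mem_ofPred_eq, memLp_wHat_iff]
    exact MemLp.zero.ae_eq h.symm
  smul_mem' := by
    intro c u hu
    simp only [mem_ofPred_eq, memLp_wHat_iff] at hu ⊢
    exact (hu.const_smul c).ae_eq (wHat_smul k s c u).symm

/-- The space `Y_s` (for the Sobolev exponent `k = d^*`). It is not given the topology of `L²` but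
that of its own norm, defined below. -/
def Y (d k : ℕ) (s : ℝ) : Type := ↥(ySub d k s)

instance (d k : ℕ) (s : ℝ) : AddCommGroup (Y d k s) := inferInstanceAs (AddCommGroup (ySub d k s))

instance (d k : ℕ) (s : ℝ) : Module ℂ (Y d k s) := inferInstanceAs (Module ℂ (ySub d k s))

/-- The inclusion of `Y_s` in `L²(ℝ^{d-1} × 𝕋)`. -/
def Y.incl {d k : ℕ} {s : ℝ} : Y d k s →ₗ[ℂ] L2 d := (ySub d k s).subtype

/-- The norm of `Y_s`. -/
instance (d k : ℕ) (s : ℝ) : Norm (Y d k s) := ⟨fun u => Real.sqrt (yNormSq k s u.incl).toReal⟩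

theorem Y.norm_def {d k : ℕ} {s : ℝ} (u : Y d k s) :
    ‖u‖ = Real.sqrt (yNormSq k s u.incl).toReal := rfl

theorem Y.norm_eq {d k : ℕ} {s : ℝ} (u : Y d k s) : ‖u‖ =
    (eLpNorm (wHat k s u.incl) 2 ((volume : Measure (Tan d)).prod Measure.count)).toReal := by
  rw [Y.norm_def, yNormSq_eq, ENNReal.toReal_pow, Real.sqrt_sq ENNReal.toReal_nonneg]

theorem Y.memLp {d k : ℕ} {s : ℝ} (u : Y d k s) :
    MemLp (wHat k s u.incl) 2 ((volume : Measure (Tan d)).prod Measure.count) :=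
  (memLp_wHat_iff k s _).1 u.2

theorem Y.core (d k : ℕ) (s : ℝ) : NormedSpace.Core ℂ (Y d k s) where
  norm_nonneg u := Real.sqrt_nonneg _
  norm_smul c u := by
    rw [Y.norm_eq, Y.norm_eq, map_smul, eLpNorm_congr_ae (wHat_smul k s c _), eLpNorm_const_smul,
      ENNReal.toReal_mul, toReal_enorm]
  norm_triangle u v := by
    rw [Y.norm_eq, Y.norm_eq, Y.norm_eq, map_add, eLpNorm_congr_ae (wHat_add k s _ _),
      ← ENNReal.toReal_add u.memLp.2.ne v.memLp.2.ne]
    refine ENNReal.toReal_mono (ENNReal.add_lt_top.2 ⟨u.memLp.2, v.memLp.2⟩).ne ?_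
    exact eLpNorm_add_le u.memLp.1 v.memLp.1 (by norm_num)
  norm_eq_zero_iff u := by
    rw [Y.norm_eq]
    constructor
    · intro h
      rw [ENNReal.toReal_eq_zero_iff, or_iff_left u.memLp.2.ne,
        eLpNorm_eq_zero_iff u.memLp.1 (by norm_num)] at h
      apply Subtype.ext
      refine eq_zero_of_coeff u.incl fun l => ?_
      have h1 : ∀ᵐ ξ : Tan d, hat u.incl l ξ = 0 := by
        filter_upwards [Measure.ae_ae_of_ae_prod h] with ξ h2
        have h3 := (ae_iff.1 h2 : Measure.count _ = 0)
        rw [Measure.count_eq_zero_iff] at h3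
        have h4 : l ∉ {a : ℤ | ¬ wHat k s u.incl (ξ, a) = (0 : Tan d × ℤ → ℂ) (ξ, a)} := by
          rw [h3]; exact notMem_empty l
        simp only [mem_ofPred_eq, not_not] at h4
        have h5 : ((Real.sqrt (yWeight k s l ξ) : ℝ) : ℂ) ≠ 0 :=
          Complex.ofReal_ne_zero.2 (Real.sqrt_pos.2 (yWeight_pos k s l ξ)).ne'
        exact (mul_eq_zero.1 h4).resolve_left h5
      have h2 : (𝓕 (coeff u.incl l) : Lp ℂ 2 (volume : Measure (Tan d))) = 0 :=
        (Lp.eq_zero_iff_ae_eq_zero).2 (ae_undilate h1)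
      rw [← norm_eq_zero, Lp.norm_fourier_eq, norm_eq_zero] at h2
      exact h2
    · rintro rfl
      have h := wHat_smul (d := d) k s 0 0
      simp only [zero_smul] at h
      rw [map_zero, eLpNorm_congr_ae h]
      simp

instance (d k : ℕ) (s : ℝ) : NormedAddCommGroup (Y d k s) := NormedAddCommGroup.ofCore (Y.core d k s)

instance (d k : ℕ) (s : ℝ) : NormedSpace ℂ (Y d k s) := NormedSpace.ofCore (Y.core d k s)

/-! ### Operations on functions -/

/-- The class in `L²` of a square integrable function (and `0` for other functions). -/
def toL2 {d : ℕ} (f : Tan d × Circ → ℂ) : L2 d :=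
  open Classical in if h : MemLp f 2 (meas d) then h.toLp else 0

/-- The pointwise product. -/
def mulL2 {d : ℕ} (u v : L2 d) : L2 d := toL2 fun p => u p * v p

/-- The translate `p ↦ u (p + q)`. -/
def translate {d : ℕ} (q : Tan d × Circ) (u : L2 d) : L2 d :=
  Lp.compMeasurePreserving (fun p => p + q) (measurePreserving_add_right (meas d) q) u

/-- The derivative `∂_Θ u`, as the limit in `L²` of the difference quotients. -/
def dTheta {d : ℕ} (u : L2 d) : L2 d := deriv (fun h : ℝ => translate (0, (h : Circ)) u) 0

/-- The derivative `v · ∇_y u`, as the limit in `L²` of the difference quotients. -/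
def dTan {d : ℕ} (v : Tan d) (u : L2 d) : L2 d := deriv (fun h : ℝ => translate (h • v, 0) u) 0

/-- The bilinear operator
`F[u, v] = ∑_{l ≠ 0} ∑_{l₁ + l₃ = l, l₁ l₃ ≠ 0} i u_{l₁} v_{l₃} / (l₁ δ₁ + l₃ δ₃) e^{i l Θ}`. -/
def fPer {d : ℕ} (δ₁ δ₃ : ℝ) (u v : L2 d) : L2 d :=
  toL2 fun p => ∑' l : ℤ, if l = 0 then 0 else
    (∑' l₁ : ℤ, if l₁ * (l - l₁) = 0 then 0 else
      Complex.I * coeffFun u l₁ p.1 * coeffFun v (l - l₁) p.1 /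
        ((l₁ * δ₁ + (l - l₁) * δ₃ : ℝ) : ℂ)) * fourier l p.2

/-! ### The spaces `E_ρ` of functions analytic in time

A function of time is represented by a map on `ℝ` of which only the restriction to `(-ρ, ρ)`
matters. -/

/-- The function `a` with values in `L²` seen as a function with values in `Y_s` (with value `0` at
the times `t` such that `a t` does not belong to `Y_s`). -/
def toY {d : ℕ} (k : ℕ) (s : ℝ) (a : ℝ → L2 d) : ℝ → Y d k s :=
  open Classical in fun t => if h : a t ∈ ySub d k s then (⟨a t, h⟩ : ySub d k s) else 0

/-- For every `s ∈ (0, 1)`, the function `a` is analytic from `(-ρ(1-s), ρ(1-s))` to `Y_s`. -/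
def MemETilde {d : ℕ} (k : ℕ) (ρ : ℝ) (a : ℝ → L2 d) : Prop :=
  ∀ s ∈ Ioo (0 : ℝ) 1,
    (∀ t ∈ Ioo (-(ρ * (1 - s))) (ρ * (1 - s)), a t ∈ ySub d k s) ∧
    AnalyticOnNhd ℝ (toY k s a) (Ioo (-(ρ * (1 - s))) (ρ * (1 - s)))

/-- The bound `‖∂_t^ν a(0)‖_{Y_s} ≤ M (1-s)^{-(ν+1)} (ν+1)! c_ν (4ρ)^{-ν}` for all `s ∈ (0, 1)` and
`ν ≥ 0`, where `c_ν` is the Catalan number. -/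
def EBound {d : ℕ} (k : ℕ) (ρ : ℝ) (a : ℝ → L2 d) (M : ℝ) : Prop :=
  ∀ s ∈ Ioo (0 : ℝ) 1, ∀ ν : ℕ, ‖iteratedDeriv ν (toY k s a) 0‖ ≤
    M / (1 - s) ^ (ν + 1) * (((ν + 1).factorial * catalan ν : ℝ) / (4 * ρ) ^ ν)

/-- `a` belongs to `E_ρ`. -/
def MemE {d : ℕ} (k : ℕ) (ρ : ℝ) (a : ℝ → L2 d) : Prop :=
  MemETilde k ρ a ∧ ∃ M > 0, EBound k ρ a M

/-- The norm of `E_ρ`. -/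
def normE {d : ℕ} (k : ℕ) (ρ : ℝ) (a : ℝ → L2 d) : ℝ := sInf {M | 0 < M ∧ EBound k ρ a M}

/-- The general term `e^{2ρn} ⟨n⟩^{2k} ‖a_n‖²` of the square of the norm of a sequence. -/
def seqTerm {d : ℕ} (k : ℕ) (ρ : ℝ) (a : ℕ+ → ℝ → L2 d) (n : ℕ+) : ℝ :=
  Real.exp (2 * ρ * n) * (1 + (n : ℝ) ^ 2) ^ k * normE k ρ (a n) ^ 2

/-- The sequence `a` belongs to the space `𝐄_ρ` of sequences. -/
def MemESeq {d : ℕ} (k : ℕ) (ρ : ℝ) (a : ℕ+ → ℝ → L2 d) : Prop :=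
  (∀ n, MemE k ρ (a n)) ∧ Summable (seqTerm k ρ a)

/-- The norm of `𝐄_ρ`. -/
def normESeq {d : ℕ} (k : ℕ) (ρ : ℝ) (a : ℕ+ → ℝ → L2 d) : ℝ := Real.sqrt (∑' n, seqTerm k ρ a n)

/-- The pair of sequences `b` belongs to `𝐄_ρ²`. -/
def MemE2 {d : ℕ} (k : ℕ) (ρ : ℝ) (b : Fin 2 → ℕ+ → ℝ → L2 d) : Prop := ∀ ζ, MemESeq k ρ (b ζ)

/-- The norm of `𝐄_ρ²`. -/
def normE2 {d : ℕ} (k : ℕ) (ρ : ℝ) (b : Fin 2 → ℕ+ → ℝ → L2 d) : ℝ :=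
  Real.sqrt (normESeq k ρ (b 0) ^ 2 + normESeq k ρ (b 1) ^ 2)

/-! ### The boundary system -/

/-- The data of the boundary system in space dimension `d`. The index `0 : Fin 2` stands for `φ`,
the index `1 : Fin 2` for `ψ`, and `0, 1, 2 : Fin 3` for the subscripts `1, 2, 3` of the
frequencies lifted from `φ` and `ψ`. -/
structure BoundaryData (d : ℕ) where
  /-- The matrices `A_1(0), …, A_{d-1}(0)`. -/
  A : Fin (d - 1) → Matrix (Fin 3) (Fin 3) ℝ
  /-- The matrix `A_d(0)`. -/
  Ad : Matrix (Fin 3) (Fin 3) ℝ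
  /-- The boundary is noncharacteristic. -/
  isUnit_Ad : IsUnit Ad.det
  /-- The boundary frequencies `ζ = (τ, η)`, for `ζ = φ, ψ`: time component. -/
  τ : Fin 2 → ℝ
  /-- The boundary frequencies `ζ = (τ, η)`, for `ζ = φ, ψ`: tangential component. -/
  η : Fin 2 → Tan d
  /-- The normal components `ξ_j(ζ)` of the lifted frequencies `ζ_j = (τ, η, ξ_j(ζ))`. -/
  ξ : Fin 2 → Fin 3 → ℝ
  /-- The lifted frequencies are characteristic. -/
  char : ∀ ζ j, (τ ζ • (1 : Matrix (Fin 3) (Fin 3) ℝ) + ∑ i, η ζ i • A i + ξ ζ j • Ad).det = 0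
  /-- The three lifted frequencies are distinct. -/
  ξ_injective : ∀ ζ, Function.Injective (ξ ζ)
  /-- The small divisors assumption:
  `|det L(0, l₁ ζ_1 + l₃ ζ_3)| ≥ C |(l₁, l₃)|^{-m₀}` for nonzero integers `l₁, l₃`. -/
  small_divisors : ∃ C > 0, ∃ m₀ : ℝ, 0 < m₀ ∧ ∀ ζ, ∀ l₁ l₃ : ℤ, l₁ ≠ 0 → l₃ ≠ 0 →
    C * Real.sqrt ((l₁ : ℝ) ^ 2 + (l₃ : ℝ) ^ 2) ^ (-m₀) ≤
      |((l₁ * τ ζ + l₃ * τ ζ) • (1 : Matrix (Fin 3) (Fin 3) ℝ) +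
        ∑ i, (l₁ * η ζ i + l₃ * η ζ i) • A i + (l₁ * ξ ζ 0 + l₃ * ξ ζ 2) • Ad).det|
  /-- The velocities `v_ζ`. -/
  v : Fin 2 → Tan d
  /-- The coefficients `D_ζ`. -/
  D : Fin 2 → ℂ
  /-- The coefficients `w_ζ`. -/
  w : Fin 2 → ℝ
  /-- The coefficients `K_ζ`. -/
  K : Fin 2 → ℝ

namespace BoundaryData

variable {d : ℕ} (S : BoundaryData d)

/-- `δ_ζ^1 = (ξ_1 - ξ_2) / (ξ_3 - ξ_1)`. -/
def δ₁ (ζ : Fin 2) : ℝ := (S.ξ ζ 0 - S.ξ ζ 1) / (S.ξ ζ 2 - S.ξ ζ 0)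

/-- `δ_ζ^3 = (ξ_3 - ξ_2) / (ξ_3 - ξ_1)`. -/
def δ₃ (ζ : Fin 2) : ℝ := (S.ξ ζ 2 - S.ξ ζ 1) / (S.ξ ζ 2 - S.ξ ζ 0)

/-- `m` is a nonnegative number such that, for some `C > 0`, one has
`1 / |l₁ δ_ζ^1 + l₃ δ_ζ^3| ≤ C min (|l₁|^m, |l₃|^m)` for all nonzero integers `l₁, l₃` and
`ζ = φ, ψ`. Such numbers exist, see `exists_isSmallDivisorExponent`. -/
def IsSmallDivisorExponent (m : ℝ) : Prop :=
  0 ≤ m ∧ ∃ C > 0, ∀ ζ, ∀ l₁ l₃ : ℤ, l₁ ≠ 0 → l₃ ≠ 0 →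
    1 ≤ C * min (|(l₁ : ℝ)| ^ m) (|(l₃ : ℝ)| ^ m) * |l₁ * S.δ₁ ζ + l₃ * S.δ₃ ζ|

theorem det_factor {P N : Matrix (Fin 3) (Fin 3) ℝ} {x y z : ℝ} (hxy : x ≠ y) (hxz : x ≠ z)
    (hyz : y ≠ z) (hx : (P + x • N).det = 0) (hy : (P + y • N).det = 0)
    (hz : (P + z • N).det = 0) (α β : ℝ) :
    (α • P + β • N).det = N.det * ((β - α * x) * (β - α * y) * (β - α * z)) := by
  obtain ⟨c₀, c₁, c₂, hc⟩ : ∃ c₀ c₁ c₂ : ℝ, ∀ α β : ℝ, (α • P + β • N).det =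
      α ^ 3 * c₀ + α ^ 2 * β * c₁ + α * β ^ 2 * c₂ + β ^ 3 * N.det := by
    refine ⟨P.det, ((P + N).det - (P - N).det) / 2 - N.det,
      ((P + N).det + (P - N).det) / 2 - P.det, fun α β => ?_⟩
    simp only [Matrix.det_fin_three, Matrix.add_apply, Matrix.sub_apply, Matrix.smul_apply,
      smul_eq_mul]
    ring
  have hx' := hc 1 x
  have hy' := hc 1 y
  have hz' := hc 1 z
  rw [one_smul, hx] at hx'
  rw [one_smul, hy] at hy'
  rw [one_smul, hz] at hz'
  have h1 : c₁ + (x + y) * c₂ + (x ^ 2 + x * y + y ^ 2) * N.det = 0 := by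
    apply mul_left_cancel₀ (sub_ne_zero.2 hxy)
    linear_combination hy' - hx'
  have h2 : c₁ + (x + z) * c₂ + (x ^ 2 + x * z + z ^ 2) * N.det = 0 := by
    apply mul_left_cancel₀ (sub_ne_zero.2 hxz)
    linear_combination hz' - hx'
  have h3 : c₂ + (x + y + z) * N.det = 0 := by
    apply mul_left_cancel₀ (sub_ne_zero.2 hyz)
    linear_combination h1 - h2
  rw [hc]
  have e2 : c₂ = -(x + y + z) * N.det := by linear_combination h3
  have e1 : c₁ = -(x + y) * c₂ - (x ^ 2 + x * y + y ^ 2) * N.det := by linear_combination h1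
  have e0 : c₀ = -x * c₁ - x ^ 2 * c₂ - x ^ 3 * N.det := by linear_combination -hx'
  rw [e0, e1, e2]
  ring

theorem small_divisor_aux {C K m₀ δ δ' : ℝ} (hC : 0 < C) (hK : 0 ≤ K) (hm : 0 < m₀) (hδ : δ ≠ 0)
    (hδ' : δ' ≠ 0) : ∃ C' > 0, ∀ p q : ℝ, 1 ≤ |p| → 1 ≤ |q| →
      C * Real.sqrt (p ^ 2 + q ^ 2) ^ (-m₀) ≤ K * (|p| * |q| * |p * δ + q * δ'|) →
      1 ≤ C' * |p| ^ (m₀ + 2) * |p * δ + q * δ'| := by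
  have h1 : 0 < |δ| := abs_pos.2 hδ
  have h2 : 0 < |δ'| := abs_pos.2 hδ'
  set B := 2 * |δ| / |δ'| with hB
  have hBpos : 0 < B := by positivity
  refine ⟨1 / |δ| + K * B * (1 + B) ^ m₀ / C, by positivity, fun p q hp hq h => ?_⟩
  set E := |p * δ + q * δ'| with hE
  have hE0 : 0 ≤ E := abs_nonneg _
  have hpm : 1 ≤ |p| ^ (m₀ + 2) := Real.one_le_rpow hp (by linarith)
  have hp0 : 0 < |p| := by linarith
  rcases lt_or_ge |δ| E with hc | hc
  · have h3 : 1 ≤ 1 / |δ| * E := by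
      rw [one_div, inv_mul_eq_div, one_le_div h1]; exact hc.le
    have h4 : 0 ≤ K * B * (1 + B) ^ m₀ / C := by positivity
    calc 1 ≤ 1 / |δ| * E := h3
      _ = 1 / |δ| * 1 * E := by ring
      _ ≤ (1 / |δ| + K * B * (1 + B) ^ m₀ / C) * |p| ^ (m₀ + 2) * E := by
        gcongr
        linarith
  · have hq2 : |q| ≤ B * |p| := by
      have h5 : |q| * |δ'| ≤ E + |p| * |δ| := by
        rw [← abs_mul, ← abs_mul, hE]
        calc |q * δ'| = |(p * δ + q * δ') - p * δ| := by ring_nf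
          _ ≤ _ := abs_sub _ _
      have h6 : |q| * |δ'| ≤ 2 * |δ| * |p| := by nlinarith
      rw [hB, div_mul_eq_mul_div, le_div_iff₀ h2]
      exact h6
    have hr : Real.sqrt (p ^ 2 + q ^ 2) ≤ (1 + B) * |p| := by
      rw [Real.sqrt_le_left (by positivity)]
      have : |q| ^ 2 ≤ (B * |p|) ^ 2 := by gcongr
      rw [sq_abs] at this
      nlinarith [sq_abs p, mul_nonneg hBpos.le (sq_nonneg p)]
    have hr0 : 0 < Real.sqrt (p ^ 2 + q ^ 2) := by
      apply Real.sqrt_pos.2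
      nlinarith [sq_abs p, sq_nonneg q]
    have h7 : ((1 + B) * |p|) ^ (-m₀) ≤ Real.sqrt (p ^ 2 + q ^ 2) ^ (-m₀) :=
      Real.rpow_le_rpow_of_nonpos hr0 hr (by linarith)
    have h8 : C * ((1 + B) * |p|) ^ (-m₀) ≤ K * (|p| * (B * |p|) * E) := by
      refine (mul_le_mul_of_nonneg_left h7 hC.le).trans (h.trans ?_)
      gcongr
    have hX : 0 < ((1 + B) * |p|) ^ m₀ := by positivity
    rw [Real.rpow_neg (by positivity)] at h8
    have h9 : 1 ≤ K * B * (1 + B) ^ m₀ / C * |p| ^ (m₀ + 2) * E := by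
      rw [← div_eq_mul_inv, div_le_iff₀ hX, Real.mul_rpow (by positivity) hp0.le] at h8
      rw [Real.rpow_add hp0, Real.rpow_two]
      rw [div_mul_eq_mul_div, div_mul_eq_mul_div, le_div_iff₀ hC]
      linarith
    have h10 : 0 ≤ 1 / |δ| * |p| ^ (m₀ + 2) * E := by positivity
    nlinarith

/-- The small divisors assumption on the determinants provides exponents as above, so that the
choice of the exponent of the functional spaces made below is possible. -/
theorem exists_isSmallDivisorExponent : ∃ m, S.IsSmallDivisorExponent m := by
  obtain ⟨C, hC, m₀, hm₀, h⟩ := S.small_divisors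
  have hξ : ∀ ζ, S.ξ ζ 0 ≠ S.ξ ζ 1 ∧ S.ξ ζ 0 ≠ S.ξ ζ 2 ∧ S.ξ ζ 1 ≠ S.ξ ζ 2 := fun ζ =>
    ⟨(S.ξ_injective ζ).ne (by decide), (S.ξ_injective ζ).ne (by decide),
      (S.ξ_injective ζ).ne (by decide)⟩
  have key : ∀ ζ, ∃ C' > 0, ∀ l₁ l₃ : ℤ, l₁ ≠ 0 → l₃ ≠ 0 →
      1 ≤ C' * min (|(l₁ : ℝ)| ^ (m₀ + 2)) (|(l₃ : ℝ)| ^ (m₀ + 2)) *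
        |l₁ * S.δ₁ ζ + l₃ * S.δ₃ ζ| := by
    intro ζ
    obtain ⟨h01, h02, h12⟩ := hξ ζ
    have hz : S.ξ ζ 2 - S.ξ ζ 0 ≠ 0 := sub_ne_zero.2 h02.symm
    have hd1 : S.δ₁ ζ ≠ 0 := div_ne_zero (sub_ne_zero.2 h01) hz
    have hd3 : S.δ₃ ζ ≠ 0 := div_ne_zero (sub_ne_zero.2 h12.symm) hz
    have hK : 0 ≤ |S.Ad.det| * |S.ξ ζ 2 - S.ξ ζ 0| ^ 3 := by positivity
    obtain ⟨C₁, hC₁, H₁⟩ := small_divisor_aux hC hK hm₀ hd1 hd3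
    obtain ⟨C₂, hC₂, H₂⟩ := small_divisor_aux hC hK hm₀ hd3 hd1
    refine ⟨max C₁ C₂, lt_max_of_lt_left hC₁, fun l₁ l₃ h₁ h₃ => ?_⟩
    have e₁ : (1 : ℝ) ≤ |(l₁ : ℝ)| := by exact_mod_cast Int.one_le_abs h₁
    have e₃ : (1 : ℝ) ≤ |(l₃ : ℝ)| := by exact_mod_cast Int.one_le_abs h₃
    have hdet := h ζ l₁ l₃ h₁ h₃
    have hmat : ((l₁ * S.τ ζ + l₃ * S.τ ζ) • (1 : Matrix (Fin 3) (Fin 3) ℝ) +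
        ∑ i, (l₁ * S.η ζ i + l₃ * S.η ζ i) • S.A i + (l₁ * S.ξ ζ 0 + l₃ * S.ξ ζ 2) • S.Ad)
        = ((l₁ : ℝ) + l₃) • (S.τ ζ • (1 : Matrix (Fin 3) (Fin 3) ℝ) + ∑ i, S.η ζ i • S.A i)
          + (l₁ * S.ξ ζ 0 + l₃ * S.ξ ζ 2) • S.Ad := by
      rw [smul_add, Finset.smul_sum, smul_smul, add_mul]
      simp only [smul_smul, add_mul]
    rw [hmat, det_factor h01 h02 h12 (S.char ζ 0) (S.char ζ 1) (S.char ζ 2)] at hdet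
    have hfac : |S.Ad.det * ((l₁ * S.ξ ζ 0 + l₃ * S.ξ ζ 2 - ((l₁ : ℝ) + l₃) * S.ξ ζ 0) *
        (l₁ * S.ξ ζ 0 + l₃ * S.ξ ζ 2 - ((l₁ : ℝ) + l₃) * S.ξ ζ 1) *
        (l₁ * S.ξ ζ 0 + l₃ * S.ξ ζ 2 - ((l₁ : ℝ) + l₃) * S.ξ ζ 2))|
        = |S.Ad.det| * |S.ξ ζ 2 - S.ξ ζ 0| ^ 3 *
          (|(l₁ : ℝ)| * |(l₃ : ℝ)| * |l₁ * S.δ₁ ζ + l₃ * S.δ₃ ζ|) := by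
      rw [← abs_pow, ← abs_mul, ← abs_mul, ← abs_mul, ← abs_mul, ← abs_neg]
      congr 1
      unfold δ₁ δ₃
      field_simp
      ring
    rw [hfac] at hdet
    have g₁ := H₁ l₁ l₃ e₁ e₃ hdet
    have g₃ := H₂ l₃ l₁ e₃ e₁ (by
      rw [add_comm ((l₃ : ℝ) ^ 2), add_comm ((l₃ : ℝ) * _), mul_comm |(l₃ : ℝ)|]; exact hdet)
    rw [add_comm ((l₃ : ℝ) * _)] at g₃
    rcases min_choice (|(l₁ : ℝ)| ^ (m₀ + 2)) (|(l₃ : ℝ)| ^ (m₀ + 2)) with e | e <;> rw [e]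
    · refine g₁.trans ?_
      gcongr
      exact le_max_left _ _
    · refine g₃.trans ?_
      gcongr
      exact le_max_right _ _
  choose C' hC' hk using key
  refine ⟨m₀ + 2, by linarith, max (C' 0) (C' 1), lt_max_of_lt_left (hC' 0),
    fun ζ l₁ l₃ h₁ h₃ => (hk ζ l₁ l₃ h₁ h₃).trans ?_⟩
  have : C' ζ ≤ max (C' 0) (C' 1) := by
    fin_cases ζ
    · exact le_max_left _ _
    · exact le_max_right _ _
  gcongr

/-- The primitive `a(t) = ∫_0^t b(σ) dσ`. -/
def primitive (b : Fin 2 → ℕ+ → ℝ → L2 d) : Fin 2 → ℕ+ → ℝ → L2 d :=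
  fun ζ n t => ∫ σ in (0 : ℝ)..t, b ζ n σ

/-- The component of index `(ζ, n)` of
`L a - ∂_Θ D(a, a) - F(∂_Θ a, ∂_Θ a) + K(a, a)` for a pair of sequences `a` of functions of
`(y, Θ)`. -/
def rhs (a : Fin 2 → ℕ+ → L2 d) (ζ : Fin 2) (n : ℕ+) : L2 d :=
  dTan (S.v ζ) (a ζ n)
    - dTheta (S.D ζ • mulL2 (a ζ 1) (a ζ n))
    - S.w ζ • fPer (S.δ₁ ζ) (S.δ₃ ζ) (dTheta (a ζ 1)) (dTheta (a ζ n))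
    + S.K ζ • ∑ k ∈ Finset.Ico 1 n, dTheta (mulL2 (a 0 k) (a 1 (n - k)))

/-- `b` solves the integrated boundary system with source term `H` on the time interval
`(-ρ, ρ)`. -/
def IsSolution (ρ : ℝ) (H b : Fin 2 → ℕ+ → ℝ → L2 d) : Prop :=
  ∀ ζ n, ∀ t ∈ Ioo (-ρ) ρ, b ζ n t = S.rhs (fun ζ' n' => primitive b ζ' n' t) ζ n + H ζ n t

end BoundaryData

end WeaklyStable

end

/-! The system is an abstract Cauchy–Kovalevskaya problem on the scale `Y d k s`. Every operator on
the right maps `Y_{s'}` to `Y_s` for `s < s'` with norm at most `C / (s' - s)`, and all unknowns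
enter through primitives in time. No fixed point theorem is used: the equation is solved for the
Taylor coefficients at time zero.

An element of `E_ρ` is the same thing as a sequence of coefficients lying in all the `Y_s` with
bounds `M * wt ρ s ν` (`coeffBound_normE`, `memE_of_coeffBound`). These bounds make the Taylor
series converge in `Y_s` for `|t| < ρ (1 - s)`. Integration raises the order by one, so the equation
becomes a recursion in which the coefficient of order `ν` depends only on those of lower order and
on the source (`solCoeff_eq`). Hence there is exactly one formal solution (`eq_solCoeff`), which
already gives uniqueness. Existence amounts to bounding this formal solution.

The bound (`solCoeff_bound`) is an induction on `ν`. At order `ν` the loss is taken from `s' = s +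
(1 - s)/(ν + 2)` to `s`. It costs a factor `(ν + 2)/(1 - s)`, which is paid for by the factor `ν +
1` and the extra power of `1 - s` in `wt`. Powers of `1 - s'` and of `1 - s` are comparable because
`(1 + 1/(ν + 1))^ν ≤ 4`, and Cauchy products close up because the Catalan numbers satisfy their own
quadratic recursion (`sum_intWt`). Each term thereby gains a factor `128 ρ`. What remains is a
numerical inequality in the index `n` of the profiles. A majorant for it is found in a weighted `ℓ²`
space, which is an algebra for Cauchy products, as soon as `ρ` is small (`exists_majorant`).

The operators are estimated on the Fourier side, on `ℝ^{d-1} × ℤ`. A derivative is a multiplier of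
size at most a constant times the frequency, and `x ≤ e^x` converts the frequency into `1 / (s' -
s)` (`fn_mul_W_le`). Products and the small divisor operator are convolutions with a multiplier. In
the latter, the two `Θ`-derivatives are shared between the two factors. The one on the larger
frequency produces the loss, while the one on the smaller frequency, together with the divisor, is
absorbed by the polynomial weight (`multBound_perMultTheta`). This leaves an exponent `k - m - 1`,
which exceeds the integrability threshold `(d + 1)/2`. The condition on `k` also leaves room for two
derivatives, so that the difference quotients defining the derivatives converge in `L²`. -/

noncomputable section

namespace WeaklyStable

/-! ### Consistency of the Fourier integral and the `L²` Fourier transform. -/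

section FourierLOneLTwo

variable {V : Type*} [NormedAddCommGroup V] [InnerProductSpace ℝ V] [FiniteDimensional ℝ V]
  [MeasurableSpace V] [BorelSpace V]

open SchwartzMap in
/-- On `L¹ ∩ L²` the inverse Fourier integral agrees with the inverse `L²` Fourier transform. -/
theorem fourierInv_toLp_ae_eq {h : V → ℂ} (h₁ : Integrable h) (h₂ : MemLp h 2) :
    (𝓕⁻ h₂.toLp : Lp ℂ 2 (volume : Measure V)) =ᵐ[volume] 𝓕⁻ h := by
  set f : Lp ℂ 2 (volume : Measure V) := 𝓕⁻ h₂.toLp with hf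
  have hcont : Continuous (𝓕⁻ h) := by
    refine VectorFourier.fourierIntegral_continuous Real.continuous_fourierChar ?_ h₁
    simp only [LinearMap.neg_apply, innerₗ_apply_apply]
    fun_prop
  -- Duality: against a Schwartz function, both versions of the inverse transform can be moved onto
  -- the test function, where they agree. Smooth compactly supported tests then separate locally
  -- integrable functions.
  have key : ∀ g : 𝓢(V, ℂ), ∫ x, g x * f x = ∫ x, g x * 𝓕⁻ h x := by
    intro g
    have e1 : (f : 𝓢'(V, ℂ)) g = ∫ x, g x • f x := Lp.toTemperedDistribution_apply f g
    have e2 : (f : 𝓢'(V, ℂ)) g = ∫ x, (𝓕⁻ g) x • (h₂.toLp : Lp ℂ 2 (volume : Measure V)) x := by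
      rw [hf, ← Lp.fourierInv_toTemperedDistribution_eq, TemperedDistribution.fourierInv_apply,
        Lp.toTemperedDistribution_apply]
    have e3 : ∫ x, (𝓕⁻ g) x • (h₂.toLp : Lp ℂ 2 (volume : Measure V)) x
        = ∫ x, (𝓕⁻ g) x * h x := by
      refine integral_congr_ae ?_
      filter_upwards [h₂.coeFn_toLp] with x hx
      rw [hx, smul_eq_mul]
    have e4 := VectorFourier.integral_fourierIntegral_smul_eq_flip (μ := (volume : Measure V))
      (ν := (volume : Measure V)) (L := -innerₗ V) (f := h) (g := (g : V → ℂ))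
      Real.continuous_fourierChar
      (by simp only [LinearMap.neg_apply, innerₗ_apply_apply]; fun_prop) h₁ g.integrable
    have e5 : (-innerₗ V).flip = -innerₗ V := by
      ext x y; simp [real_inner_comm]
    rw [e5] at e4
    simp only [smul_eq_mul] at e1 e4
    rw [← e1, e2, e3, fourierInv_coe]
    calc ∫ x, 𝓕⁻ (g : V → ℂ) x * h x = ∫ x, h x * 𝓕⁻ (g : V → ℂ) x := by simp_rw [mul_comm]
      _ = ∫ x, 𝓕⁻ h x * g x := e4.symm
      _ = _ := by simp_rw [mul_comm]
  refine ae_eq_of_integral_contDiff_smul_eq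
    ((Lp.memLp f).locallyIntegrable (by norm_num)) hcont.locallyIntegrable ?_
  intro g hg hc
  have hc' : HasCompactSupport (fun x => (g x : ℂ)) := hc.comp_left (g := ((↑) : ℝ → ℂ)) rfl
  have hg' : ContDiff ℝ ((⊤ : ℕ∞) : WithTop ℕ∞) (fun x => (g x : ℂ)) := Complex.ofRealCLM.contDiff.comp hg
  have := key (hc'.toSchwartzMap hg')
  simpa using this

theorem memLp_fourierInv {h : V → ℂ} (h₁ : Integrable h) (h₂ : MemLp h 2) :
    MemLp (𝓕⁻ h) 2 :=
  (Lp.memLp _).ae_eq (fourierInv_toLp_ae_eq h₁ h₂)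

theorem fourier_toLp_fourierInv {h : V → ℂ} (h₁ : Integrable h) (h₂ : MemLp h 2) :
    (𝓕 (memLp_fourierInv h₁ h₂).toLp : Lp ℂ 2 (volume : Measure V)) = h₂.toLp := by
  have : (memLp_fourierInv h₁ h₂).toLp = (𝓕⁻ h₂.toLp : Lp ℂ 2 (volume : Measure V)) := by
    ext1
    exact (MemLp.coeFn_toLp _).trans (fourierInv_toLp_ae_eq h₁ h₂).symm
  rw [this, FourierTransform.fourier_fourierInv_eq]

theorem eLpNorm_fourierInv {h : V → ℂ} (h₁ : Integrable h) (h₂ : MemLp h 2) :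
    eLpNorm (𝓕⁻ h) 2 volume = eLpNorm h 2 volume := by
  have e1 := Lp.norm_fourier_eq (memLp_fourierInv h₁ h₂).toLp
  rw [fourier_toLp_fourierInv h₁ h₂, Lp.norm_toLp, Lp.norm_toLp,
    ENNReal.toReal_eq_toReal_iff' h₂.2.ne (memLp_fourierInv h₁ h₂).2.ne] at e1
  exact e1.symm

end FourierLOneLTwo

theorem eLpNorm_two_sq {α E : Type*} [MeasurableSpace α] [NormedAddCommGroup E] (f : α → E)
    (μ : Measure α) : eLpNorm f 2 μ ^ 2 = ∫⁻ x, ‖f x‖ₑ ^ 2 ∂μ := by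
  rw [eLpNorm_eq_lintegral_rpow_enorm_toReal (by norm_num) (by norm_num), ← ENNReal.rpow_natCast,
    ← ENNReal.rpow_mul]
  simp

theorem memLp_two_of_lintegral {α E : Type*} [MeasurableSpace α] [NormedAddCommGroup E] {f : α → E}
    {μ : Measure α} (hf : AEStronglyMeasurable f μ) (h : ∫⁻ x, ‖f x‖ₑ ^ 2 ∂μ < ⊤) :
    MemLp f 2 μ := by
  refine ⟨hf, ?_⟩
  rw [← eLpNorm_two_sq, ENNReal.pow_lt_top_iff] at h
  exact h.resolve_right (by norm_num)

theorem lintegral_sq_lt_top {α E : Type*} [MeasurableSpace α] [NormedAddCommGroup E] {f : α → E}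
    {μ : Measure α} (h : MemLp f 2 μ) : ∫⁻ x, ‖f x‖ₑ ^ 2 ∂μ < ⊤ := by
  rw [← eLpNorm_two_sq]
  exact ENNReal.pow_lt_top h.2

/-! ### Absolutely convergent Fourier series -/

section Series

variable {c : ℤ → ℂ}

theorem continuous_fourier_series (hc : Summable fun n => ‖c n‖) :
    Continuous fun θ : Circ => ∑' n, fourier n θ * c n := by
  refine continuous_tsum (fun n => ?_) hc fun n θ => ?_
  · fun_prop
  · simp [fourier_apply, Circle.norm_coe]

theorem fourierCoeff_series (hc : Summable fun n => ‖c n‖) (l : ℤ) :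
    fourierCoeff (fun θ : Circ => ∑' n, fourier n θ * c n) l = c l := by
  have hint : ∀ n, Integrable (fun θ : Circ => (fourier (-l) θ : ℂ) • (fourier n θ * c n))
      (AddCircle.haarAddCircle (T := 2 * Real.pi)) := fun n =>
    Continuous.integrable_of_hasCompactSupport (by fun_prop)
      (HasCompactSupport.of_compactSpace _)
  have h := hasSum_integral_of_summable_integral_norm hint (by
    simpa [norm_mul, fourier_apply, Circle.norm_coe] using hc)
  have h1 : ∀ n, ∫ θ : Circ, (fourier (-l) θ : ℂ) • (fourier n θ * c n)
      ∂(AddCircle.haarAddCircle (T := 2 * Real.pi)) = if n = l then c l else 0 := by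
    intro n
    have h2 := congrFun (fourierCoeff_fourier (T := 2 * Real.pi) n) l
    unfold fourierCoeff at h2
    simp only [smul_eq_mul, ← mul_assoc] at h2 ⊢
    rw [integral_mul_const, h2, Pi.single_apply]
    by_cases hn : n = l
    · simp [hn]
    · simp [hn, Ne.symm hn]
  simp_rw [h1, smul_eq_mul, tsum_mul_left] at h
  unfold fourierCoeff
  simp only [smul_eq_mul]
  exact ((hasSum_ite_eq l (c l)).unique h).symm

/-- Parseval for the continuous sum of the series. The form with extended nonnegative integrals
allows a later integration in `y` by Tonelli, without integrability checks. -/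
theorem lintegral_fourier_series (hc : Summable fun n => ‖c n‖) :
    ∫⁻ θ : Circ, ‖∑' n, fourier n θ * c n‖ₑ ^ 2 ∂(AddCircle.haarAddCircle (T := 2 * Real.pi))
      = ∑' n, ‖c n‖ₑ ^ 2 := by
  have hcont := continuous_fourier_series hc
  have hm : MemLp (fun θ : Circ => ∑' n, fourier n θ * c n) 2
      (AddCircle.haarAddCircle (T := 2 * Real.pi)) :=
    hcont.memLp_of_hasCompactSupport (HasCompactSupport.of_compactSpace _)
  have h := hasSum_sq_fourierCoeff hm.toLp
  simp_rw [fourierCoeff_congr_ae hm.coeFn_toLp, fourierCoeff_series hc] at h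
  have h2 : ∫ θ, ‖(MemLp.toLp _ hm : Lp ℂ 2 (AddCircle.haarAddCircle (T := 2 * Real.pi))) θ‖ ^ 2 ∂(AddCircle.haarAddCircle (T := 2 * Real.pi)) =
      ∫ θ : Circ, ‖∑' n, fourier n θ * c n‖ ^ 2
        ∂(AddCircle.haarAddCircle (T := 2 * Real.pi)) := by
    refine integral_congr_ae ?_
    filter_upwards [hm.coeFn_toLp] with θ hθ
    rw [hθ]
  rw [h2] at h
  have h3 : ∀ z : ℂ, ‖z‖ₑ ^ 2 = ENNReal.ofReal (‖z‖ ^ 2) := fun z => by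
    rw [← ofReal_norm, ENNReal.ofReal_pow (norm_nonneg _)]
  simp_rw [h3]
  rw [← ofReal_integral_eq_lintegral_ofReal, ← h.tsum_eq, ENNReal.ofReal_tsum_of_nonneg]
  · exact fun n => by positivity
  · exact h.summable
  · exact Continuous.integrable_of_hasCompactSupport (by fun_prop)
      (HasCompactSupport.of_compactSpace _)
  · exact ae_of_all _ fun θ => by positivity

end Series

/-! ### Fourier synthesis on `ℝ^{d-1} × 𝕋` -/

/-- The measure on the dual group `ℝ^{d-1} × ℤ`. -/
abbrev freqMeas (d : ℕ) : Measure (Tan d × ℤ) := (volume : Measure (Tan d)).prod Measure.count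

/-- The characters of `ℝ^{d-1} × 𝕋`. -/
def chi {d : ℕ} (p : Tan d × ℤ) (x : Tan d × Circ) : ℂ :=
  (Real.fourierChar (inner ℝ p.1 x.1) : ℂ) * fourier p.2 x.2

theorem norm_chi {d : ℕ} (p : Tan d × ℤ) (x : Tan d × Circ) : ‖chi p x‖ = 1 := by
  simp [chi, fourier_apply, Circle.norm_coe]

theorem chi_add_left {d : ℕ} (p q : Tan d × ℤ) (x : Tan d × Circ) :
    chi (p + q) x = chi p x * chi q x := by
  simp only [chi, Prod.fst_add, Prod.snd_add, inner_add_left, AddChar.map_add_eq_mul,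
    Circle.coe_mul, fourier_add]
  ring

theorem chi_add_right {d : ℕ} (p : Tan d × ℤ) (x y : Tan d × Circ) :
    chi p (x + y) = chi p x * chi p y := by
  simp only [chi, Prod.fst_add, Prod.snd_add, inner_add_right, AddChar.map_add_eq_mul,
    Circle.coe_mul, fourier_apply, smul_add, AddCircle.toCircle_add]
  ring

theorem continuous_chi_right {d : ℕ} (p : Tan d × ℤ) : Continuous (chi p) := by
  unfold chi; fun_prop

theorem continuous_chi_left {d : ℕ} (x : Tan d × Circ) : Continuous fun p => chi p x := by
  have h : Continuous fun l : ℤ => (fourier l x.2 : ℂ) := continuous_of_discreteTopology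
  unfold chi
  fun_prop

theorem measurable_chi_left {d : ℕ} (x : Tan d × Circ) : Measurable fun p => chi p x := by
  refine measurable_from_prod_countable_left fun l => ?_
  exact ((continuous_chi_left x).comp (Continuous.prodMk_left l)).measurable

/-- The inverse Fourier transform on `ℝ^{d-1} × ℤ`. -/
def synth {d : ℕ} (H : Tan d × ℤ → ℂ) (x : Tan d × Circ) : ℂ := ∫ p, chi p x * H p ∂freqMeas d

/-- The Fourier transform on `ℝ^{d-1} × 𝕋`. -/
def spec {d : ℕ} (u : L2 d) (p : Tan d × ℤ) : ℂ :=
  (𝓕 (coeff u p.2) : Lp ℂ 2 (volume : Measure (Tan d))) p.1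

theorem measurable_spec {d : ℕ} (u : L2 d) : Measurable (spec u) :=
  measurable_from_prod_countable_left fun l => (Lp.stronglyMeasurable (𝓕 (coeff u l))).measurable

theorem integrable_chi_mul {d : ℕ} {H : Tan d × ℤ → ℂ} (h : Integrable H (freqMeas d))
    (x : Tan d × Circ) : Integrable (fun p => chi p x * H p) (freqMeas d) := by
  refine h.mono ((measurable_chi_left x).aestronglyMeasurable.mul h.1) (ae_of_all _ fun p => ?_)
  rw [norm_mul, norm_chi, one_mul]

theorem continuous_synth {d : ℕ} {H : Tan d × ℤ → ℂ} (h : Integrable H (freqMeas d)) :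
    Continuous (synth H) := by
  refine continuous_of_dominated (bound := fun p => ‖H p‖)
    (fun x => (integrable_chi_mul h x).1) (fun x => ae_of_all _ fun p => ?_) h.norm
    (ae_of_all _ fun p => (continuous_chi_right p).mul continuous_const)
  rw [norm_mul, norm_chi, one_mul]

theorem integrable_freq_slice {d : ℕ} {H : Tan d × ℤ → ℂ} (h : Integrable H (freqMeas d)) (l : ℤ) :
    Integrable fun ξ => H (ξ, l) :=
  Measure.ae_count_iff.1 h.prod_left_ae l

theorem integral_intCount {f : ℤ → ℂ} (hf : Integrable f Measure.count) :
    HasSum f (∫ l, f l ∂Measure.count) := by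
  have h2 := integral_countable hf
  have h3 : ∀ l : ℤ, (Measure.count : Measure ℤ).real {l} = 1 := fun l => by
    rw [measureReal_def, Measure.count_singleton, ENNReal.toReal_one]
  simp only [h3, one_smul] at h2
  have h5 : Summable f := by
    have h4 := integrable_count_iff.1 hf
    exact Summable.of_norm h4
  rw [h2]
  exact h5.hasSum

theorem hasSum_freq_integral {d : ℕ} {H : Tan d × ℤ → ℂ} (h : Integrable H (freqMeas d)) :
    HasSum (fun l => ∫ ξ, H (ξ, l)) (∫ p, H p ∂freqMeas d) := by
  have h1 : Integrable (fun l => ∫ ξ, H (ξ, l)) (Measure.count : Measure ℤ) :=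
    h.integral_prod_right
  rw [integral_prod_symm _ h]
  exact integral_intCount h1

theorem fourierInv_slice {d : ℕ} (H : Tan d × ℤ → ℂ) (y : Tan d) (θ : Circ) (l : ℤ) :
    ∫ ξ, chi (ξ, l) (y, θ) * H (ξ, l) = fourier l θ * 𝓕⁻ (fun ξ => H (ξ, l)) y := by
  rw [Real.fourierInv_eq, ← integral_const_mul]
  refine integral_congr_ae (ae_of_all _ fun ξ => ?_)
  simp only [chi, Circle.smul_def, smul_eq_mul]
  ring

theorem norm_fourierInv_le {d : ℕ} (H : Tan d × ℤ → ℂ) (y : Tan d) (l : ℤ) :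
    ‖𝓕⁻ (fun ξ => H (ξ, l)) y‖ ≤ ∫ ξ, ‖H (ξ, l)‖ := by
  rw [Real.fourierInv_eq]
  refine (norm_integral_le_integral_norm _).trans_eq ?_
  simp [Circle.smul_def, Circle.norm_coe]

theorem summable_fourierInv {d : ℕ} {H : Tan d × ℤ → ℂ} (h : Integrable H (freqMeas d))
    (y : Tan d) : Summable fun l => ‖𝓕⁻ (fun ξ => H (ξ, l)) y‖ := by
  have h1 := (integrable_count_iff.1 h.norm.integral_prod_right)
  refine Summable.of_nonneg_of_le (fun l => norm_nonneg _) (fun l => norm_fourierInv_le H y l) ?_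
  exact h1.congr fun l => Real.norm_of_nonneg (integral_nonneg fun _ => norm_nonneg _)

/-- Fubini on the dual group: integrating in `ξ` at fixed integer frequency leaves an absolutely
convergent Fourier series in `θ`. This is the bridge to `coeffFun`. -/
theorem synth_eq_tsum {d : ℕ} {H : Tan d × ℤ → ℂ} (h : Integrable H (freqMeas d))
    (y : Tan d) (θ : Circ) :
    synth H (y, θ) = ∑' l, fourier l θ * 𝓕⁻ (fun ξ => H (ξ, l)) y := by
  rw [synth, ← (hasSum_freq_integral (integrable_chi_mul h (y, θ))).tsum_eq]
  simp_rw [fourierInv_slice]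

theorem coeffFun_synth {d : ℕ} {H : Tan d × ℤ → ℂ} (h : Integrable H (freqMeas d)) (l : ℤ)
    (y : Tan d) : coeffFun (synth H) l y = 𝓕⁻ (fun ξ => H (ξ, l)) y := by
  unfold coeffFun
  simp_rw [synth_eq_tsum h]
  exact fourierCoeff_series (summable_fourierInv h y) l

/-- Integrable and square integrable functions on the dual group. -/
structure Good {d : ℕ} (H : Tan d × ℤ → ℂ) : Prop where
  integrable : Integrable H (freqMeas d)
  memLp : MemLp H 2 (freqMeas d)

theorem lintegral_freqMeas {d : ℕ} {f : Tan d × ℤ → ℝ≥0∞} (hf : AEMeasurable f (freqMeas d)) :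
    ∫⁻ p, f p ∂freqMeas d = ∑' l, ∫⁻ ξ, f (ξ, l) := by
  rw [lintegral_prod_symm _ hf, lintegral_count]

theorem memLp_freq_slice {d : ℕ} {H : Tan d × ℤ → ℂ} (h : MemLp H 2 (freqMeas d)) (l : ℤ) :
    MemLp (fun ξ => H (ξ, l)) 2 := by
  have h1 : Integrable (fun p => ‖H p‖ ^ 2) (freqMeas d) := (memLp_two_iff_integrable_sq_norm h.1).1 h
  have h2 : AEStronglyMeasurable (fun ξ => H (ξ, l)) :=
    Measure.ae_count_iff.1 (h.1.prod_swap.prodMk_left) l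
  rw [memLp_two_iff_integrable_sq_norm h2]
  exact Measure.ae_count_iff.1 h1.prod_left_ae l

/-- Plancherel on the product group: Parseval in `θ` at fixed `y`, exchange of sum and integral,
then Plancherel in `y` for each slice. Integrability of `H` makes everything pointwise meaningful;
square integrability makes the value finite. -/
theorem lintegral_synth {d : ℕ} {H : Tan d × ℤ → ℂ} (h : Good H) :
    ∫⁻ x, ‖synth H x‖ₑ ^ 2 ∂meas d = ∫⁻ p, ‖H p‖ₑ ^ 2 ∂freqMeas d := by
  rw [lintegral_prod _ ((continuous_synth h.integrable).enorm.measurable.pow_const 2).aemeasurable,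
    lintegral_freqMeas (h.memLp.1.enorm.pow_const 2)]
  have hl := fun l => integrable_freq_slice h.integrable l
  have hl2 := fun l => memLp_freq_slice h.memLp l
  calc ∫⁻ y, ∫⁻ θ, ‖synth H (y, θ)‖ₑ ^ 2 ∂(AddCircle.haarAddCircle (T := 2 * Real.pi))
      = ∫⁻ y, ∑' l, ‖𝓕⁻ (fun ξ => H (ξ, l)) y‖ₑ ^ 2 := by
        refine lintegral_congr fun y => ?_
        simp_rw [synth_eq_tsum h.integrable]
        exact lintegral_fourier_series (summable_fourierInv h.integrable y)
    _ = ∑' l, ∫⁻ y, ‖𝓕⁻ (fun ξ => H (ξ, l)) y‖ₑ ^ 2 :=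
        lintegral_tsum fun l => (memLp_fourierInv (hl l) (hl2 l)).1.enorm.pow_const 2
    _ = _ := by
        refine tsum_congr fun l => ?_
        rw [← eLpNorm_two_sq, ← eLpNorm_two_sq, eLpNorm_fourierInv (hl l) (hl2 l)]

theorem memLp_synth {d : ℕ} {H : Tan d × ℤ → ℂ} (h : Good H) : MemLp (synth H) 2 (meas d) := by
  refine memLp_two_of_lintegral (continuous_synth h.integrable).aestronglyMeasurable ?_
  rw [lintegral_synth h]
  exact lintegral_sq_lt_top h.memLp

theorem toL2_of_ae {d : ℕ} {f g : Tan d × Circ → ℂ} (h : f =ᵐ[meas d] g) (hg : MemLp g 2 (meas d)) :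
    toL2 f = hg.toLp := by
  have hf : MemLp f 2 (meas d) := hg.ae_eq h.symm
  rw [toL2, dif_pos hf]
  exact (MemLp.toLp_eq_toLp_iff _ _).2 h

theorem coeFn_toL2 {d : ℕ} {f : Tan d × Circ → ℂ} (hf : MemLp f 2 (meas d)) :
    toL2 f =ᵐ[meas d] f := by
  rw [toL2_of_ae (Filter.EventuallyEq.refl _ _) hf]
  exact hf.coeFn_toLp

theorem coeffFun_congr {d : ℕ} {f g : Tan d × Circ → ℂ} (h : f =ᵐ[meas d] g) :
    ∀ᵐ y, ∀ l, coeffFun f l y = coeffFun g l y := by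
  filter_upwards [Measure.ae_ae_of_ae_prod h] with y hy l
  exact congrFun (fourierCoeff_congr_ae hy) l

/-- Slice by slice in the integer frequency, this is the agreement on `L¹ ∩ L²` of the inverse
Fourier integral with the `L²` transform. -/
theorem spec_of_ae {d : ℕ} {u : L2 d} {H : Tan d × ℤ → ℂ} (h : Good H)
    (hu : u =ᵐ[meas d] synth H) : spec u =ᵐ[freqMeas d] H := by
  refine ae_prod_int fun l => ?_
  have hl := integrable_freq_slice h.integrable l
  have hl2 := memLp_freq_slice h.memLp l
  have h1 : coeff u l = (memLp_fourierInv hl hl2).toLp := by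
    refine (MemLp.toLp_eq_toLp_iff _ _).2 ?_
    filter_upwards [coeffFun_congr hu] with y hy
    rw [hy, coeffFun_synth h.integrable]
  have h2 : (𝓕 (coeff u l) : Lp ℂ 2 (volume : Measure (Tan d))) = hl2.toLp := by
    rw [h1, fourier_toLp_fourierInv hl hl2]
  filter_upwards [hl2.coeFn_toLp] with ξ hξ
  simp only [spec]
  rw [h2, hξ]

/-- The function with a given Fourier transform. -/
def syn {d : ℕ} (H : Tan d × ℤ → ℂ) : L2 d := toL2 (synth H)

theorem coeFn_syn {d : ℕ} {H : Tan d × ℤ → ℂ} (h : Good H) : syn H =ᵐ[meas d] synth H :=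
  coeFn_toL2 (memLp_synth h)

theorem spec_syn {d : ℕ} {H : Tan d × ℤ → ℂ} (h : Good H) : spec (syn H) =ᵐ[freqMeas d] H :=
  spec_of_ae h (coeFn_syn h)

theorem ae_slice {d : ℕ} {p : Tan d × ℤ → Prop} (h : ∀ᵐ z ∂freqMeas d, p z) (l : ℤ) :
    ∀ᵐ ξ : Tan d, p (ξ, l) := by
  filter_upwards [Measure.ae_ae_of_ae_prod h] with ξ hξ
  exact Measure.ae_count_iff.1 hξ l

theorem spec_add {d : ℕ} (u v : L2 d) : spec (u + v) =ᵐ[freqMeas d] spec u + spec v := by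
  refine ae_prod_int fun l => ?_
  have h := Lp.coeFn_add (𝓕 (coeff u l) : Lp ℂ 2 (volume : Measure (Tan d))) (𝓕 (coeff v l))
  rw [← FourierTransform.fourier_add, ← coeff_add] at h
  exact h

theorem spec_smul {d : ℕ} (c : ℂ) (u : L2 d) : spec (c • u) =ᵐ[freqMeas d] c • spec u := by
  refine ae_prod_int fun l => ?_
  have h := Lp.coeFn_smul c (𝓕 (coeff u l) : Lp ℂ 2 (volume : Measure (Tan d)))
  rw [← FourierTransform.fourier_smul, ← coeff_smul] at h
  exact h

theorem spec_injective {d : ℕ} {u v : L2 d} (h : spec u =ᵐ[freqMeas d] spec v) : u = v := by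
  rw [← sub_eq_zero]
  refine eq_zero_of_coeff _ fun l => ?_
  have h1 : (𝓕 (coeff u l) : Lp ℂ 2 (volume : Measure (Tan d))) = 𝓕 (coeff v l) :=
    Lp.ext (ae_slice h l)
  have h2 : coeff u l = coeff v l :=
    (Lp.fourierTransformₗᵢ (Tan d) ℂ).injective h1
  rw [sub_eq_add_neg, ← neg_one_smul ℂ v, coeff_add, coeff_smul, h2]
  simp

/-- Fourier inversion, by injectivity of `spec`. Identities in `L²` are reduced through it to almost
everywhere identities between frequency functions. -/
theorem syn_spec {d : ℕ} {u : L2 d} {H : Tan d × ℤ → ℂ} (hH : Good H)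
    (h : spec u =ᵐ[freqMeas d] H) : u = syn H :=
  spec_injective (h.trans (spec_syn hH).symm)

theorem enorm_syn {d : ℕ} {H : Tan d × ℤ → ℂ} (h : Good H) :
    ‖syn H‖ₑ = eLpNorm H 2 (freqMeas d) := by
  rw [Lp.enorm_def, eLpNorm_congr_ae (coeFn_syn h)]
  refine (ENNReal.pow_right_strictMono (n := 2) (by norm_num)).injective ?_
  simp only [eLpNorm_two_sq, lintegral_synth h]

theorem Good.congr {d : ℕ} {H G : Tan d × ℤ → ℂ} (h : Good H) (e : H =ᵐ[freqMeas d] G) : Good G :=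
  ⟨h.1.congr e, h.2.ae_eq e⟩

theorem Good.add {d : ℕ} {H G : Tan d × ℤ → ℂ} (h : Good H) (g : Good G) : Good (H + G) :=
  ⟨h.1.add g.1, h.2.add g.2⟩

theorem Good.smul {d : ℕ} {H : Tan d × ℤ → ℂ} (h : Good H) (c : ℂ) : Good (c • H) :=
  ⟨h.1.smul c, h.2.const_smul c⟩

theorem Good.mul_bounded {d : ℕ} {H : Tan d × ℤ → ℂ} (h : Good H) {f : Tan d × ℤ → ℂ}
    (hf : Measurable f) {C : ℝ} (hb : ∀ p, ‖f p‖ ≤ C) : Good (fun p => f p * H p) :=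
  ⟨h.1.bdd_mul hf.aestronglyMeasurable (ae_of_all _ hb),
    h.2.of_le_mul (c := C) (hf.aestronglyMeasurable.mul h.2.1) (ae_of_all _ fun p => by
      rw [norm_mul]; gcongr; exact hb p)⟩

theorem syn_add {d : ℕ} {H G : Tan d × ℤ → ℂ} (h : Good H) (g : Good G) :
    syn (H + G) = syn H + syn G := by
  refine (syn_spec (h.add g) ?_).symm
  exact (spec_add _ _).trans ((spec_syn h).add (spec_syn g))

theorem syn_smul {d : ℕ} {H : Tan d × ℤ → ℂ} (h : Good H) (c : ℂ) :
    syn (c • H) = c • syn H := by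
  refine (syn_spec (h.smul c) ?_).symm
  exact (spec_smul _ _).trans ((spec_syn h).const_smul c)

theorem syn_congr {d : ℕ} {H G : Tan d × ℤ → ℂ} (h : Good H) (e : H =ᵐ[freqMeas d] G) :
    syn H = syn G :=
  syn_spec (h.congr e) ((spec_syn h).trans e)

/-! ### Weights -/

/-- The modulus of the frequency, in the normalisation of `spec`. -/
def fn {d : ℕ} (p : Tan d × ℤ) : ℝ := freqNorm p.2 ((2 * Real.pi) • p.1)

/-- The square of the Japanese bracket. -/
def jb {d : ℕ} (p : Tan d × ℤ) : ℝ := 1 + fn p ^ 2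

/-- The square root of the weight. -/
def W {d : ℕ} (k : ℕ) (s : ℝ) (p : Tan d × ℤ) : ℝ :=
  Real.sqrt (yWeight k s p.2 ((2 * Real.pi) • p.1))

theorem fn_nonneg {d : ℕ} (p : Tan d × ℤ) : 0 ≤ fn p := Real.sqrt_nonneg _

theorem fn_sq {d : ℕ} (p : Tan d × ℤ) : fn p ^ 2 = (p.2 : ℝ) ^ 2 + ‖(2 * Real.pi) • p.1‖ ^ 2 :=
  Real.sq_sqrt (by positivity)

theorem one_le_jb {d : ℕ} (p : Tan d × ℤ) : 1 ≤ jb p := by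
  unfold jb; nlinarith [sq_nonneg (fn p)]

theorem jb_pos {d : ℕ} (p : Tan d × ℤ) : 0 < jb p := one_pos.trans_le (one_le_jb p)

theorem W_sq {d : ℕ} (k : ℕ) (s : ℝ) (p : Tan d × ℤ) :
    W k s p ^ 2 = Real.exp (2 * s * fn p) * jb p ^ k :=
  Real.sq_sqrt (yWeight_pos _ _ _ _).le

theorem W_pos {d : ℕ} (k : ℕ) (s : ℝ) (p : Tan d × ℤ) : 0 < W k s p :=
  Real.sqrt_pos.2 (yWeight_pos _ _ _ _)

theorem W_eq {d : ℕ} (k : ℕ) (s : ℝ) (p : Tan d × ℤ) :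
    W k s p = Real.exp (s * fn p) * jb p ^ ((k : ℝ) / 2) := by
  refine (sq_eq_sq₀ (W_pos k s p).le (mul_nonneg (Real.exp_pos _).le
    (Real.rpow_nonneg (jb_pos p).le _))).1 ?_
  rw [W_sq, mul_pow, ← Real.exp_nat_mul, ← Real.rpow_natCast (jb p ^ ((k : ℝ) / 2)),
    ← Real.rpow_mul (jb_pos p).le, ← Real.rpow_natCast (jb p)]
  congr 2
  · push_cast; ring
  · push_cast; ring

theorem jb_rpow_le_W {d : ℕ} (k : ℕ) {s : ℝ} (h : 0 ≤ s) (p : Tan d × ℤ) :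
    jb p ^ ((k : ℝ) / 2) ≤ W k s p := by
  rw [W_eq]
  refine le_mul_of_one_le_left (Real.rpow_nonneg (jb_pos p).le _) ?_
  exact Real.one_le_exp (mul_nonneg h (fn_nonneg p))

theorem one_le_W {d : ℕ} (k : ℕ) {s : ℝ} (h : 0 ≤ s) (p : Tan d × ℤ) : 1 ≤ W k s p :=
  (Real.one_le_rpow (one_le_jb p) (by positivity)).trans (jb_rpow_le_W k h p)

theorem measurable_fn {d : ℕ} : Measurable (fn : Tan d × ℤ → ℝ) := by
  refine measurable_from_prod_countable_left fun l => ?_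
  have : Continuous fun ξ : Tan d => fn (ξ, l) := by unfold fn freqNorm; fun_prop
  exact this.measurable

theorem measurable_jb {d : ℕ} : Measurable (jb : Tan d × ℤ → ℝ) :=
  (measurable_fn.pow_const 2).const_add 1

theorem measurable_W {d : ℕ} (k : ℕ) (s : ℝ) : Measurable (W k s : Tan d × ℤ → ℝ) := by
  have : (W k s : Tan d × ℤ → ℝ) = fun p => Real.exp (s * fn p) * jb p ^ ((k : ℝ) / 2) :=
    funext fun p => W_eq k s p
  rw [this]
  exact (measurable_fn.const_mul s).exp.mul (measurable_jb.pow_const _)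

theorem fn_add_le {d : ℕ} (p q : Tan d × ℤ) : fn (p + q) ≤ fn p + fn q := by
  have hp := fn_nonneg p
  have hq := fn_nonneg q
  refine abs_le_of_sq_le_sq' ?_ (by positivity) |>.2
  rw [add_sq, fn_sq, fn_sq, fn_sq]
  set x := (2 * Real.pi) • p.1
  set y := (2 * Real.pi) • q.1
  have h1 : ‖(2 * Real.pi) • (p + q).1‖ ≤ ‖x‖ + ‖y‖ := by
    rw [Prod.fst_add, smul_add]; exact norm_add_le _ _
  have h2 : ‖(2 * Real.pi) • (p + q).1‖ ^ 2 ≤ (‖x‖ + ‖y‖) ^ 2 := by gcongr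
  -- Cauchy–Schwarz in `ℝ²` for the pairs of integer frequency and length of the continuous one.
  have h3 : (p.2 : ℝ) * q.2 + ‖x‖ * ‖y‖ ≤ fn p * fn q := by
    refine abs_le_of_sq_le_sq' ?_ (by positivity) |>.2
    rw [mul_pow, fn_sq, fn_sq]
    nlinarith [sq_nonneg ((p.2 : ℝ) * ‖y‖ - q.2 * ‖x‖)]
  have h4 : (((p + q).2 : ℤ) : ℝ) = p.2 + q.2 := by rw [Prod.snd_add]; push_cast; ring
  rw [h4]
  nlinarith

theorem abs_snd_le_fn {d : ℕ} (p : Tan d × ℤ) : |(p.2 : ℝ)| ≤ fn p := by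
  rw [← Real.sqrt_sq_eq_abs]
  exact Real.sqrt_le_sqrt (by simp)

theorem norm_fst_le_fn {d : ℕ} (p : Tan d × ℤ) : 2 * Real.pi * ‖p.1‖ ≤ fn p := by
  have : 2 * Real.pi * ‖p.1‖ = ‖(2 * Real.pi) • p.1‖ := by
    rw [norm_smul, Real.norm_of_nonneg (by positivity)]
  rw [this]
  exact Real.le_sqrt_of_sq_le (by nlinarith [sq_nonneg (p.2 : ℝ)])

theorem summable_one_div_one_add_sq : Summable fun l : ℤ => 1 / (1 + (l : ℝ) ^ 2) := by
  refine Summable.of_norm_bounded_eventually (Real.summable_one_div_int_pow.2 one_lt_two) ?_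
  filter_upwards [(Set.finite_singleton (0 : ℤ)).compl_mem_cofinite] with l hl
  have : (l : ℝ) ≠ 0 := by exact_mod_cast hl
  rw [Real.norm_of_nonneg (by positivity)]
  gcongr
  linarith

/-- One power of `jb` is spent on the summation in the integer frequency, and the remaining `σ - 1`
on the integral over `ℝ^{d-1}`, which converges when `2 (σ - 1) > d - 1`. This is the origin of the
threshold `(d + 1)/2`. -/
theorem integrable_jb {d : ℕ} (hd : 2 ≤ d) {σ : ℝ} (hσ : ((d : ℝ) + 1) / 2 < σ) :
    Integrable (fun p => jb p ^ (-σ)) (freqMeas d) := by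
  have h1 : Integrable (fun ξ : Tan d => (1 + ‖ξ‖ ^ 2) ^ (-(2 * (σ - 1)) / 2)) := by
    refine integrable_rpow_neg_one_add_norm_sq ?_
    rw [finrank_euclideanSpace_fin, Nat.cast_sub (by omega)]
    push_cast
    linarith
  have h2 : Integrable (fun l : ℤ => 1 / (1 + (l : ℝ) ^ 2)) Measure.count :=
    integrable_count_iff.2 summable_one_div_one_add_sq.norm
  refine (h1.mul_prod h2).mono' (measurable_jb.pow_const _).aestronglyMeasurable
    (ae_of_all _ fun p => ?_)
  have hp := jb_pos p
  have e1 : 1 + (p.2 : ℝ) ^ 2 ≤ jb p := by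
    unfold jb; rw [fn_sq]; nlinarith [sq_nonneg ‖(2 * Real.pi) • p.1‖]
  have e2 : 1 + ‖p.1‖ ^ 2 ≤ jb p := by
    have h3 : ‖p.1‖ ≤ fn p := by
      refine le_trans ?_ (norm_fst_le_fn p)
      exact le_mul_of_one_le_left (norm_nonneg _) (by linarith [Real.two_le_pi])
    unfold jb; gcongr
  have hd' : (2 : ℝ) ≤ d := by exact_mod_cast hd
  rw [Real.norm_of_nonneg (by positivity)]
  have e3 : jb p ^ (-σ) = jb p ^ (-(2 * (σ - 1)) / 2) * jb p ^ (-1 : ℝ) := by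
    rw [← Real.rpow_add hp]; congr 1; ring
  rw [e3]
  gcongr ?_ * ?_
  · exact Real.rpow_le_rpow_of_nonpos (by positivity) e2 (by linarith)
  · rw [Real.rpow_neg_one, ← one_div]
    gcongr

/-! ### The norms of `Y_s` in terms of `spec` -/

/-- The scaling constant between the two normalisations of the Fourier transform. -/
def kapE (d : ℕ) : ℝ≥0∞ :=
  ENNReal.ofReal |((2 * Real.pi)⁻¹ ^ Module.finrank ℝ (Tan d))⁻¹|

theorem kapE_pos (d : ℕ) : kapE d ≠ 0 := by
  simp [kapE]

theorem kapE_lt_top (d : ℕ) : kapE d ≠ ⊤ := ENNReal.ofReal_ne_top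

theorem lintegral_dilate {d : ℕ} {F : Tan d → ℝ≥0∞} (hF : Measurable F) :
    ∫⁻ ξ, F ((2 * Real.pi)⁻¹ • ξ) = kapE d * ∫⁻ ξ, F ξ := by
  have hc : (2 * Real.pi)⁻¹ ≠ 0 := inv_ne_zero Real.two_pi_pos.ne'
  rw [← lintegral_map (g := fun ξ : Tan d => (2 * Real.pi)⁻¹ • ξ) hF (measurable_const_smul _),
    Measure.map_addHaar_smul _ hc, lintegral_smul_measure]
  rfl

/-- The weighted `L²` norm of the Fourier transform. -/
def wn {d : ℕ} (k : ℕ) (s : ℝ) (u : L2 d) : ℝ≥0∞ :=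
  eLpNorm (fun p => (W k s p : ℂ) * spec u p) 2 (freqMeas d)

theorem enorm_W_mul_sq {d : ℕ} (k : ℕ) (s : ℝ) (p : Tan d × ℤ) (z : ℂ) :
    ‖(W k s p : ℂ) * z‖ₑ ^ 2 =
      ENNReal.ofReal (yWeight k s p.2 ((2 * Real.pi) • p.1)) * ‖z‖ₑ ^ 2 := by
  rw [enorm_mul, mul_pow]
  congr 1
  rw [← ofReal_norm, ← ENNReal.ofReal_pow (norm_nonneg _), Complex.norm_real,
      Real.norm_eq_abs, sq_abs, W, Real.sq_sqrt (yWeight_pos k s _ _).le]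

theorem measurable_W_spec {d : ℕ} (k : ℕ) (s : ℝ) (u : L2 d) :
    Measurable fun p => (W k s p : ℂ) * spec u p :=
  (Complex.measurable_ofReal.comp (measurable_W k s)).mul (measurable_spec u)

/-- A dilation of `ξ` by `2π` relates the two conventions of the Fourier transform, and only its
Jacobian appears. All later estimates can thus be made with `spec` and `W`. -/
theorem yNormSq_eq_wn {d : ℕ} (k : ℕ) (s : ℝ) (u : L2 d) :
    yNormSq k s u = kapE d * wn k s u ^ 2 := by
  have hm : ∀ l, Measurable fun ξ : Tan d => ‖(W k s (ξ, l) : ℂ) * spec u (ξ, l)‖ₑ ^ 2 := fun l =>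
    ((measurable_W_spec k s u).comp measurable_prodMk_right).enorm.pow_const 2
  have h := lintegral_dilate
    (F := fun ξ : Tan d => ∑' l : ℤ, ‖(W k s (ξ, l) : ℂ) * spec u (ξ, l)‖ₑ ^ 2)
    (Measurable.tsum hm)
  rw [wn, eLpNorm_two_sq, lintegral_prod _ ((measurable_W_spec k s u).enorm.pow_const 2).aemeasurable]
  simp_rw [lintegral_count]
  rw [← h, yNormSq]
  refine lintegral_congr fun ξ => tsum_congr fun l => ?_
  rw [enorm_W_mul_sq, smul_inv_smul₀ Real.two_pi_pos.ne']
  rfl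

theorem mem_ySub_iff {d k : ℕ} {s : ℝ} {u : L2 d} : u ∈ ySub d k s ↔ wn k s u < ⊤ := by
  change yNormSq k s u < ⊤ ↔ _
  rw [yNormSq_eq_wn, ENNReal.mul_lt_top_iff, ENNReal.pow_lt_top_iff]
  simp [kapE_pos, (kapE_lt_top d).lt_top]
  exact fun h => by simp [h]

theorem mem_ySub_iff_memLp {d k : ℕ} {s : ℝ} {u : L2 d} : u ∈ ySub d k s ↔
    MemLp (fun p => (W k s p : ℂ) * spec u p) 2 (freqMeas d) := by
  rw [mem_ySub_iff]
  exact ⟨fun h => ⟨(measurable_W_spec k s u).aestronglyMeasurable, h⟩, fun h => h.2⟩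

/-- The scaling constant between the two normalisations of the norms. -/
def kap (d : ℕ) : ℝ := Real.sqrt (kapE d).toReal

theorem kap_pos (d : ℕ) : 0 < kap d :=
  Real.sqrt_pos.2 (ENNReal.toReal_pos (kapE_pos d) (kapE_lt_top d))

/-- The norm of `Y_s`, as a function on `L²`. -/
def nrm {d : ℕ} (k : ℕ) (s : ℝ) (u : L2 d) : ℝ := Real.sqrt (yNormSq k s u).toReal

theorem nrm_eq {d : ℕ} (k : ℕ) (s : ℝ) (u : L2 d) : nrm k s u = kap d * (wn k s u).toReal := by
  rw [nrm, yNormSq_eq_wn, ENNReal.toReal_mul, Real.sqrt_mul ENNReal.toReal_nonneg,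
    ENNReal.toReal_pow, Real.sqrt_sq ENNReal.toReal_nonneg, kap]

theorem nrm_nonneg {d : ℕ} (k : ℕ) (s : ℝ) (u : L2 d) : 0 ≤ nrm k s u := Real.sqrt_nonneg _

/-- An element of `Y_s`. -/
def Y.mk {d k : ℕ} {s : ℝ} (u : L2 d) (h : u ∈ ySub d k s) : Y d k s := (⟨u, h⟩ : ySub d k s)

theorem Y.incl_mk {d k : ℕ} {s : ℝ} (u : L2 d) (h : u ∈ ySub d k s) : (Y.mk u h).incl = u := rfl

theorem Y.mem {d k : ℕ} {s : ℝ} (u : Y d k s) : u.incl ∈ ySub d k s := u.2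

theorem Y.incl_injective {d k : ℕ} {s : ℝ} :
    Function.Injective (Y.incl : Y d k s →ₗ[ℂ] L2 d) := Subtype.val_injective

theorem Y.norm_eq_nrm {d k : ℕ} {s : ℝ} (u : Y d k s) : ‖u‖ = nrm k s u.incl := rfl

theorem nrm_add_le {d k : ℕ} {s : ℝ} {u v : L2 d} (hu : u ∈ ySub d k s) (hv : v ∈ ySub d k s) :
    nrm k s (u + v) ≤ nrm k s u + nrm k s v :=
  norm_add_le (Y.mk u hu) (Y.mk v hv)

theorem nrm_smul {d k : ℕ} {s : ℝ} {u : L2 d} (hu : u ∈ ySub d k s) (c : ℂ) :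
    nrm k s (c • u) = ‖c‖ * nrm k s u :=
  norm_smul c (Y.mk u hu)

theorem nrm_zero {d : ℕ} (k : ℕ) (s : ℝ) : nrm k s (0 : L2 d) = 0 :=
  norm_zero (E := Y d k s)

theorem nrm_sum_le {d k : ℕ} {s : ℝ} {ι : Type*} (t : Finset ι) {u : ι → L2 d}
    (hu : ∀ i ∈ t, u i ∈ ySub d k s) : nrm k s (∑ i ∈ t, u i) ≤ ∑ i ∈ t, nrm k s (u i) := by
  classical
  induction t using Finset.induction_on with
  | empty => simp [nrm_zero]
  | insert a t ha ih =>
    rw [Finset.sum_insert ha, Finset.sum_insert ha]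
    have h1 : ∀ i ∈ t, u i ∈ ySub d k s := fun i hi => hu i (Finset.mem_insert_of_mem hi)
    exact (nrm_add_le (hu a (Finset.mem_insert_self a t)) (Submodule.sum_mem _ h1)).trans
      (by gcongr; exact ih h1)

theorem wn_le_of_le {d k : ℕ} {s s' : ℝ} {u v : L2 d} {C : ℝ}
    (h : ∀ᵐ p ∂freqMeas d, ‖(W k s p : ℂ) * spec v p‖ ≤ C * ‖(W k s' p : ℂ) * spec u p‖) :
    wn k s v ≤ ENNReal.ofReal C * wn k s' u :=
  eLpNorm_le_mul_eLpNorm_of_ae_le_mul h 2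

theorem mem_and_nrm_le_of_wn {d k : ℕ} {s s' : ℝ} {u v : L2 d} {C : ℝ} (hC : 0 ≤ C)
    (hu : u ∈ ySub d k s') (h : wn k s v ≤ ENNReal.ofReal C * wn k s' u) :
    v ∈ ySub d k s ∧ nrm k s v ≤ C * nrm k s' u := by
  have hu' := mem_ySub_iff.1 hu
  have hfin : ENNReal.ofReal C * wn k s' u < ⊤ := ENNReal.mul_lt_top ENNReal.ofReal_lt_top hu'
  refine ⟨mem_ySub_iff.2 (h.trans_lt hfin), ?_⟩
  rw [nrm_eq, nrm_eq]
  have := ENNReal.toReal_mono hfin.ne h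
  rw [ENNReal.toReal_mul, ENNReal.toReal_ofReal hC] at this
  calc kap d * (wn k s v).toReal ≤ kap d * (C * (wn k s' u).toReal) := by
        gcongr; exact (kap_pos d).le
    _ = _ := by ring

theorem mem_and_nrm_le_of_le {d k : ℕ} {s s' : ℝ} {u v : L2 d} {C : ℝ} (hC : 0 ≤ C)
    (hu : u ∈ ySub d k s')
    (h : ∀ᵐ p ∂freqMeas d, ‖(W k s p : ℂ) * spec v p‖ ≤ C * ‖(W k s' p : ℂ) * spec u p‖) :
    v ∈ ySub d k s ∧ nrm k s v ≤ C * nrm k s' u :=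
  mem_and_nrm_le_of_wn hC hu (wn_le_of_le h)

/-- Write `g H = (g / W)(W H)`. The first factor is square integrable, so Cauchy–Schwarz gives
integrability; it is also bounded, so the product stays square integrable. -/
theorem good_of_weight {d : ℕ} (hd : 2 ≤ d) {k : ℕ} {s : ℝ} {H g : Tan d × ℤ → ℂ}
    (hH : MemLp (fun p => (W k s p : ℂ) * H p) 2 (freqMeas d)) (hg : Measurable g) {C σ : ℝ}
    (hσ : ((d : ℝ) + 1) / 2 < σ) (hC : 0 ≤ C)
    (hb : ∀ p, ‖g p‖ ≤ C * (W k s p * jb p ^ (-σ / 2))) : Good fun p => g p * H p := by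
  have hd' : (2 : ℝ) ≤ d := by exact_mod_cast hd
  set a : Tan d × ℤ → ℂ := fun p => ((g p / W k s p : ℂ)) with ha
  have ham : Measurable a := hg.div (Complex.measurable_ofReal.comp (measurable_W k s))
  have hab : ∀ p, ‖a p‖ ≤ C * jb p ^ (-σ / 2) := fun p => by
    rw [ha, norm_div, Complex.norm_real, Real.norm_of_nonneg (W_pos _ _ _).le,
      div_le_iff₀ (W_pos _ _ _)]
    refine (hb p).trans_eq (by ring)
  have hfac : (fun p => g p * H p) = fun p => a p * ((W k s p : ℂ) * H p) := by
    ext p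
    have : (W k s p : ℂ) ≠ 0 := Complex.ofReal_ne_zero.2 (W_pos k s p).ne'
    rw [ha]; field_simp
  have ha2 : MemLp a 2 (freqMeas d) := by
    rw [memLp_two_iff_integrable_sq_norm ham.aestronglyMeasurable]
    refine ((integrable_jb hd hσ).const_mul (C ^ 2)).mono'
      (ham.norm.pow_const 2).aestronglyMeasurable (ae_of_all _ fun p => ?_)
    have hp := jb_pos p
    rw [Real.norm_of_nonneg (by positivity)]
    calc ‖a p‖ ^ 2 ≤ (C * jb p ^ (-σ / 2)) ^ 2 := by gcongr; exact hab p
      _ = _ := by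
        rw [mul_pow, ← Real.rpow_natCast (jb p ^ (-σ / 2)), ← Real.rpow_mul hp.le]
        congr 2; push_cast; ring
  rw [hfac]
  refine ⟨ha2.integrable_mul hH, ?_⟩
  refine hH.of_le_mul (c := C) (ham.aestronglyMeasurable.mul hH.1) (ae_of_all _ fun p => ?_)
  rw [norm_mul]
  gcongr
  refine (hab p).trans (mul_le_of_le_one_right hC ?_)
  exact Real.rpow_le_one_of_one_le_of_nonpos (one_le_jb p) (by linarith)

/-- Powers of the frequency times the Fourier transform of an element of `Y_s`. -/
theorem good_mul_spec {d : ℕ} (hd : 2 ≤ d) {k : ℕ} {s : ℝ} (hs : 0 ≤ s) {u : L2 d}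
    (hu : u ∈ ySub d k s) {g : Tan d × ℤ → ℂ} (hg : Measurable g) {C : ℝ} {j : ℕ}
    (hj : ((d : ℝ) + 1) / 2 + j < k) (hC : 0 ≤ C) (hb : ∀ p, ‖g p‖ ≤ C * jb p ^ ((j : ℝ) / 2)) :
    Good fun p => g p * spec u p := by
  refine good_of_weight hd (mem_ySub_iff_memLp.1 hu) hg (σ := k - j) (by linarith) hC fun p => ?_
  refine (hb p).trans ?_
  gcongr
  have hp := jb_pos p
  calc jb p ^ ((j : ℝ) / 2) = jb p ^ ((k : ℝ) / 2) * jb p ^ (-((k : ℝ) - j) / 2) := by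
        rw [← Real.rpow_add hp]; congr 1; ring
    _ ≤ _ := by gcongr; exact jb_rpow_le_W k hs p

theorem good_spec {d : ℕ} (hd : 2 ≤ d) {k : ℕ} {s : ℝ} (hs : 0 ≤ s) {u : L2 d}
    (hu : u ∈ ySub d k s) (hk : ((d : ℝ) + 1) / 2 < k) : Good (spec u) := by
  have := good_mul_spec hd hs hu (g := fun _ => 1) measurable_const (C := 1) (j := 0)
    (by simpa using hk) zero_le_one (by simp)
  simpa using this

theorem norm_le_nrm {d : ℕ} (hd : 2 ≤ d) {k : ℕ} {s : ℝ} (hs : 0 ≤ s) {u : L2 d}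
    (hu : u ∈ ySub d k s) (hk : ((d : ℝ) + 1) / 2 < k) : ‖u‖ ≤ (kap d)⁻¹ * nrm k s u := by
  have hg := good_spec hd hs hu hk
  have h1 : u = syn (spec u) := syn_spec hg (Filter.EventuallyEq.refl _ _)
  have h2 : ‖u‖ₑ ≤ wn k s u := by
    rw [h1, enorm_syn hg, ← h1]
    refine eLpNorm_mono fun p => ?_
    rw [norm_mul, Complex.norm_real, Real.norm_of_nonneg (W_pos _ _ _).le]
    exact le_mul_of_one_le_left (norm_nonneg _) (one_le_W k hs p)
  rw [nrm_eq, inv_mul_cancel_left₀ (kap_pos d).ne', ← toReal_enorm]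
  exact ENNReal.toReal_mono (mem_ySub_iff.1 hu).ne h2

/-- The inclusion of `Y_s` in `L²` is continuous. -/
def inclL {d : ℕ} (hd : 2 ≤ d) {k : ℕ} {s : ℝ} (hs : 0 ≤ s) (hk : ((d : ℝ) + 1) / 2 < k) :
    Y d k s →L[ℂ] L2 d :=
  Y.incl.mkContinuous (kap d)⁻¹ fun u => norm_le_nrm hd hs u.mem hk

/-- The weighted Fourier transform, as a linear map. -/
def specL (d k : ℕ) (s : ℝ) : Y d k s →ₗ[ℂ] Lp ℂ 2 (freqMeas d) where
  toFun u := (mem_ySub_iff_memLp.1 u.mem).toLp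
  map_add' u v := by
    rw [← MemLp.toLp_add]
    refine (MemLp.toLp_eq_toLp_iff _ _).2 ?_
    filter_upwards [spec_add u.incl v.incl] with p hp
    rw [map_add, hp]
    simp only [Pi.add_apply]
    ring
  map_smul' c u := by
    rw [RingHom.id_apply, ← MemLp.toLp_const_smul]
    refine (MemLp.toLp_eq_toLp_iff _ _).2 ?_
    filter_upwards [spec_smul c u.incl] with p hp
    rw [map_smul, hp]
    simp only [Pi.smul_apply, smul_eq_mul]
    ring

theorem norm_specL {d k : ℕ} {s : ℝ} (u : Y d k s) : ‖u‖ = kap d * ‖specL d k s u‖ := by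
  rw [Y.norm_eq_nrm, nrm_eq]
  congr 1
  exact (Lp.norm_toLp _ (mem_ySub_iff_memLp.1 u.mem)).symm

/-- A square integrable function divided by the weight is `Good`, hence can be synthesised.
Completeness of `Y_s` follows, since `specL` is then an isometry onto an `L²` space up to the factor
`kap d`. -/
theorem specL_surjective {d : ℕ} (hd : 2 ≤ d) {k : ℕ} {s : ℝ} (hs : 0 ≤ s)
    (hk : ((d : ℝ) + 1) / 2 < k) : Function.Surjective (specL d k s) := by
  intro g
  have hWm := Complex.measurable_ofReal.comp (measurable_W (d := d) k s)
  have hW : ∀ p : Tan d × ℤ, (W k s p : ℂ) ≠ 0 := fun p =>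
    Complex.ofReal_ne_zero.2 (W_pos k s p).ne'
  set H : Tan d × ℤ → ℂ := fun p => g p / W k s p with hH
  have hWH : (fun p => (W k s p : ℂ) * H p) = g := by
    ext p; rw [hH]; exact mul_div_cancel₀ _ (hW p)
  have hgood : Good H := by
    have h := good_of_weight hd (H := H) (k := k) (s := s) (by rw [hWH]; exact Lp.memLp g)
      (g := fun _ => 1) measurable_const (C := 1) hk zero_le_one fun p => ?_
    · simpa using h
    · have hp := jb_pos p
      rw [norm_one, one_mul]
      calc 1 = jb p ^ ((k : ℝ) / 2) * jb p ^ (-(k : ℝ) / 2) := by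
            rw [← Real.rpow_add hp]; simp [← add_div]
        _ ≤ _ := by gcongr; exact jb_rpow_le_W k hs p
  have hs := spec_syn hgood
  have he : (fun p => (W k s p : ℂ) * spec (syn H) p) =ᵐ[freqMeas d] g := by
    filter_upwards [hs] with p hp
    rw [hp, ← hWH]
  have hmem : syn H ∈ ySub d k s := mem_ySub_iff_memLp.2 ((Lp.memLp g).ae_eq he.symm)
  refine ⟨Y.mk (syn H) hmem, ?_⟩
  ext1
  exact (MemLp.coeFn_toLp (mem_ySub_iff_memLp.1 hmem)).trans he

theorem completeSpace_Y {d : ℕ} (hd : 2 ≤ d) {k : ℕ} {s : ℝ} (hs : 0 ≤ s)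
    (hk : ((d : ℝ) + 1) / 2 < k) : CompleteSpace (Y d k s) := by
  have hinj : Function.Injective (specL d k s) := by
    refine (injective_iff_map_eq_zero _).2 fun u hu => ?_
    rw [← norm_eq_zero, norm_specL, hu, norm_zero, mul_zero]
  let e := (LinearEquiv.ofBijective (specL d k s) ⟨hinj, specL_surjective hd hs hk⟩)
  let E := e.toContinuousLinearEquivOfBounds (kap d)⁻¹ (kap d)
    (fun u => by
      rw [norm_specL u, inv_mul_cancel_left₀ (kap_pos d).ne']; rfl)
    (fun g => by
      rw [norm_specL (e.symm g)]
      exact (congrArg (fun z => kap d * ‖z‖) (e.apply_symm_apply g)).le)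
  exact (completeSpace_congr (e := E.toEquiv) E.isUniformEmbedding).2 inferInstance

/-! ### Translations and derivatives -/

/-- Characters are multiplicative in the space variable, so a translation becomes a multiplication
by a unimodular function on the Fourier side. -/
theorem translate_syn {d : ℕ} {H : Tan d × ℤ → ℂ} (h : Good H) (q : Tan d × Circ) :
    translate q (syn H) = syn (fun p => chi p q * H p) := by
  have hg : Good fun p => chi p q * H p :=
    h.mul_bounded (measurable_chi_left q) (C := 1) fun p => (norm_chi p q).le
  refine syn_spec hg (spec_of_ae hg ?_)
  have hmp := measurePreserving_add_right (meas d) q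
  have h1 := Lp.coeFn_compMeasurePreserving (syn H) hmp
  have h2 := hmp.quasiMeasurePreserving.ae (coeFn_syn h)
  unfold translate
  filter_upwards [h1, h2] with x h1 h2
  rw [h1, Function.comp_apply, h2, synth, synth]
  refine integral_congr_ae (ae_of_all _ fun p => ?_)
  simp only [chi_add_right]
  ring

/-- The symbol of the derivative in the direction `(v, τ)`, divided by `i`. -/
def phase {d : ℕ} (v : Tan d) (τ : ℝ) (p : Tan d × ℤ) : ℝ :=
  2 * Real.pi * inner ℝ p.1 v + p.2 * τ

theorem measurable_phase {d : ℕ} (v : Tan d) (τ : ℝ) : Measurable (phase v τ) := by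
  refine measurable_from_prod_countable_left fun l => ?_
  have : Continuous fun ξ : Tan d => phase v τ (ξ, l) := by unfold phase; fun_prop
  exact this.measurable

theorem abs_phase_le {d : ℕ} (v : Tan d) (τ : ℝ) (p : Tan d × ℤ) :
    |phase v τ p| ≤ (‖v‖ + |τ|) * fn p := by
  have h1 : |inner ℝ p.1 v| ≤ ‖p.1‖ * ‖v‖ := abs_real_inner_le_norm _ _
  have h2 := norm_fst_le_fn p
  have h3 := abs_snd_le_fn p
  calc |phase v τ p| ≤ 2 * Real.pi * |inner ℝ p.1 v| + |(p.2 : ℝ)| * |τ| := by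
        refine (abs_add_le _ _).trans_eq ?_
        rw [abs_mul (2 * Real.pi), abs_mul (p.2 : ℝ), abs_of_pos Real.two_pi_pos]
    _ ≤ 2 * Real.pi * (‖p.1‖ * ‖v‖) + fn p * |τ| := by gcongr
    _ = (2 * Real.pi * ‖p.1‖) * ‖v‖ + fn p * |τ| := by ring
    _ ≤ fn p * ‖v‖ + fn p * |τ| := by gcongr
    _ = _ := by ring

theorem chi_shift {d : ℕ} (v : Tan d) (τ h : ℝ) (p : Tan d × ℤ) :
    chi p (h • v, ((h * τ : ℝ) : Circ)) = Complex.exp (Complex.I * (h * phase v τ p : ℝ)) := by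
  rw [chi, Real.fourierChar_apply, fourier_coe_apply, ← Complex.exp_add]
  congr 1
  have : (Real.pi : ℂ) ≠ 0 := Complex.ofReal_ne_zero.2 Real.pi_ne_zero
  simp only [phase, inner_smul_right]
  push_cast
  field_simp

/-- The quadratic remainder must hold for all real `x`, since the phases are unbounded. For large
`x` it follows from the exponential having modulus one. -/
theorem norm_exp_sub_one_sub_le (x : ℝ) :
    ‖Complex.exp (Complex.I * x) - 1 - Complex.I * x‖ ≤ 3 * x ^ 2 := by
  have hx : ‖Complex.I * (x : ℂ)‖ = |x| := by simp
  rcases le_or_gt |x| 1 with h | h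
  · have := Complex.norm_exp_sub_one_sub_id_le (hx.le.trans h)
    rw [hx, sq_abs] at this
    nlinarith [sq_nonneg x]
  · have h1 : ‖Complex.exp (Complex.I * x)‖ = 1 := by
      rw [mul_comm]; exact Complex.norm_exp_ofReal_mul_I x
    calc ‖Complex.exp (Complex.I * x) - 1 - Complex.I * x‖
        ≤ ‖Complex.exp (Complex.I * x)‖ + ‖(1 : ℂ)‖ + ‖Complex.I * (x : ℂ)‖ :=
          (norm_sub_le _ _).trans (by gcongr; exact norm_sub_le _ _)
      _ = 2 + |x| := by rw [h1, hx, norm_one]; norm_num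
      _ ≤ 3 * x ^ 2 := by rw [← sq_abs x]; nlinarith

/-- The second order Taylor estimate of the exponential, applied frequency by frequency, bounds the
remainder of the difference quotient in `L²` by `t²` times the norm of the second derivative. -/
theorem hasDerivAt_translate {d : ℕ} {H : Tan d × ℤ → ℂ} (v : Tan d) (τ : ℝ) (h : Good H)
    (h1 : Good fun p => (Complex.I * phase v τ p) * H p)
    (h2 : MemLp (fun p => ((phase v τ p) ^ 2 : ℂ) * H p) 2 (freqMeas d)) :
    HasDerivAt (fun t : ℝ => translate (t • v, ((t * τ : ℝ) : Circ)) (syn H))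
      (syn fun p => (Complex.I * phase v τ p) * H p) 0 := by
  rw [hasDerivAt_iff_isLittleO_nhds_zero]
  refine Asymptotics.IsBigO.trans_isLittleO (g := fun t : ℝ => t ^ 2) ?_
    (Asymptotics.isLittleO_pow_id one_lt_two)
  refine Asymptotics.IsBigO.of_bound
    (3 * (eLpNorm (fun p => ((phase v τ p) ^ 2 : ℂ) * H p) 2 (freqMeas d)).toReal)
    (Filter.Eventually.of_forall fun t => ?_)
  set a : Tan d × ℤ → ℂ := fun p => chi p (t • v, ((t * τ : ℝ) : Circ)) with ha
  set b : Tan d × ℤ → ℂ := fun p => Complex.I * phase v τ p with hb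
  have hga : Good fun p => a p * H p :=
    h.mul_bounded (measurable_chi_left _) (C := 1) fun p => (norm_chi p _).le
  have hzero : translate ((0 : ℝ) • v, (((0 : ℝ) * τ : ℝ) : Circ)) (syn H) = syn H := by
    rw [translate_syn h]
    congr 1
    ext p
    rw [chi_shift]
    simp
  have hG : Good ((fun p => a p * H p) + ((-1 : ℂ) • H + (-(t : ℂ)) • fun p => b p * H p)) :=
    hga.add ((h.smul _).add (h1.smul _))
  have heq : translate ((0 + t) • v, (((0 + t) * τ : ℝ) : Circ)) (syn H)
      - translate ((0 : ℝ) • v, (((0 : ℝ) * τ : ℝ) : Circ)) (syn H) - t • syn (fun p => b p * H p)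
      = syn ((fun p => a p * H p) + ((-1 : ℂ) • H + (-(t : ℂ)) • fun p => b p * H p)) := by
    rw [hzero, zero_add, translate_syn h, syn_add hga ((h.smul _).add (h1.smul _)),
      syn_add (h.smul _) (h1.smul _), syn_smul h, syn_smul h1]
    have : t • syn (fun p => b p * H p) = (t : ℂ) • syn (fun p => b p * H p) := by
      exact (algebraMap_smul ℂ t (syn fun p => b p * H p)).symm
    rw [this, neg_smul, neg_smul, one_smul]
    abel
  rw [heq, ← toReal_enorm, enorm_syn hG]
  have hle : eLpNorm ((fun p => a p * H p) + ((-1 : ℂ) • H + (-(t : ℂ)) • fun p => b p * H p)) 2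
      (freqMeas d) ≤ ENNReal.ofReal (3 * t ^ 2) *
        eLpNorm (fun p => ((phase v τ p) ^ 2 : ℂ) * H p) 2 (freqMeas d) := by
    refine eLpNorm_le_mul_eLpNorm_of_ae_le_mul (ae_of_all _ fun p => ?_) 2
    have e : ((fun p => a p * H p) + ((-1 : ℂ) • H + (-(t : ℂ)) • fun p => b p * H p)) p
        = (Complex.exp (Complex.I * (t * phase v τ p : ℝ)) - 1
          - Complex.I * (t * phase v τ p : ℝ)) * H p := by
      simp only [Pi.add_apply, Pi.smul_apply, smul_eq_mul, ha, hb, chi_shift]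
      push_cast
      ring
    rw [e, norm_mul, norm_mul, norm_pow, Complex.norm_real, Real.norm_eq_abs, sq_abs, ← mul_assoc]
    gcongr
    refine (norm_exp_sub_one_sub_le _).trans_eq (by ring)
  have hfin := ENNReal.mul_lt_top (ENNReal.ofReal_lt_top (r := 3 * t ^ 2)) h2.2
  refine (ENNReal.toReal_mono hfin.ne hle).trans_eq ?_
  rw [ENNReal.toReal_mul, ENNReal.toReal_ofReal (by positivity), norm_pow, Real.norm_eq_abs, sq_abs]
  ring

/-- The derivative in the direction `(v, τ)`. -/
def dDir {d : ℕ} (v : Tan d) (τ : ℝ) (u : L2 d) : L2 d :=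
  deriv (fun t : ℝ => translate (t • v, ((t * τ : ℝ) : Circ)) u) 0

theorem dTan_eq {d : ℕ} (v : Tan d) : dTan v = dDir v 0 := by
  ext1 u
  simp [dTan, dDir]

theorem dTheta_eq {d : ℕ} : (dTheta : L2 d → L2 d) = dDir 0 1 := by
  ext1 u
  simp [dTheta, dDir]

theorem fn_pow_le_jb {d : ℕ} (p : Tan d × ℤ) (j : ℕ) : fn p ^ j ≤ jb p ^ ((j : ℝ) / 2) := by
  have h : fn p ≤ jb p ^ ((1 : ℝ) / 2) := by
    rw [← Real.sqrt_eq_rpow]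
    exact Real.le_sqrt_of_sq_le (by unfold jb; linarith)
  calc fn p ^ j ≤ (jb p ^ ((1 : ℝ) / 2)) ^ j := by
        gcongr; exact fn_nonneg p
    _ = _ := by
      rw [← Real.rpow_natCast, ← Real.rpow_mul (jb_pos p).le]
      congr 1; ring

theorem good_phase_spec {d : ℕ} (hd : 2 ≤ d) {k : ℕ} {s : ℝ} (hs : 0 ≤ s) {u : L2 d}
    (hu : u ∈ ySub d k s) (v : Tan d) (τ : ℝ) (j : ℕ) (hj : ((d : ℝ) + 1) / 2 + j < k) (c : ℂ) :
    Good fun p => (c * (phase v τ p : ℂ) ^ j) * spec u p := by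
  refine good_mul_spec hd hs hu (g := fun p => c * (phase v τ p : ℂ) ^ j)
    (C := ‖c‖ * (‖v‖ + |τ|) ^ j)
    (((Complex.measurable_ofReal.comp (measurable_phase v τ)).pow_const j).const_mul c) hj
    (by positivity) fun p => ?_
  rw [norm_mul, norm_pow, Complex.norm_real, Real.norm_eq_abs, mul_assoc]
  gcongr
  calc |phase v τ p| ^ j ≤ ((‖v‖ + |τ|) * fn p) ^ j := by gcongr; exact abs_phase_le v τ p
    _ = (‖v‖ + |τ|) ^ j * fn p ^ j := mul_pow _ _ _
    _ ≤ _ := by gcongr; exact fn_pow_le_jb p j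

theorem good_dDir {d : ℕ} (hd : 2 ≤ d) {k : ℕ} {s : ℝ} (hs : 0 ≤ s) {u : L2 d}
    (hu : u ∈ ySub d k s) (hk : ((d : ℝ) + 1) / 2 + 2 < k) (v : Tan d) (τ : ℝ) :
    Good fun p => (Complex.I * phase v τ p) * spec u p := by
  simpa using good_phase_spec hd hs hu v τ 1 (by push_cast; linarith) Complex.I

theorem dDir_eq {d : ℕ} (hd : 2 ≤ d) {k : ℕ} {s : ℝ} (hs : 0 ≤ s) {u : L2 d}
    (hu : u ∈ ySub d k s) (hk : ((d : ℝ) + 1) / 2 + 2 < k) (v : Tan d) (τ : ℝ) :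
    dDir v τ u = syn fun p => (Complex.I * phase v τ p) * spec u p := by
  have h0 := good_spec hd hs hu (by linarith)
  have h2 := good_phase_spec hd hs hu v τ 2 (by push_cast; linarith) 1
  simp only [one_mul] at h2
  have h := hasDerivAt_translate v τ h0 (good_dDir hd hs hu hk v τ) h2.2
  rw [← syn_spec h0 (Filter.EventuallyEq.refl _ _)] at h
  exact h.deriv

theorem spec_dDir {d : ℕ} (hd : 2 ≤ d) {k : ℕ} {s : ℝ} (hs : 0 ≤ s) {u : L2 d}
    (hu : u ∈ ySub d k s) (hk : ((d : ℝ) + 1) / 2 + 2 < k) (v : Tan d) (τ : ℝ) :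
    spec (dDir v τ u) =ᵐ[freqMeas d] fun p => (Complex.I * phase v τ p) * spec u p := by
  rw [dDir_eq hd hs hu hk]
  exact spec_syn (good_dDir hd hs hu hk v τ)

/-- The inequality `x ≤ e^x` at `x = (s' - s) fn p`: a derivative is traded for a narrowing of the
exponential weight. Every factor `1 / (s' - s)` comes from here. -/
theorem fn_mul_W_le {d : ℕ} (k : ℕ) {s s' : ℝ} (h : s < s') (p : Tan d × ℤ) :
    fn p * W k s p ≤ 1 / (s' - s) * W k s' p := by
  have hp := (jb_pos p).le
  have hs : 0 < s' - s := sub_pos.2 h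
  rw [W_eq, W_eq, one_div, inv_mul_eq_div, le_div_iff₀ hs]
  have h1 : (s' - s) * fn p ≤ Real.exp ((s' - s) * fn p) := by
    have := Real.add_one_le_exp ((s' - s) * fn p)
    linarith
  have h2 : Real.exp (s' * fn p) = Real.exp ((s' - s) * fn p) * Real.exp (s * fn p) := by
    rw [← Real.exp_add]; congr 1; ring
  rw [h2]
  calc fn p * (Real.exp (s * fn p) * jb p ^ ((k : ℝ) / 2)) * (s' - s)
      = ((s' - s) * fn p) * Real.exp (s * fn p) * jb p ^ ((k : ℝ) / 2) := by ring
    _ ≤ _ := by gcongr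

/-- A linear operator that acts on the scale `Y_s` with the loss of a derivative. -/
structure LinLoss {d : ℕ} (k : ℕ) (C : ℝ) (L : L2 d → L2 d) : Prop where
  mem : ∀ {s s' : ℝ} {u : L2 d}, 0 < s → s < s' → s' < 1 → u ∈ ySub d k s' → L u ∈ ySub d k s
  le : ∀ {s s' : ℝ} {u : L2 d}, 0 < s → s < s' → s' < 1 → u ∈ ySub d k s' →
    nrm k s (L u) ≤ C / (s' - s) * nrm k s' u
  map_add : ∀ {s : ℝ} {u v : L2 d}, 0 < s → s < 1 → u ∈ ySub d k s → v ∈ ySub d k s →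
    L (u + v) = L u + L v
  map_smul : ∀ {s : ℝ} {u : L2 d} (c : ℂ), 0 < s → s < 1 → u ∈ ySub d k s → L (c • u) = c • L u

/-- The symbol is at most linear in the frequency, which `fn_mul_W_le` converts into the loss.
Linearity is not available from the definition of `dDir` by `deriv` and is read off the Fourier
side. -/
theorem linLoss_dDir {d : ℕ} (hd : 2 ≤ d) {k : ℕ} (hk : ((d : ℝ) + 1) / 2 + 2 < k)
    (v : Tan d) (τ : ℝ) : LinLoss k (‖v‖ + |τ|) (dDir v τ) := by
  have key : ∀ {s s' : ℝ} {u : L2 d}, 0 < s → s < s' → u ∈ ySub d k s' →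
      dDir v τ u ∈ ySub d k s ∧
        nrm k s (dDir v τ u) ≤ (‖v‖ + |τ|) / (s' - s) * nrm k s' u := by
    intro s s' u hs hss hu
    have h0 : 0 < s' - s := sub_pos.2 hss
    refine mem_and_nrm_le_of_le (by positivity) hu ?_
    filter_upwards [spec_dDir hd (hs.trans hss).le hu hk v τ] with p hp
    rw [hp]
    simp only [norm_mul, Complex.norm_real, Real.norm_eq_abs, Complex.norm_I, one_mul,
      abs_of_pos (W_pos _ _ p)]
    have h1 := abs_phase_le v τ p
    have h2 := fn_mul_W_le k hss p
    have h3 := (W_pos k s p).le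
    calc W k s p * (|phase v τ p| * ‖spec u p‖)
        ≤ W k s p * ((‖v‖ + |τ|) * fn p * ‖spec u p‖) := by gcongr
      _ = (‖v‖ + |τ|) * (fn p * W k s p) * ‖spec u p‖ := by ring
      _ ≤ (‖v‖ + |τ|) * (1 / (s' - s) * W k s' p) * ‖spec u p‖ := by gcongr
      _ = _ := by ring
  refine ⟨fun hs hss _ hu => (key hs hss hu).1, fun hs hss _ hu => (key hs hss hu).2,
    fun hs _ hu hv => ?_, fun c hs _ hu => ?_⟩
  · refine spec_injective ?_
    filter_upwards [spec_dDir hd hs.le (Submodule.add_mem _ hu hv) hk v τ,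
      spec_dDir hd hs.le hu hk v τ, spec_dDir hd hs.le hv hk v τ, spec_add (dDir v τ _) (dDir v τ _),
      spec_add _ _] with p h1 h2 h3 h4 h5
    rw [h1, h4, Pi.add_apply, h2, h3, h5, Pi.add_apply]
    ring
  · refine spec_injective ?_
    filter_upwards [spec_dDir hd hs.le (Submodule.smul_mem _ c hu) hk v τ,
      spec_dDir hd hs.le hu hk v τ, spec_smul c (dDir v τ _), spec_smul c _] with p h1 h2 h3 h4
    rw [h1, h3, Pi.smul_apply, h2, h4, Pi.smul_apply, smul_eq_mul, smul_eq_mul]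
    ring

/-! ### Twisted convolutions -/

/-- Cauchy–Schwarz estimate for a twisted convolution. -/
theorem lintegral_twisted_conv_sq_le {d : ℕ} {Φ : Tan d × ℤ → Tan d × ℤ → ℝ≥0∞}
    {h g : Tan d × ℤ → ℝ≥0∞} (hΦ : Measurable (Function.uncurry Φ)) (hh : Measurable h)
    (hg : Measurable g) {A : ℝ≥0∞}
    (hA : ∀ p, ∫⁻ q, Φ q (p - q) ^ 2 ∂freqMeas d ≤ A) :
    ∫⁻ p, (∫⁻ q, Φ q (p - q) * (h q * g (p - q)) ∂freqMeas d) ^ 2 ∂freqMeas d ≤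
      A * ((∫⁻ q, h q ^ 2 ∂freqMeas d) * ∫⁻ q, g q ^ 2 ∂freqMeas d) := by
  have hΦm : ∀ p, Measurable fun q => Φ q (p - q) := fun p =>
    hΦ.comp (measurable_id.prodMk (measurable_const.sub measurable_id))
  have hgm : ∀ p, Measurable fun q => h q * g (p - q) := fun p =>
    hh.mul (hg.comp (measurable_const.sub measurable_id))
  have hjm : Measurable (Function.uncurry fun p q : Tan d × ℤ => (h q * g (p - q)) ^ 2) :=
    ((hh.comp measurable_snd).mul (hg.comp (measurable_fst.sub measurable_snd))).pow_const 2
  -- Cauchy–Schwarz in `q` isolates the kernel, whose square integral is uniformly bounded in `p`.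
  -- The remaining double integral factorises by Tonelli and translation invariance.
  have h1 : ∀ p, (∫⁻ q, Φ q (p - q) * (h q * g (p - q)) ∂freqMeas d) ^ 2 ≤
      A * ∫⁻ q, (h q * g (p - q)) ^ 2 ∂freqMeas d := by
    intro p
    have hc := ENNReal.lintegral_mul_le_Lp_mul_Lq (freqMeas d) Real.HolderConjugate.two_two
      (hΦm p).aemeasurable (hgm p).aemeasurable
    have e : ∀ x : ℝ≥0∞, (x ^ (1 / (2 : ℝ))) ^ 2 = x := fun x => by
      rw [← ENNReal.rpow_natCast, ← ENNReal.rpow_mul]; simp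
    calc _ ≤ ((∫⁻ q, Φ q (p - q) ^ (2 : ℝ) ∂freqMeas d) ^ (1 / (2 : ℝ)) *
          (∫⁻ q, (h q * g (p - q)) ^ (2 : ℝ) ∂freqMeas d) ^ (1 / (2 : ℝ))) ^ 2 := by
          gcongr
          exact hc
      _ = (∫⁻ q, Φ q (p - q) ^ 2 ∂freqMeas d) * ∫⁻ q, (h q * g (p - q)) ^ 2 ∂freqMeas d := by
          rw [mul_pow, e, e]
          simp only [ENNReal.rpow_two]
      _ ≤ _ := by gcongr; exact hA p
  calc _ ≤ ∫⁻ p, A * ∫⁻ q, (h q * g (p - q)) ^ 2 ∂freqMeas d ∂freqMeas d := lintegral_mono h1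
    _ = A * ∫⁻ p, ∫⁻ q, (h q * g (p - q)) ^ 2 ∂freqMeas d ∂freqMeas d :=
        lintegral_const_mul _ (Measurable.lintegral_prod_right hjm)
    _ = A * ∫⁻ q, ∫⁻ p, (h q * g (p - q)) ^ 2 ∂freqMeas d ∂freqMeas d := by
        rw [lintegral_lintegral_swap hjm.aemeasurable]
    _ = A * ∫⁻ q, h q ^ 2 * ∫⁻ p, g p ^ 2 ∂freqMeas d ∂freqMeas d := by
        congr 1
        refine lintegral_congr fun q => ?_
        simp_rw [mul_pow]
        have hm : Measurable fun p => g (p - q) ^ 2 :=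
          (hg.comp (measurable_id.sub_const q)).pow_const 2
        rw [lintegral_const_mul _ hm,
          lintegral_sub_right_eq_self (fun p => g p ^ 2)]
    _ = _ := by rw [lintegral_mul_const _ (hh.pow_const 2)]

/-- The convolution of `H` and `G` with the multiplier `M`. -/
def conv {d : ℕ} (M : ℤ → ℤ → ℂ) (H G : Tan d × ℤ → ℂ) (p : Tan d × ℤ) : ℂ :=
  ∫ q, M q.2 (p.2 - q.2) * (H q * G (p - q)) ∂freqMeas d

/-- The integrability condition under which `conv M H G` is meaningful. -/
def ConvInt {d : ℕ} (M : ℤ → ℤ → ℂ) (H G : Tan d × ℤ → ℂ) : Prop :=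
  Integrable (fun z : (Tan d × ℤ) × (Tan d × ℤ) =>
    M z.1.2 (z.2.2 - z.1.2) * (H z.1 * G (z.2 - z.1))) ((freqMeas d).prod (freqMeas d))

theorem integrable_conv {d : ℕ} {M : ℤ → ℤ → ℂ} {H G : Tan d × ℤ → ℂ} (h : ConvInt M H G) :
    Integrable (conv M H G) (freqMeas d) :=
  Integrable.integral_prod_right h

theorem ConvInt.chi_mul {d : ℕ} {M : ℤ → ℤ → ℂ} {H G : Tan d × ℤ → ℂ} (h : ConvInt M H G)
    (x : Tan d × Circ) : Integrable (fun z : (Tan d × ℤ) × (Tan d × ℤ) =>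
      chi z.2 x * (M z.1.2 (z.2.2 - z.1.2) * (H z.1 * G (z.2 - z.1))))
      ((freqMeas d).prod (freqMeas d)) := by
  refine Integrable.mono h
    (((measurable_chi_left x).comp measurable_snd).aestronglyMeasurable.mul h.1)
    (ae_of_all _ fun z => ?_)
  rw [norm_mul, norm_chi, one_mul]

/-- Fubini and `chi p = chi q * chi (p - q)`: this represents the pointwise product on the Fourier
side. -/
theorem synth_conv_one {d : ℕ} {H G : Tan d × ℤ → ℂ} (h : ConvInt (fun _ _ => 1) H G)
    (x : Tan d × Circ) : synth (conv (fun _ _ => 1) H G) x = synth H x * synth G x := by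
  have hi := h.chi_mul x
  have e1 : synth (conv (fun _ _ => 1) H G) x = ∫ p, ∫ q, chi p x * (1 * (H q * G (p - q)))
      ∂freqMeas d ∂freqMeas d := by
    refine integral_congr_ae (ae_of_all _ fun p => ?_)
    simp only [conv, integral_const_mul]
  have e2 := integral_integral_swap (f := fun q p => chi p x * (1 * (H q * G (p - q)))) hi
  have e3 : ∀ q, ∫ p, chi p x * (1 * (H q * G (p - q))) ∂freqMeas d
      = chi q x * H q * synth G x := by
    intro q
    rw [synth, ← integral_sub_right_eq_self (fun p => chi p x * G p) q, ← integral_const_mul]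
    refine integral_congr_ae (ae_of_all _ fun p => ?_)
    have : chi p x = chi q x * chi (p - q) x := by rw [← chi_add_left, add_sub_cancel]
    simp only [this]
    ring
  rw [e1, ← e2]
  simp_rw [e3]
  rw [integral_mul_const]
  rfl

theorem integrable_slice_snd {d : ℕ} {f : (Tan d × ℤ) × (Tan d × ℤ) → ℂ}
    (h : Integrable f ((freqMeas d).prod (freqMeas d))) (l : ℤ) :
    Integrable (fun z : (Tan d × ℤ) × Tan d => f (z.1, (z.2, l)))
      ((freqMeas d).prod volume) := by
  have hmp := measurePreserving_prodAssoc (freqMeas d) (volume : Measure (Tan d))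
    (Measure.count : Measure ℤ)
  have h1 := (hmp.integrable_comp_emb MeasurableEquiv.prodAssoc.measurableEmbedding).2 h
  exact Measure.ae_count_iff.1 h1.prod_left_ae l

/-- The multiplier sees only the integer frequencies, so at fixed `l` and `l₁` it leaves the
`ξ`-integrals, which split into a product of inverse transforms. The result has the shape of the
double series defining `fPer`. -/
theorem synth_conv {d : ℕ} {M : ℤ → ℤ → ℂ} {H G : Tan d × ℤ → ℂ} (h : ConvInt M H G)
    (y : Tan d) (θ : Circ) :
    synth (conv M H G) (y, θ) = ∑' l, (∑' l₁, M l₁ (l - l₁) * (𝓕⁻ (fun ξ => H (ξ, l₁)) y *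
      𝓕⁻ (fun ξ => G (ξ, l - l₁)) y)) * fourier l θ := by
  have hB := integrable_conv h
  rw [synth_eq_tsum hB]
  refine tsum_congr fun l => ?_
  rw [mul_comm]
  congr 1
  have hs := integrable_slice_snd (h.chi_mul (y, 0)) l
  have e0 : 𝓕⁻ (fun ξ => conv M H G (ξ, l)) y
      = ∫ ξ, chi (ξ, l) (y, 0) * conv M H G (ξ, l) := by
    rw [fourierInv_slice, fourier_eval_zero, one_mul]
  have e1 : ∫ ξ, chi (ξ, l) (y, 0) * conv M H G (ξ, l) = ∫ ξ, ∫ q, chi (ξ, l) (y, 0) *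
      (M q.2 (l - q.2) * (H q * G ((ξ, l) - q))) ∂freqMeas d := by
    refine integral_congr_ae (ae_of_all _ fun p => ?_)
    simp only [conv, integral_const_mul]
  have e2 := integral_integral_swap (μ := freqMeas d) (ν := (volume : Measure (Tan d)))
    (f := fun q ξ => chi (ξ, l) (y, 0) * (M q.2 (l - q.2) * (H q * G ((ξ, l) - q)))) hs
  have e3 := hasSum_freq_integral hs.integral_prod_left
  rw [e0, e1, ← e2, ← e3.tsum_eq]
  refine tsum_congr fun l₁ => ?_
  have e4 : ∀ η : Tan d, ∫ ξ, chi (ξ, l) (y, 0) *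
      (M l₁ (l - l₁) * (H (η, l₁) * G ((ξ, l) - (η, l₁)))) =
      chi (η, l₁) (y, 0) * H (η, l₁) *
        (M l₁ (l - l₁) * 𝓕⁻ (fun ξ => G (ξ, l - l₁)) y) := by
    intro η
    have e5 : 𝓕⁻ (fun ξ => G (ξ, l - l₁)) y
        = ∫ ξ, chi (ξ, l - l₁) (y, 0) * G (ξ, l - l₁) := by
      rw [fourierInv_slice, fourier_eval_zero, one_mul]
    rw [e5, ← integral_sub_right_eq_self (fun ξ => chi (ξ, l - l₁) (y, 0) * G (ξ, l - l₁)) η,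
      ← integral_const_mul, ← integral_const_mul]
    refine integral_congr_ae (ae_of_all _ fun ξ => ?_)
    have : chi (ξ, l) (y, (0 : Circ)) = chi (η, l₁) (y, 0) * chi (ξ - η, l - l₁) (y, 0) := by
      rw [← chi_add_left, Prod.mk_add_mk, add_sub_cancel, add_sub_cancel]
    simp only [this, Prod.mk_sub_mk]
    ring
  simp only [e4]
  rw [integral_mul_const, fourierInv_slice, fourier_eval_zero, one_mul]
  ring

/-- The equality holds at every point: for each fixed `p`, the map `q ↦ p - q` pulls null sets back
to null sets, so the integrand changes only on a null set. -/
theorem conv_congr {d : ℕ} (M : ℤ → ℤ → ℂ) {H H' G G' : Tan d × ℤ → ℂ}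
    (hH : H =ᵐ[freqMeas d] H') (hG : G =ᵐ[freqMeas d] G') : conv M H G = conv M H' G' := by
  ext p
  refine integral_congr_ae ?_
  have h1 := (quasiMeasurePreserving_sub_left_of_right_invariant (freqMeas d) p).ae hG
  filter_upwards [hH, h1] with q h2 h3
  rw [h2, h3]

theorem conv_add_left {d : ℕ} {M : ℤ → ℤ → ℂ} {H H' G : Tan d × ℤ → ℂ} (h : ConvInt M H G)
    (h' : ConvInt M H' G) : conv M (H + H') G =ᵐ[freqMeas d] conv M H G + conv M H' G := by
  filter_upwards [Integrable.prod_left_ae h, Integrable.prod_left_ae h'] with p h1 h2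
  rw [Pi.add_apply, conv, conv, conv, ← integral_add h1 h2]
  refine integral_congr_ae (ae_of_all _ fun q => ?_)
  simp only [Pi.add_apply]
  ring

theorem conv_add_right {d : ℕ} {M : ℤ → ℤ → ℂ} {H G G' : Tan d × ℤ → ℂ} (h : ConvInt M H G)
    (h' : ConvInt M H G') : conv M H (G + G') =ᵐ[freqMeas d] conv M H G + conv M H G' := by
  filter_upwards [Integrable.prod_left_ae h, Integrable.prod_left_ae h'] with p h1 h2
  rw [Pi.add_apply, conv, conv, conv, ← integral_add h1 h2]
  refine integral_congr_ae (ae_of_all _ fun q => ?_)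
  simp only [Pi.add_apply]
  ring

theorem conv_smul_left {d : ℕ} (M : ℤ → ℤ → ℂ) (H G : Tan d × ℤ → ℂ) (c : ℂ) :
    conv M (c • H) G = c • conv M H G := by
  ext p
  rw [Pi.smul_apply, conv, conv, smul_eq_mul, ← integral_const_mul]
  refine integral_congr_ae (ae_of_all _ fun q => ?_)
  simp only [Pi.smul_apply, smul_eq_mul]
  ring

theorem conv_smul_right {d : ℕ} (M : ℤ → ℤ → ℂ) (H G : Tan d × ℤ → ℂ) (c : ℂ) :
    conv M H (c • G) = c • conv M H G := by
  ext p
  rw [Pi.smul_apply, conv, conv, smul_eq_mul, ← integral_const_mul]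
  refine integral_congr_ae (ae_of_all _ fun q => ?_)
  simp only [Pi.smul_apply, smul_eq_mul]
  ring

theorem measurable_mult {d : ℕ} (M : ℤ → ℤ → ℂ) :
    Measurable fun z : (Tan d × ℤ) × (Tan d × ℤ) => M z.1.2 z.2.2 := by
  have : Measurable fun w : ℤ × ℤ => M w.1 w.2 := measurable_of_countable _
  exact this.comp ((measurable_snd.comp measurable_fst).prodMk
    (measurable_snd.comp measurable_snd))

theorem fn_neg {d : ℕ} (p : Tan d × ℤ) : fn (-p) = fn p := by
  simp [fn, freqNorm]

theorem jb_sub_comm {d : ℕ} (p q : Tan d × ℤ) : jb (p - q) = jb (q - p) := by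
  rw [jb, jb, ← fn_neg, neg_sub]

/-- The integral of `⟨p⟩^{-2σ}` over the dual group. -/
def jbInt (d : ℕ) (σ : ℝ) : ℝ≥0∞ := ∫⁻ p, ENNReal.ofReal (jb p ^ (-σ)) ∂freqMeas d

theorem jbInt_lt_top {d : ℕ} (hd : 2 ≤ d) {σ : ℝ} (hσ : ((d : ℝ) + 1) / 2 < σ) :
    jbInt d σ < ⊤ := by
  have h := (integrable_jb hd hσ).2
  rw [hasFiniteIntegral_iff_ofReal (ae_of_all _ fun p => Real.rpow_nonneg (jb_pos p).le _)] at h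
  exact h

/-- A pointwise estimate of a multiplier with respect to the weights of `Y_s` and `Y_{s'}`. -/
def MultBound (d k : ℕ) (σ s s' C : ℝ) (M : ℤ → ℤ → ℂ) : Prop :=
  ∀ q r : Tan d × ℤ, W k s (q + r) * ‖M q.2 r.2‖ ≤
    C * (W k s' q * W k s' r) * (jb q ^ (-σ / 2) + jb r ^ (-σ / 2))

/-- The majorant of the convolution of the Fourier transforms. -/
def absConv {d : ℕ} (M : ℤ → ℤ → ℂ) (H G : Tan d × ℤ → ℂ) (p : Tan d × ℤ) : ℝ≥0∞ :=
  ∫⁻ q, ‖M q.2 (p.2 - q.2) * (H q * G (p - q))‖ₑ ∂freqMeas d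

theorem measurable_convIntegrand {d : ℕ} {M : ℤ → ℤ → ℂ} {H G : Tan d × ℤ → ℂ} (hH : Measurable H)
    (hG : Measurable G) : Measurable fun z : (Tan d × ℤ) × (Tan d × ℤ) =>
      M z.1.2 (z.2.2 - z.1.2) * (H z.1 * G (z.2 - z.1)) := by
  have h1 : Measurable fun z : (Tan d × ℤ) × (Tan d × ℤ) => (z.1, z.2 - z.1) :=
    measurable_fst.prodMk (measurable_snd.sub measurable_fst)
  exact ((measurable_mult M).comp h1).mul
    ((hH.comp measurable_fst).mul (hG.comp (measurable_snd.sub measurable_fst)))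

theorem measurable_absConv {d : ℕ} {M : ℤ → ℤ → ℂ} {H G : Tan d × ℤ → ℂ} (hH : Measurable H)
    (hG : Measurable G) : Measurable (absConv M H G) :=
  (measurable_convIntegrand hH hG).enorm.lintegral_prod_left'

theorem enorm_W {d : ℕ} (k : ℕ) (s : ℝ) (p : Tan d × ℤ) :
    ‖(W k s p : ℂ)‖ₑ = ENNReal.ofReal (W k s p) := by
  rw [← ofReal_norm, Complex.norm_real, Real.norm_of_nonneg (W_pos _ _ _).le]

/-- After `MultBound` has distributed the weight over the two factors, the kernel left over is a sum
of two powers `jb ^ (-σ / 2)`, one for each frequency. Its square integral in `q` is bounded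
independently of `p`, because one term does not involve `p` and the other is a translate. The `4`
comes from `(a + b)² ≤ 2 a² + 2 b²` and the two equal integrals. -/
theorem lintegral_absConv_le {d k : ℕ} {σ s s' C : ℝ} {M : ℤ → ℤ → ℂ}
    (hM : MultBound d k σ s s' C M) (hC : 0 ≤ C) (u v : L2 d) :
    ∫⁻ p, (ENNReal.ofReal (W k s p) * absConv M (spec u) (spec v) p) ^ 2 ∂freqMeas d ≤
      (ENNReal.ofReal (4 * C ^ 2) * jbInt d σ) * (wn k s' u ^ 2 * wn k s' v ^ 2) := by
  set Φ : Tan d × ℤ → Tan d × ℤ → ℝ≥0∞ := fun q r =>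
    ENNReal.ofReal C * (ENNReal.ofReal (jb q ^ (-σ / 2)) + ENNReal.ofReal (jb r ^ (-σ / 2)))
    with hΦ
  have hjm : Measurable fun p : Tan d × ℤ => ENNReal.ofReal (jb p ^ (-σ / 2)) :=
    (measurable_jb.pow_const _).ennreal_ofReal
  have hjm' : Measurable fun p : Tan d × ℤ => ENNReal.ofReal (jb p ^ (-σ)) :=
    (measurable_jb.pow_const _).ennreal_ofReal
  have hΦm : Measurable (Function.uncurry Φ) :=
    ((hjm.comp measurable_fst).add (hjm.comp measurable_snd)).const_mul _
  have hsq : ∀ p : Tan d × ℤ, ENNReal.ofReal (jb p ^ (-σ / 2)) ^ 2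
      = ENNReal.ofReal (jb p ^ (-σ)) := fun p => by
    have hp := jb_pos p
    rw [← ENNReal.ofReal_pow (by positivity), ← Real.rpow_natCast, ← Real.rpow_mul hp.le]
    congr 2; push_cast; ring
  have hA : ∀ p, ∫⁻ q, Φ q (p - q) ^ 2 ∂freqMeas d ≤ ENNReal.ofReal (4 * C ^ 2) * jbInt d σ := by
    intro p
    have h1 : ∀ q, Φ q (p - q) ^ 2 ≤ ENNReal.ofReal (2 * C ^ 2) *
        (ENNReal.ofReal (jb q ^ (-σ)) + ENNReal.ofReal (jb (q - p) ^ (-σ))) := by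
      intro q
      rw [hΦ]
      simp only
      rw [jb_sub_comm p q, ← hsq, ← hsq]
      have ha := Real.rpow_nonneg (jb_pos q).le (-σ / 2)
      have hb := Real.rpow_nonneg (jb_pos (q - p)).le (-σ / 2)
      rw [← ENNReal.ofReal_add ha hb, ← ENNReal.ofReal_mul hC, ← ENNReal.ofReal_pow (by positivity),
        ← ENNReal.ofReal_pow ha, ← ENNReal.ofReal_pow hb, ← ENNReal.ofReal_add (by positivity)
        (by positivity), ← ENNReal.ofReal_mul (by positivity)]
      refine ENNReal.ofReal_le_ofReal ?_
      rw [mul_pow, mul_comm 2 (C ^ 2), mul_assoc]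
      gcongr
      nlinarith [sq_nonneg (jb q ^ (-σ / 2) - jb (q - p) ^ (-σ / 2))]
    calc _ ≤ ∫⁻ q, ENNReal.ofReal (2 * C ^ 2) * (ENNReal.ofReal (jb q ^ (-σ))
          + ENNReal.ofReal (jb (q - p) ^ (-σ))) ∂freqMeas d := lintegral_mono h1
      _ = ENNReal.ofReal (2 * C ^ 2) * (jbInt d σ + jbInt d σ) := by
          have hm : Measurable fun q => ENNReal.ofReal (jb (q - p) ^ (-σ)) :=
            hjm'.comp (measurable_id.sub_const p)
          rw [lintegral_const_mul' _ _ ENNReal.ofReal_ne_top,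
            lintegral_add_left hjm', lintegral_sub_right_eq_self
              (fun q => ENNReal.ofReal (jb q ^ (-σ)))]
          rfl
      _ = _ := by
          rw [← two_mul, ← mul_assoc]
          congr 1
          rw [← ENNReal.ofReal_ofNat 2, ← ENNReal.ofReal_mul (by positivity)]
          congr 1; ring
  have hwm := fun w : L2 d => (measurable_W_spec k s' w).enorm
  have hmain := lintegral_twisted_conv_sq_le hΦm (hwm u) (hwm v) hA
  rw [← eLpNorm_two_sq, ← eLpNorm_two_sq] at hmain
  refine le_trans (lintegral_mono fun p => ?_) hmain
  gcongr
  rw [absConv, ← lintegral_const_mul' _ _ ENNReal.ofReal_ne_top]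
  refine lintegral_mono fun q => ?_
  have hb := hM q (p - q)
  rw [add_sub_cancel] at hb
  simp only [enorm_mul, enorm_W, hΦ]
  have hb' := ENNReal.ofReal_le_ofReal hb
  rw [ENNReal.ofReal_mul (W_pos _ _ _).le, ENNReal.ofReal_mul (by
      have := W_pos k s' q; have := W_pos k s' (p - q); positivity), ENNReal.ofReal_mul hC,
    ENNReal.ofReal_mul (W_pos _ _ _).le, ENNReal.ofReal_add
      (Real.rpow_nonneg (jb_pos _).le _) (Real.rpow_nonneg (jb_pos _).le _), ofReal_norm,
    Prod.snd_sub] at hb'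
  calc ENNReal.ofReal (W k s p) * (‖M q.2 (p.2 - q.2)‖ₑ * (‖spec u q‖ₑ * ‖spec v (p - q)‖ₑ))
      = ENNReal.ofReal (W k s p) * ‖M q.2 (p.2 - q.2)‖ₑ * (‖spec u q‖ₑ * ‖spec v (p - q)‖ₑ) := by
        ring
    _ ≤ _ := by
        refine (mul_le_mul_left hb' _).trans_eq ?_
        ring

/-- The weighted `L²` bound of `absConv` becomes an `L¹` bound by Cauchy–Schwarz, because `W`
dominates `jb ^ (k / 2)`, whose inverse is square integrable. -/
theorem convInt_of_multBound {d : ℕ} (hd : 2 ≤ d) {k : ℕ} (hk : ((d : ℝ) + 1) / 2 < k)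
    {σ s s' C : ℝ} (hσ : ((d : ℝ) + 1) / 2 < σ) (hs : 0 ≤ s) {M : ℤ → ℤ → ℂ}
    (hM : MultBound d k σ s s' C M) (hC : 0 ≤ C) {u v : L2 d} (hu : u ∈ ySub d k s')
    (hv : v ∈ ySub d k s') : ConvInt M (spec u) (spec v) := by
  have hm := measurable_convIntegrand (M := M) (measurable_spec u) (measurable_spec v)
  refine ⟨hm.aestronglyMeasurable, ?_⟩
  rw [hasFiniteIntegral_iff_enorm, lintegral_prod_symm _ hm.enorm.aemeasurable]
  have hL := lintegral_absConv_le hM hC u v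
  have hfin : (ENNReal.ofReal (4 * C ^ 2) * jbInt d σ) * (wn k s' u ^ 2 * wn k s' v ^ 2) < ⊤ :=
    ENNReal.mul_lt_top (ENNReal.mul_lt_top ENNReal.ofReal_lt_top (jbInt_lt_top hd hσ))
      (ENNReal.mul_lt_top (ENNReal.pow_lt_top (mem_ySub_iff.1 hu))
        (ENNReal.pow_lt_top (mem_ySub_iff.1 hv)))
  have hjm : Measurable fun p : Tan d × ℤ => ENNReal.ofReal (jb p ^ (-(k : ℝ) / 2)) :=
    (measurable_jb.pow_const _).ennreal_ofReal
  have ham := measurable_absConv (M := M) (measurable_spec u) (measurable_spec v)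
  have hc := ENNReal.lintegral_mul_le_Lp_mul_Lq (freqMeas d) Real.HolderConjugate.two_two
    hjm.aemeasurable (((measurable_W k s).ennreal_ofReal.mul ham)).aemeasurable
  have h1 : ∫⁻ p, absConv M (spec u) (spec v) p ∂freqMeas d ≤
      ∫⁻ p, ENNReal.ofReal (jb p ^ (-(k : ℝ) / 2)) *
        (ENNReal.ofReal (W k s p) * absConv M (spec u) (spec v) p) ∂freqMeas d := by
    refine lintegral_mono fun p => ?_
    rw [← mul_assoc, ← ENNReal.ofReal_mul (Real.rpow_nonneg (jb_pos p).le _)]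
    refine le_mul_of_one_le_left' ?_
    rw [← ENNReal.ofReal_one]
    refine ENNReal.ofReal_le_ofReal ?_
    have hp := jb_pos p
    calc 1 = jb p ^ (-(k : ℝ) / 2) * jb p ^ ((k : ℝ) / 2) := by
          rw [← Real.rpow_add hp]; simp [← add_div]
      _ ≤ _ := by gcongr; exact jb_rpow_le_W k hs p
  refine lt_of_le_of_lt (h1.trans hc) (ENNReal.mul_lt_top ?_ ?_)
  · refine ENNReal.rpow_lt_top_of_nonneg (by norm_num) (ne_of_lt ?_)
    refine lt_of_le_of_lt (lintegral_mono fun p => ?_) (jbInt_lt_top hd hk)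
    have hp := jb_pos p
    rw [ENNReal.ofReal_rpow_of_nonneg (by positivity) (by norm_num), ← Real.rpow_mul hp.le]
    refine le_of_eq ?_
    congr 2; ring
  · refine ENNReal.rpow_lt_top_of_nonneg (by norm_num) (ne_of_lt ?_)
    refine lt_of_le_of_lt (le_of_eq ?_) (hL.trans_lt hfin)
    simp only [ENNReal.rpow_two, Pi.mul_apply]

/-- The constant in the estimate of twisted convolutions. -/
def convConst (d : ℕ) (σ : ℝ) : ℝ := 2 * Real.sqrt (jbInt d σ).toReal / kap d

/-- The bilinear operator with a given multiplier. -/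
def bil {d : ℕ} (M : ℤ → ℤ → ℂ) (u v : L2 d) : L2 d := syn (conv M (spec u) (spec v))

theorem enorm_conv_le {d : ℕ} (M : ℤ → ℤ → ℂ) (H G : Tan d × ℤ → ℂ) (p : Tan d × ℤ) :
    ‖conv M H G p‖ₑ ≤ absConv M H G p :=
  enorm_integral_le_lintegral_enorm _

/-- The majorant `absConv` controls the convolution pointwise, so `lintegral_absConv_le` yields the
norm bound. Divided by the weight, the same bound makes the convolution a legitimate Fourier
transform. -/
theorem bil_aux {d : ℕ} (hd : 2 ≤ d) {k : ℕ} (hk : ((d : ℝ) + 1) / 2 < k)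
    {σ s s' C : ℝ} (hσ : ((d : ℝ) + 1) / 2 < σ) (hs : 0 ≤ s) {M : ℤ → ℤ → ℂ}
    (hM : MultBound d k σ s s' C M) (hC : 0 ≤ C) {u v : L2 d} (hu : u ∈ ySub d k s')
    (hv : v ∈ ySub d k s') : Good (conv M (spec u) (spec v)) ∧ bil M u v ∈ ySub d k s ∧
      nrm k s (bil M u v) ≤ convConst d σ * C * (nrm k s' u * nrm k s' v) := by
  have hci := integrable_conv (convInt_of_multBound hd hk hσ hs hM hC hu hv)
  have hL := lintegral_absConv_le hM hC u v
  have hfin : (ENNReal.ofReal (4 * C ^ 2) * jbInt d σ) * (wn k s' u ^ 2 * wn k s' v ^ 2) < ⊤ :=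
    ENNReal.mul_lt_top (ENNReal.mul_lt_top ENNReal.ofReal_lt_top (jbInt_lt_top hd hσ))
      (ENNReal.mul_lt_top (ENNReal.pow_lt_top (mem_ySub_iff.1 hu))
        (ENNReal.pow_lt_top (mem_ySub_iff.1 hv)))
  have h1 : ∫⁻ p, ‖(W k s p : ℂ) * conv M (spec u) (spec v) p‖ₑ ^ 2 ∂freqMeas d ≤
      (ENNReal.ofReal (4 * C ^ 2) * jbInt d σ) * (wn k s' u ^ 2 * wn k s' v ^ 2) := by
    refine le_trans (lintegral_mono fun p => ?_) hL
    rw [enorm_mul, enorm_W]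
    gcongr
    exact enorm_conv_le _ _ _ _
  have h2 : MemLp (fun p => (W k s p : ℂ) * conv M (spec u) (spec v) p) 2 (freqMeas d) :=
    memLp_two_of_lintegral
      ((Complex.measurable_ofReal.comp (measurable_W k s)).aestronglyMeasurable.mul hci.1)
      (h1.trans_lt hfin)
  have hgood : Good (conv M (spec u) (spec v)) := by
    have h := good_of_weight hd h2 (g := fun _ => 1) measurable_const (C := 1) hk zero_le_one
      fun p => ?_
    · simpa using h
    · have hp := jb_pos p
      rw [norm_one, one_mul]
      calc 1 = jb p ^ ((k : ℝ) / 2) * jb p ^ (-(k : ℝ) / 2) := by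
            rw [← Real.rpow_add hp]; simp [← add_div]
        _ ≤ _ := by gcongr; exact jb_rpow_le_W k hs p
  have he : (fun p => (W k s p : ℂ) * spec (bil M u v) p) =ᵐ[freqMeas d]
      fun p => (W k s p : ℂ) * conv M (spec u) (spec v) p := by
    filter_upwards [spec_syn hgood] with p hp
    rw [bil, hp]
  refine ⟨hgood, mem_ySub_iff_memLp.2 (h2.ae_eq he.symm), ?_⟩
  have h3 : wn k s (bil M u v) ^ 2 ≤
      (ENNReal.ofReal (4 * C ^ 2) * jbInt d σ) * (wn k s' u ^ 2 * wn k s' v ^ 2) := by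
    rw [wn, eLpNorm_congr_ae he, eLpNorm_two_sq]
    exact h1
  have h4 := ENNReal.toReal_mono hfin.ne h3
  simp only [ENNReal.toReal_mul, ENNReal.toReal_pow] at h4
  rw [ENNReal.toReal_ofReal (by positivity)] at h4
  have h5 : (wn k s (bil M u v)).toReal ≤
      2 * C * Real.sqrt (jbInt d σ).toReal * ((wn k s' u).toReal * (wn k s' v).toReal) := by
    refine abs_le_of_sq_le_sq' (h4.trans_eq ?_) (by positivity) |>.2
    rw [mul_pow, mul_pow, mul_pow, Real.sq_sqrt ENNReal.toReal_nonneg]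
    ring
  rw [nrm_eq, nrm_eq, nrm_eq, convConst]
  have hkap := kap_pos d
  calc _ ≤ kap d * (2 * C * Real.sqrt (jbInt d σ).toReal *
        ((wn k s' u).toReal * (wn k s' v).toReal)) := by gcongr
    _ = _ := by field_simp

theorem bil_add_left {d : ℕ} (hd : 2 ≤ d) {k : ℕ} (hk : ((d : ℝ) + 1) / 2 < k)
    {σ s s' C : ℝ} (hσ : ((d : ℝ) + 1) / 2 < σ) (hs : 0 ≤ s) {M : ℤ → ℤ → ℂ}
    (hM : MultBound d k σ s s' C M) (hC : 0 ≤ C) {u u' v : L2 d} (hu : u ∈ ySub d k s')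
    (hu' : u' ∈ ySub d k s') (hv : v ∈ ySub d k s') :
    bil M (u + u') v = bil M u v + bil M u' v := by
  have h1 := (bil_aux hd hk hσ hs hM hC hu hv).1
  have h2 := (bil_aux hd hk hσ hs hM hC hu' hv).1
  rw [bil, bil, bil, ← syn_add h1 h2, conv_congr M (spec_add u u') (Filter.EventuallyEq.refl _ _)]
  exact (syn_congr (h1.add h2) (conv_add_left (convInt_of_multBound hd hk hσ hs hM hC hu hv)
    (convInt_of_multBound hd hk hσ hs hM hC hu' hv)).symm).symm

theorem bil_add_right {d : ℕ} (hd : 2 ≤ d) {k : ℕ} (hk : ((d : ℝ) + 1) / 2 < k)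
    {σ s s' C : ℝ} (hσ : ((d : ℝ) + 1) / 2 < σ) (hs : 0 ≤ s) {M : ℤ → ℤ → ℂ}
    (hM : MultBound d k σ s s' C M) (hC : 0 ≤ C) {u v v' : L2 d} (hu : u ∈ ySub d k s')
    (hv : v ∈ ySub d k s') (hv' : v' ∈ ySub d k s') :
    bil M u (v + v') = bil M u v + bil M u v' := by
  have h1 := (bil_aux hd hk hσ hs hM hC hu hv).1
  have h2 := (bil_aux hd hk hσ hs hM hC hu hv').1
  rw [bil, bil, bil, ← syn_add h1 h2, conv_congr M (Filter.EventuallyEq.refl _ _) (spec_add v v')]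
  exact (syn_congr (h1.add h2) (conv_add_right (convInt_of_multBound hd hk hσ hs hM hC hu hv)
    (convInt_of_multBound hd hk hσ hs hM hC hu hv')).symm).symm

theorem bil_smul_left {d : ℕ} (hd : 2 ≤ d) {k : ℕ} (hk : ((d : ℝ) + 1) / 2 < k)
    {σ s s' C : ℝ} (hσ : ((d : ℝ) + 1) / 2 < σ) (hs : 0 ≤ s) {M : ℤ → ℤ → ℂ}
    (hM : MultBound d k σ s s' C M) (hC : 0 ≤ C) {u v : L2 d} (c : ℂ) (hu : u ∈ ySub d k s')
    (hv : v ∈ ySub d k s') : bil M (c • u) v = c • bil M u v := by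
  have h1 := (bil_aux hd hk hσ hs hM hC hu hv).1
  rw [bil, bil, ← syn_smul h1, conv_congr M (spec_smul c u) (Filter.EventuallyEq.refl _ _),
    conv_smul_left]

theorem bil_smul_right {d : ℕ} (hd : 2 ≤ d) {k : ℕ} (hk : ((d : ℝ) + 1) / 2 < k)
    {σ s s' C : ℝ} (hσ : ((d : ℝ) + 1) / 2 < σ) (hs : 0 ≤ s) {M : ℤ → ℤ → ℂ}
    (hM : MultBound d k σ s s' C M) (hC : 0 ≤ C) {u v : L2 d} (c : ℂ) (hu : u ∈ ySub d k s')
    (hv : v ∈ ySub d k s') : bil M u (c • v) = c • bil M u v := by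
  have h1 := (bil_aux hd hk hσ hs hM hC hu hv).1
  rw [bil, bil, ← syn_smul h1, conv_congr M (Filter.EventuallyEq.refl _ _) (spec_smul c v),
    conv_smul_right]

/-! ### The bilinear operators of the boundary system -/

/-- When `q` dominates, the bracket of `q + r` is at most twice that of `q`, so `q` carries the
whole polynomial weight. Only the exponential must be shared with `r`, whose own polynomial weight
remains free. -/
theorem W_add_le {d : ℕ} (k : ℕ) {s : ℝ} (hs : 0 ≤ s) {q r : Tan d × ℤ} (h : fn r ≤ fn q) :
    W k s (q + r) ≤ 2 ^ k * (W k s q * Real.exp (s * fn r)) := by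
  have h1 := fn_add_le q r
  have h0 := fn_nonneg (q + r)
  have hq := jb_pos q
  have h2 : jb (q + r) ≤ 4 * jb q := by
    have : fn (q + r) ≤ 2 * fn q := by linarith
    unfold jb
    nlinarith
  have h3 : (4 * jb q) ^ ((k : ℝ) / 2) = 2 ^ k * jb q ^ ((k : ℝ) / 2) := by
    rw [Real.mul_rpow (by norm_num) hq.le]
    congr 1
    have : (4 : ℝ) = 2 ^ (2 : ℝ) := by norm_num
    rw [this, ← Real.rpow_mul (by norm_num), ← Real.rpow_natCast]
    congr 1; ring
  rw [W_eq, W_eq]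
  calc Real.exp (s * fn (q + r)) * jb (q + r) ^ ((k : ℝ) / 2)
      ≤ Real.exp (s * fn q + s * fn r) * (4 * jb q) ^ ((k : ℝ) / 2) := by
        have := (jb_pos (q + r)).le
        gcongr
        nlinarith
    _ = _ := by rw [h3, Real.exp_add]; ring

/-- The frequency plane is split according to which of `q` and `r` is larger. The symmetry of the
majorant `N` exchanges the two regions, and each uses only the decay in its smaller frequency. -/
theorem multBound_of_symm {d k : ℕ} {σ s s' C : ℝ} {M : ℤ → ℤ → ℂ} {N : ℤ → ℤ → ℝ}
    (hs : 0 ≤ s) (hC : 0 ≤ C) (hN0 : ∀ a b, 0 ≤ N a b)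
    (hN : ∀ a b, ‖M a b‖ ≤ N a b) (hsymm : ∀ a b, N a b = N b a)
    (h : ∀ q r : Tan d × ℤ, fn r ≤ fn q → W k s q * Real.exp (s * fn r) * N q.2 r.2 ≤
      C * (W k s' q * W k s' r) * jb r ^ (-σ / 2)) :
    MultBound d k σ s s' (2 ^ k * C) M := by
  have key : ∀ q r : Tan d × ℤ, fn r ≤ fn q → W k s (q + r) * N q.2 r.2 ≤
      2 ^ k * C * (W k s' q * W k s' r) * (jb q ^ (-σ / 2) + jb r ^ (-σ / 2)) := by
    intro q r hqr
    have h1 := W_add_le k hs hqr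
    have h2 := h q r hqr
    have h3 := Real.rpow_nonneg (jb_pos q).le (-σ / 2)
    have h5 := W_pos k s' q
    have h6 := W_pos k s' r
    calc W k s (q + r) * N q.2 r.2 ≤ 2 ^ k * (W k s q * Real.exp (s * fn r)) * N q.2 r.2 := by
          gcongr; exact hN0 _ _
      _ = 2 ^ k * (W k s q * Real.exp (s * fn r) * N q.2 r.2) := by ring
      _ ≤ 2 ^ k * (C * (W k s' q * W k s' r) * jb r ^ (-σ / 2)) := by gcongr
      _ ≤ 2 ^ k * (C * (W k s' q * W k s' r) * (jb q ^ (-σ / 2) + jb r ^ (-σ / 2))) := by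
          gcongr; linarith
      _ = _ := by ring
  intro q r
  have h4 : W k s (q + r) * ‖M q.2 r.2‖ ≤ W k s (q + r) * N q.2 r.2 :=
    mul_le_mul_of_nonneg_left (hN _ _) (W_pos _ _ _).le
  refine h4.trans ?_
  rcases le_total (fn r) (fn q) with hqr | hqr
  · exact key q r hqr
  · have := key r q hqr
    rw [hsymm, add_comm q r]
    refine this.trans_eq (by ring)

/-- The polynomial weight of the smaller frequency is entirely available as decay, so there is no
loss in `s`: this is the algebra property of `Y_s`. -/
theorem multBound_one {d k : ℕ} {σ s : ℝ} (hs : 0 ≤ s) (hσ : σ ≤ k) :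
    MultBound d k σ s s (2 ^ k * 1) fun _ _ => 1 := by
  refine multBound_of_symm (N := fun _ _ => 1) hs zero_le_one (fun _ _ => zero_le_one)
    (fun _ _ => by simp) (fun _ _ => rfl) fun q r _ => ?_
  have hr := jb_pos r
  have hq := (W_pos k s q).le
  rw [W_eq k s r, one_mul, mul_one]
  have h1 : 1 ≤ jb r ^ ((k : ℝ) / 2) * jb r ^ (-σ / 2) := by
    rw [← Real.rpow_add hr]
    exact Real.one_le_rpow (one_le_jb r) (by linarith)
  calc W k s q * Real.exp (s * fn r) ≤
        W k s q * Real.exp (s * fn r) * (jb r ^ ((k : ℝ) / 2) * jb r ^ (-σ / 2)) :=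
        le_mul_of_one_le_right (by positivity) h1
    _ = _ := by ring

/-- The multiplier of the operator `fPer`. -/
def perMult (δ₁ δ₃ : ℝ) (l₁ l₃ : ℤ) : ℂ :=
  if l₁ + l₃ = 0 ∨ l₁ * l₃ = 0 then 0 else Complex.I / ((l₁ * δ₁ + l₃ * δ₃ : ℝ) : ℂ)

/-- The multiplier of the operator `(u, v) ↦ fPer (∂_Θ u, ∂_Θ v)`. -/
def perMultTheta (δ₁ δ₃ : ℝ) (l₁ l₃ : ℤ) : ℂ :=
  perMult δ₁ δ₃ l₁ l₃ * ((Complex.I * l₁) * (Complex.I * l₃))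

theorem norm_perMultTheta_le {δ₁ δ₃ C m : ℝ} (hC : 0 ≤ C)
    (h : ∀ l₁ l₃ : ℤ, l₁ ≠ 0 → l₃ ≠ 0 →
      1 ≤ C * min (|(l₁ : ℝ)| ^ m) (|(l₃ : ℝ)| ^ m) * |l₁ * δ₁ + l₃ * δ₃|) (l₁ l₃ : ℤ) :
    ‖perMultTheta δ₁ δ₃ l₁ l₃‖ ≤
      C * min (|(l₁ : ℝ)| ^ m) (|(l₃ : ℝ)| ^ m) * (|(l₁ : ℝ)| * |(l₃ : ℝ)|) := by
  have h0 : 0 ≤ min (|(l₁ : ℝ)| ^ m) (|(l₃ : ℝ)| ^ m) := le_min (by positivity) (by positivity)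
  unfold perMultTheta perMult
  split_ifs with hc
  · simp only [zero_mul, norm_zero]; positivity
  · push Not at hc
    obtain ⟨h1, h3⟩ := mul_ne_zero_iff.1 hc.2
    have hl := h l₁ l₃ h1 h3
    have hpos : 0 < |(l₁ : ℝ) * δ₁ + l₃ * δ₃| := by
      rcases (abs_nonneg ((l₁ : ℝ) * δ₁ + l₃ * δ₃)).eq_or_lt with he | he
      · rw [← he, mul_zero] at hl; linarith
      · exact he
    simp only [norm_mul, norm_div, Complex.norm_I, one_mul, Complex.norm_real, Real.norm_eq_abs,
      Complex.norm_intCast]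
    gcongr
    rw [div_le_iff₀ hpos]
    exact hl

/-- In the minimum bounding the inverse divisor, the power of the smaller frequency `r` is chosen.
With the `Θ`-derivative on `r` it costs `m + 1` powers, taken from the polynomial weight of `r`,
which explains `σ = k - m - 1`. The `Θ`-derivative on `q` gives the single factor `1 / (s' - s)`. -/
theorem multBound_perMultTheta {d k : ℕ} {δ₁ δ₃ C m s s' : ℝ} (hC : 0 ≤ C) (hm : 0 ≤ m)
    (h : ∀ l₁ l₃ : ℤ, l₁ ≠ 0 → l₃ ≠ 0 →
      1 ≤ C * min (|(l₁ : ℝ)| ^ m) (|(l₃ : ℝ)| ^ m) * |l₁ * δ₁ + l₃ * δ₃|)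
    (hs : 0 ≤ s) (hss : s < s') :
    MultBound d k ((k : ℝ) - m - 1) s s' (2 ^ k * (C / (s' - s))) (perMultTheta δ₁ δ₃) := by
  have h0 : 0 < s' - s := sub_pos.2 hss
  refine multBound_of_symm hs (by positivity) (N := fun l₁ l₃ =>
    C * min (|(l₁ : ℝ)| ^ m) (|(l₃ : ℝ)| ^ m) * (|(l₁ : ℝ)| * |(l₃ : ℝ)|))
    (fun a b => by
      have : 0 ≤ min (|(a : ℝ)| ^ m) (|(b : ℝ)| ^ m) := le_min (by positivity) (by positivity)
      positivity)
    (fun a b => norm_perMultTheta_le hC h a b)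
    (fun a b => by simp only [min_comm, mul_comm |(a : ℝ)|]) fun q r _ => ?_
  have hr := jb_pos r
  have hq := fn_nonneg q
  have hWq := (W_pos k s q).le
  have hWq' := (W_pos k s' q).le
  have e1 : |(r.2 : ℝ)| ≤ jb r ^ ((1 : ℝ) / 2) := by
    refine (abs_snd_le_fn r).trans ?_
    have := fn_pow_le_jb r 1
    simpa using this
  have e2 : |(r.2 : ℝ)| ^ m * |(r.2 : ℝ)| ≤ jb r ^ ((m + 1) / 2) := by
    calc |(r.2 : ℝ)| ^ m * |(r.2 : ℝ)| ≤ (jb r ^ ((1 : ℝ) / 2)) ^ m * jb r ^ ((1 : ℝ) / 2) := by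
          gcongr
      _ = _ := by
          rw [← Real.rpow_mul hr.le, ← Real.rpow_add hr]; congr 1; ring
  have e3 := fn_mul_W_le k hss q
  have e4 : Real.exp (s * fn r) ≤ Real.exp (s' * fn r) := by
    have := fn_nonneg r
    gcongr
  have e5 : jb r ^ ((m + 1) / 2) = jb r ^ ((k : ℝ) / 2) * jb r ^ (-((k : ℝ) - m - 1) / 2) := by
    rw [← Real.rpow_add hr]; congr 1; ring
  calc W k s q * Real.exp (s * fn r) *
        (C * min (|(q.2 : ℝ)| ^ m) (|(r.2 : ℝ)| ^ m) * (|(q.2 : ℝ)| * |(r.2 : ℝ)|))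
      ≤ W k s q * Real.exp (s * fn r) *
        (C * |(r.2 : ℝ)| ^ m * (fn q * |(r.2 : ℝ)|)) := by
        gcongr
        · exact min_le_right _ _
        · exact abs_snd_le_fn q
    _ = C * (fn q * W k s q) * (Real.exp (s * fn r) * (|(r.2 : ℝ)| ^ m * |(r.2 : ℝ)|)) := by ring
    _ ≤ C * (1 / (s' - s) * W k s' q) * (Real.exp (s' * fn r) * jb r ^ ((m + 1) / 2)) := by
        gcongr
    _ = _ := by rw [W_eq k s' r, e5]; ring

theorem coeFn_eq_synth {d : ℕ} {u : L2 d} (h : Good (spec u)) : u =ᵐ[meas d] synth (spec u) := by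
  have h1 : u = syn (spec u) := syn_spec h (Filter.EventuallyEq.refl _ _)
  have h2 := coeFn_syn h
  rwa [← h1] at h2

/-! ### Operator classes on the scale, and the operators that belong to them. -/

/-- A bounded bilinear operator on the spaces `Y_s`. -/
structure BilBdd {d : ℕ} (k : ℕ) (C : ℝ) (B : L2 d → L2 d → L2 d) : Prop where
  mem : ∀ {s : ℝ} {u v : L2 d}, 0 < s → s < 1 → u ∈ ySub d k s → v ∈ ySub d k s →
    B u v ∈ ySub d k s
  le : ∀ {s : ℝ} {u v : L2 d}, 0 < s → s < 1 → u ∈ ySub d k s → v ∈ ySub d k s →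
    nrm k s (B u v) ≤ C * (nrm k s u * nrm k s v)
  add_left : ∀ {s : ℝ} {u u' v : L2 d}, 0 < s → s < 1 → u ∈ ySub d k s → u' ∈ ySub d k s →
    v ∈ ySub d k s → B (u + u') v = B u v + B u' v
  add_right : ∀ {s : ℝ} {u v v' : L2 d}, 0 < s → s < 1 → u ∈ ySub d k s → v ∈ ySub d k s →
    v' ∈ ySub d k s → B u (v + v') = B u v + B u v'
  smul_left : ∀ {s : ℝ} {u v : L2 d} (c : ℂ), 0 < s → s < 1 → u ∈ ySub d k s → v ∈ ySub d k s →
    B (c • u) v = c • B u v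
  smul_right : ∀ {s : ℝ} {u v : L2 d} (c : ℂ), 0 < s → s < 1 → u ∈ ySub d k s → v ∈ ySub d k s →
    B u (c • v) = c • B u v

/-- A bilinear operator that acts on the scale `Y_s` with the loss of a derivative. -/
structure BilLoss {d : ℕ} (k : ℕ) (C : ℝ) (B : L2 d → L2 d → L2 d) : Prop where
  mem : ∀ {s s' : ℝ} {u v : L2 d}, 0 < s → s < s' → s' < 1 → u ∈ ySub d k s' → v ∈ ySub d k s' →
    B u v ∈ ySub d k s
  le : ∀ {s s' : ℝ} {u v : L2 d}, 0 < s → s < s' → s' < 1 → u ∈ ySub d k s' → v ∈ ySub d k s' →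
    nrm k s (B u v) ≤ C / (s' - s) * (nrm k s' u * nrm k s' v)
  add_left : ∀ {s : ℝ} {u u' v : L2 d}, 0 < s → s < 1 → u ∈ ySub d k s → u' ∈ ySub d k s →
    v ∈ ySub d k s → B (u + u') v = B u v + B u' v
  add_right : ∀ {s : ℝ} {u v v' : L2 d}, 0 < s → s < 1 → u ∈ ySub d k s → v ∈ ySub d k s →
    v' ∈ ySub d k s → B u (v + v') = B u v + B u v'
  smul_left : ∀ {s : ℝ} {u v : L2 d} (c : ℂ), 0 < s → s < 1 → u ∈ ySub d k s → v ∈ ySub d k s →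
    B (c • u) v = c • B u v
  smul_right : ∀ {s : ℝ} {u v : L2 d} (c : ℂ), 0 < s → s < 1 → u ∈ ySub d k s → v ∈ ySub d k s →
    B u (c • v) = c • B u v

/-- Both factors agree almost everywhere with the synthesis of their transforms, whose product is
the synthesis of the convolution. In particular the product is square integrable, so the default
value of `toL2` is not taken. -/
theorem mulL2_eq_bil {d : ℕ} (hd : 2 ≤ d) {k : ℕ} (hk : ((d : ℝ) + 1) / 2 < k) {s : ℝ}
    (hs : 0 ≤ s) {u v : L2 d} (hu : u ∈ ySub d k s) (hv : v ∈ ySub d k s) :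
    mulL2 u v = bil (fun _ _ => 1) u v := by
  have hM := multBound_one (d := d) (k := k) hs le_rfl
  have hgood := (bil_aux hd hk hk hs hM (by positivity) hu hv).1
  have hci := convInt_of_multBound hd hk hk hs hM (by positivity) hu hv
  unfold mulL2 bil syn
  rw [toL2_of_ae (Filter.EventuallyEq.refl _ _) (memLp_synth hgood)]
  refine toL2_of_ae ?_ _
  filter_upwards [coeFn_eq_synth (good_spec hd hs hu hk),
    coeFn_eq_synth (good_spec hd hs hv hk)] with x h1 h2
  rw [h1, h2, synth_conv_one hci]

theorem bilBdd_mulL2 {d : ℕ} (hd : 2 ≤ d) {k : ℕ} (hk : ((d : ℝ) + 1) / 2 < k) :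
    BilBdd k (convConst d k * (2 ^ k * 1)) (mulL2 : L2 d → L2 d → L2 d) := by
  have hM := fun {s : ℝ} (hs : 0 < s) => multBound_one (d := d) (k := k) hs.le le_rfl
  have hC : (0 : ℝ) ≤ 2 ^ k * 1 := by positivity
  have e := fun {s : ℝ} {u v : L2 d} (hs : 0 < s) (hu : u ∈ ySub d k s) (hv : v ∈ ySub d k s) =>
    mulL2_eq_bil hd hk hs.le hu hv
  refine ⟨fun hs _ hu hv => ?_, fun hs _ hu hv => ?_, fun hs _ hu hu' hv => ?_,
    fun hs _ hu hv hv' => ?_, fun c hs _ hu hv => ?_, fun c hs _ hu hv => ?_⟩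
  · rw [e hs hu hv]
    exact (bil_aux hd hk hk hs.le (hM hs) hC hu hv).2.1
  · rw [e hs hu hv]
    exact (bil_aux hd hk hk hs.le (hM hs) hC hu hv).2.2
  · rw [e hs hu hv, e hs hu' hv, e hs (Submodule.add_mem _ hu hu') hv]
    exact bil_add_left hd hk hk hs.le (hM hs) hC hu hu' hv
  · rw [e hs hu hv, e hs hu hv', e hs hu (Submodule.add_mem _ hv hv')]
    exact bil_add_right hd hk hk hs.le (hM hs) hC hu hv hv'
  · rw [e hs hu hv, e hs (Submodule.smul_mem _ c hu) hv]
    exact bil_smul_left hd hk hk hs.le (hM hs) hC c hu hv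
  · rw [e hs hu hv, e hs hu (Submodule.smul_mem _ c hv)]
    exact bil_smul_right hd hk hk hs.le (hM hs) hC c hu hv

theorem phase_theta {d : ℕ} (p : Tan d × ℤ) : phase 0 1 p = p.2 := by
  simp [phase]

/-- The two `Θ`-derivatives are moved into the multiplier, so that the estimates apply to `u` and
`v` themselves; `synth_conv` then reproduces the defining series. -/
theorem fPer_eq_bil {d : ℕ} (hd : 2 ≤ d) {k : ℕ} {m : ℝ} (hm : 0 ≤ m)
    (hk : m + 2 + ((d : ℝ) + 1) / 2 < k) {δ₁ δ₃ C : ℝ} (hC : 0 ≤ C)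
    (h : ∀ l₁ l₃ : ℤ, l₁ ≠ 0 → l₃ ≠ 0 →
      1 ≤ C * min (|(l₁ : ℝ)| ^ m) (|(l₃ : ℝ)| ^ m) * |l₁ * δ₁ + l₃ * δ₃|)
    {s : ℝ} (hs : 0 < s) {u v : L2 d} (hu : u ∈ ySub d k s) (hv : v ∈ ySub d k s) :
    fPer δ₁ δ₃ (dTheta u) (dTheta v) = bil (perMultTheta δ₁ δ₃) u v := by
  -- The identity is qualitative, so any index below `s` serves for the output; `s / 2` is used.
  have hM := multBound_perMultTheta (d := d) (k := k) hC hm h (half_pos hs).le (half_lt_self hs)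
  have hC' : 0 ≤ 2 ^ k * (C / (s - s / 2)) := by
    have : 0 < s - s / 2 := by linarith
    positivity
  have hσ : ((d : ℝ) + 1) / 2 < (k : ℝ) - m - 1 := by linarith
  have hk' : ((d : ℝ) + 1) / 2 < k := by linarith
  have hgood := (bil_aux hd hk' hσ (half_pos hs).le hM hC' hu hv).1
  have hci := convInt_of_multBound hd hk' hσ (half_pos hs).le hM hC' hu hv
  have hH := good_dDir hd hs.le hu (by linarith) 0 1
  have hG := good_dDir hd hs.le hv (by linarith) 0 1
  have hdu := dDir_eq hd hs.le hu (by linarith) 0 1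
  have hdv := dDir_eq hd hs.le hv (by linarith) 0 1
  rw [← dTheta_eq] at hdu hdv
  set H : Tan d × ℤ → ℂ := fun p => (Complex.I * phase 0 1 p) * spec u p with hHdef
  set G : Tan d × ℤ → ℂ := fun p => (Complex.I * phase 0 1 p) * spec v p with hGdef
  have hpt : ∀ q p : Tan d × ℤ, perMult δ₁ δ₃ q.2 (p.2 - q.2) * (H q * G (p - q)) =
      perMultTheta δ₁ δ₃ q.2 (p.2 - q.2) * (spec u q * spec v (p - q)) := by
    intro q p
    simp only [hHdef, hGdef, phase_theta, perMultTheta, Prod.snd_sub]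
    push_cast
    ring
  have hconv : conv (perMult δ₁ δ₃) H G = conv (perMultTheta δ₁ δ₃) (spec u) (spec v) := by
    ext p
    exact integral_congr_ae (ae_of_all _ fun q => hpt q p)
  have hci' : ConvInt (perMult δ₁ δ₃) H G := by
    refine Integrable.congr hci (ae_of_all _ fun z => ?_)
    exact (hpt z.1 z.2).symm
  unfold bil syn
  rw [toL2_of_ae (Filter.EventuallyEq.refl _ _) (memLp_synth hgood)]
  refine toL2_of_ae ?_ _
  have h1 := coeffFun_congr (coeFn_syn hH)
  have h2 := coeffFun_congr (coeFn_syn hG)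
  rw [← hdu] at h1
  rw [← hdv] at h2
  have h1' := (Measure.quasiMeasurePreserving_fst (μ := (volume : Measure (Tan d)))
    (ν := AddCircle.haarAddCircle (T := 2 * Real.pi))).ae h1
  have h2' := (Measure.quasiMeasurePreserving_fst (μ := (volume : Measure (Tan d)))
    (ν := AddCircle.haarAddCircle (T := 2 * Real.pi))).ae h2
  filter_upwards [h1', h2'] with x hx1 hx2
  obtain ⟨y, θ⟩ := x
  rw [← hconv, synth_conv hci']
  refine tsum_congr fun l => ?_
  -- `perMult` vanishes when its arguments add up to zero, which reproduces the omitted mode `l =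
  -- 0`.
  by_cases hl : l = 0
  · subst hl
    simp [perMult]
  · rw [if_neg hl]
    congr 1
    refine tsum_congr fun l₁ => ?_
    simp only at hx1 hx2
    rw [hx1, hx2, coeffFun_synth hH.integrable, coeffFun_synth hG.integrable, perMult]
    have : (l₁ + (l - l₁) = 0 ∨ l₁ * (l - l₁) = 0) ↔ l₁ * (l - l₁) = 0 := by
      rw [add_sub_cancel]; simp [hl]
    simp only [this]
    split_ifs with hc
    · simp
    · push_cast
      ring

theorem bilLoss_fPer {d : ℕ} (hd : 2 ≤ d) {k : ℕ} {m : ℝ} (hm : 0 ≤ m)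
    (hk : m + 2 + ((d : ℝ) + 1) / 2 < k) {δ₁ δ₃ C : ℝ} (hC : 0 ≤ C)
    (h : ∀ l₁ l₃ : ℤ, l₁ ≠ 0 → l₃ ≠ 0 →
      1 ≤ C * min (|(l₁ : ℝ)| ^ m) (|(l₃ : ℝ)| ^ m) * |l₁ * δ₁ + l₃ * δ₃|) :
    BilLoss k (convConst d ((k : ℝ) - m - 1) * (2 ^ k * C))
      (fun u v : L2 d => fPer δ₁ δ₃ (dTheta u) (dTheta v)) := by
  have hM := fun {s s' : ℝ} (hs : 0 < s) (hss : s < s') =>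
    multBound_perMultTheta (d := d) (k := k) hC hm h hs.le hss
  have hC' : ∀ {s s' : ℝ}, s < s' → 0 ≤ 2 ^ k * (C / (s' - s)) := fun hss => by
    have := sub_pos.2 hss
    positivity
  have hσ : ((d : ℝ) + 1) / 2 < (k : ℝ) - m - 1 := by linarith
  have hk' : ((d : ℝ) + 1) / 2 < k := by linarith
  have e := fun {s : ℝ} {u v : L2 d} (hs : 0 < s) (hu : u ∈ ySub d k s) (hv : v ∈ ySub d k s) =>
    fPer_eq_bil hd hm hk hC h hs hu hv
  refine ⟨fun hs hss _ hu hv => ?_, fun {s s' u v} hs hss _ hu hv => ?_,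
    fun hs _ hu hu' hv => ?_,
    fun hs _ hu hv hv' => ?_, fun c hs _ hu hv => ?_, fun c hs _ hu hv => ?_⟩
  · rw [e (hs.trans hss) hu hv]
    exact (bil_aux hd hk' hσ hs.le (hM hs hss) (hC' hss) hu hv).2.1
  · rw [e (hs.trans hss) hu hv]
    refine (bil_aux hd hk' hσ hs.le (hM hs hss) (hC' hss) hu hv).2.2.trans_eq ?_
    ring
  · rw [e hs hu hv, e hs hu' hv, e hs (Submodule.add_mem _ hu hu') hv]
    exact bil_add_left hd hk' hσ (half_pos hs).le (hM (half_pos hs) (half_lt_self hs))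
      (hC' (half_lt_self hs)) hu hu' hv
  · rw [e hs hu hv, e hs hu hv', e hs hu (Submodule.add_mem _ hv hv')]
    exact bil_add_right hd hk' hσ (half_pos hs).le (hM (half_pos hs) (half_lt_self hs))
      (hC' (half_lt_self hs)) hu hv hv'
  · rw [e hs hu hv, e hs (Submodule.smul_mem _ c hu) hv]
    exact bil_smul_left hd hk' hσ (half_pos hs).le (hM (half_pos hs) (half_lt_self hs))
      (hC' (half_lt_self hs)) c hu hv
  · rw [e hs hu hv, e hs hu (Submodule.smul_mem _ c hv)]
    exact bil_smul_right hd hk' hσ (half_pos hs).le (hM (half_pos hs) (half_lt_self hs))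
      (hC' (half_lt_self hs)) c hu hv

theorem BilBdd.comp_linLoss {d k : ℕ} {C C' : ℝ} {B : L2 d → L2 d → L2 d} {L : L2 d → L2 d}
    (hB : BilBdd k C B) (hL : LinLoss k C' L) (hC' : 0 ≤ C') :
    BilLoss k (C' * C) fun u v => L (B u v) := by
  refine ⟨fun hs hss h1 hu hv => hL.mem hs hss h1 (hB.mem (hs.trans hss) h1 hu hv),
    fun {s s' u v} hs hss h1 hu hv => ?_, fun hs h1 hu hu' hv => ?_,
    fun hs h1 hu hv hv' => ?_, fun c hs h1 hu hv => ?_, fun c hs h1 hu hv => ?_⟩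
  · have h0 := sub_pos.2 hss
    refine (hL.le hs hss h1 (hB.mem (hs.trans hss) h1 hu hv)).trans ?_
    calc C' / (s' - s) * nrm k s' (B u v) ≤
          C' / (s' - s) * (C * (nrm k s' u * nrm k s' v)) := by
          gcongr
          exact hB.le (hs.trans hss) h1 hu hv
      _ = _ := by ring
  · rw [hB.add_left hs h1 hu hu' hv, hL.map_add hs h1 (hB.mem hs h1 hu hv) (hB.mem hs h1 hu' hv)]
  · rw [hB.add_right hs h1 hu hv hv', hL.map_add hs h1 (hB.mem hs h1 hu hv) (hB.mem hs h1 hu hv')]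
  · rw [hB.smul_left c hs h1 hu hv, hL.map_smul c hs h1 (hB.mem hs h1 hu hv)]
  · rw [hB.smul_right c hs h1 hu hv, hL.map_smul c hs h1 (hB.mem hs h1 hu hv)]

theorem BilBdd.smul {d k : ℕ} {C : ℝ} {B : L2 d → L2 d → L2 d} (hB : BilBdd k C B) (a : ℂ) :
    BilBdd k (‖a‖ * C) fun u v => a • B u v := by
  refine ⟨fun hs h1 hu hv => Submodule.smul_mem _ a (hB.mem hs h1 hu hv),
    fun hs h1 hu hv => ?_, fun hs h1 hu hu' hv => ?_,
    fun hs h1 hu hv hv' => ?_, fun c hs h1 hu hv => ?_, fun c hs h1 hu hv => ?_⟩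
  · rw [nrm_smul (hB.mem hs h1 hu hv), mul_assoc]
    gcongr
    exact hB.le hs h1 hu hv
  · rw [hB.add_left hs h1 hu hu' hv, smul_add]
  · rw [hB.add_right hs h1 hu hv hv', smul_add]
  · rw [hB.smul_left c hs h1 hu hv, smul_comm]
  · rw [hB.smul_right c hs h1 hu hv, smul_comm]

theorem BilLoss.smul {d k : ℕ} {C : ℝ} {B : L2 d → L2 d → L2 d} (hB : BilLoss k C B) (a : ℂ) :
    BilLoss k (‖a‖ * C) fun u v => a • B u v := by
  refine ⟨fun hs hss h1 hu hv => Submodule.smul_mem _ a (hB.mem hs hss h1 hu hv),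
    fun hs hss h1 hu hv => ?_, fun hs h1 hu hu' hv => ?_,
    fun hs h1 hu hv hv' => ?_, fun c hs h1 hu hv => ?_, fun c hs h1 hu hv => ?_⟩
  · rw [nrm_smul (hB.mem hs hss h1 hu hv), mul_div_assoc, mul_assoc]
    gcongr
    exact hB.le hs hss h1 hu hv
  · rw [hB.add_left hs h1 hu hu' hv, smul_add]
  · rw [hB.add_right hs h1 hu hv hv', smul_add]
  · rw [hB.smul_left c hs h1 hu hv, smul_comm]
  · rw [hB.smul_right c hs h1 hu hv, smul_comm]

theorem BilLoss.add {d k : ℕ} {C C' : ℝ} {B B' : L2 d → L2 d → L2 d} (hB : BilLoss k C B)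
    (hB' : BilLoss k C' B') : BilLoss k (C + C') fun u v => B u v + B' u v := by
  refine ⟨fun hs hss h1 hu hv =>
      Submodule.add_mem _ (hB.mem hs hss h1 hu hv) (hB'.mem hs hss h1 hu hv),
    fun hs hss h1 hu hv => ?_, fun hs h1 hu hu' hv => ?_,
    fun hs h1 hu hv hv' => ?_, fun c hs h1 hu hv => ?_, fun c hs h1 hu hv => ?_⟩
  · refine (nrm_add_le (hB.mem hs hss h1 hu hv) (hB'.mem hs hss h1 hu hv)).trans ?_
    rw [add_div, add_mul]
    exact add_le_add (hB.le hs hss h1 hu hv) (hB'.le hs hss h1 hu hv)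
  · rw [hB.add_left hs h1 hu hu' hv, hB'.add_left hs h1 hu hu' hv]; abel
  · rw [hB.add_right hs h1 hu hv hv', hB'.add_right hs h1 hu hv hv']; abel
  · rw [hB.smul_left c hs h1 hu hv, hB'.smul_left c hs h1 hu hv, smul_add]
  · rw [hB.smul_right c hs h1 hu hv, hB'.smul_right c hs h1 hu hv, smul_add]

theorem BilLoss.mono {d k : ℕ} {C C' : ℝ} {B : L2 d → L2 d → L2 d} (hB : BilLoss k C B)
    (h : C ≤ C') : BilLoss k C' B := by
  refine ⟨hB.mem, fun {s s' u v} hs hss h1 hu hv => (hB.le hs hss h1 hu hv).trans ?_, hB.add_left,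
    hB.add_right, hB.smul_left, hB.smul_right⟩
  have h0 := sub_pos.2 hss
  have := mul_nonneg (nrm_nonneg k s' u) (nrm_nonneg k s' v)
  gcongr

theorem LinLoss.mono {d k : ℕ} {C C' : ℝ} {L : L2 d → L2 d} (hL : LinLoss k C L)
    (h : C ≤ C') : LinLoss k C' L := by
  refine ⟨hL.mem, fun {s s' u} hs hss h1 hu => (hL.le hs hss h1 hu).trans ?_, hL.map_add,
    hL.map_smul⟩
  have h0 := sub_pos.2 hss
  have := nrm_nonneg k s' u
  gcongr

/-! ### Power series in a real variable -/

section PowerSeries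

variable {F G : Type*} [NormedAddCommGroup F] [NormedSpace ℝ F] [NormedAddCommGroup G]
  [NormedSpace ℝ G]

/-- The power series with coefficients `c`. -/
def powSer (c : ℕ → F) : FormalMultilinearSeries ℝ ℝ F :=
  fun n => ContinuousMultilinearMap.mkPiRing ℝ (Fin n) (c n)

theorem coeff_powSer (c : ℕ → F) (n : ℕ) : (powSer c).coeff n = c n := by
  simp [powSer, FormalMultilinearSeries.coeff]

theorem hasFPowerSeriesOnBall_powSer [CompleteSpace F] {c : ℕ → F} {f : ℝ → F} {R : ℝ}
    (hR : 0 < R) (hs : ∀ r, 0 ≤ r → r < R → Summable fun n => r ^ n * ‖c n‖)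
    (hf : ∀ t, |t| < R → HasSum (fun n => t ^ n • c n) (f t)) :
    HasFPowerSeriesOnBall f (powSer c) 0 (ENNReal.ofReal R) := by
  refine ⟨?_, by simpa using hR, fun {y} hy => ?_⟩
  · refine le_of_forall_lt_imp_le_of_dense fun x hx => ?_
    obtain ⟨r, rfl⟩ : ∃ r : NNReal, (r : ℝ≥0∞) = x := ⟨x.toNNReal, ENNReal.coe_toNNReal hx.ne_top⟩
    refine (powSer c).le_radius_of_summable ?_
    have h1 : (r : ℝ) < R := by
      rw [← ENNReal.ofReal_coe_nnreal] at hx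
      exact (ENNReal.ofReal_lt_ofReal_iff hR).1 hx
    refine (hs r r.2 h1).congr fun n => ?_
    rw [FormalMultilinearSeries.norm_apply_eq_norm_coef, coeff_powSer, mul_comm]
  · have h1 : |y| < R := by
      rw [Metric.mem_eball, edist_zero_right, ← ofReal_norm, Real.norm_eq_abs] at hy
      exact (ENNReal.ofReal_lt_ofReal_iff hR).1 hy
    have h2 := hf y h1
    rw [zero_add]
    refine h2.congr_fun fun n => ?_
    rw [FormalMultilinearSeries.apply_eq_pow_smul_coeff, coeff_powSer]

theorem hasSum_tsum_pow_smul [CompleteSpace F] {c : ℕ → F} {R : ℝ}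
    (hs : ∀ r, 0 ≤ r → r < R → Summable fun n => r ^ n * ‖c n‖) {t : ℝ} (ht : |t| < R) :
    HasSum (fun n => t ^ n • c n) (∑' n, t ^ n • c n) := by
  refine Summable.hasSum (Summable.of_norm ?_)
  refine (hs |t| (abs_nonneg t) ht).congr fun n => ?_
  rw [norm_smul, norm_pow, Real.norm_eq_abs]

theorem analyticOnNhd_of_hasSum [CompleteSpace F] {c : ℕ → F} {f : ℝ → F} {R : ℝ}
    (hR : 0 < R) (hs : ∀ r, 0 ≤ r → r < R → Summable fun n => r ^ n * ‖c n‖)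
    (hf : ∀ t, |t| < R → HasSum (fun n => t ^ n • c n) (f t)) :
    AnalyticOnNhd ℝ f (Ioo (-R) R) := by
  have h := (hasFPowerSeriesOnBall_powSer hR hs hf).analyticOnNhd
  refine h.mono fun t ht => ?_
  rw [Metric.mem_eball, edist_zero_right, ← ofReal_norm, Real.norm_eq_abs]
  exact (ENNReal.ofReal_lt_ofReal_iff hR).2 (abs_lt.2 ht)

theorem iteratedDeriv_of_hasSum [CompleteSpace F] {c : ℕ → F} {f : ℝ → F} {R : ℝ}
    (hR : 0 < R) (hs : ∀ r, 0 ≤ r → r < R → Summable fun n => r ^ n * ‖c n‖)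
    (hf : ∀ t, |t| < R → HasSum (fun n => t ^ n • c n) (f t)) (n : ℕ) :
    iteratedDeriv n f 0 = (n.factorial : ℝ) • c n := by
  have h := (hasFPowerSeriesOnBall_powSer hR hs hf).factorial_smul 1 n
  rw [FormalMultilinearSeries.apply_eq_pow_smul_coeff, coeff_powSer, one_pow, one_smul] at h
  rw [iteratedDeriv_eq_iteratedFDeriv, ← h, Nat.cast_smul_eq_nsmul]

/-- The Taylor coefficient of order `n` at `0`. -/
def taylorCoeff (f : ℝ → F) (n : ℕ) : F := (n.factorial : ℝ)⁻¹ • iteratedDeriv n f 0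

theorem taylorCoeff_of_hasSum [CompleteSpace F] {c : ℕ → F} {f : ℝ → F} {R : ℝ}
    (hR : 0 < R) (hs : ∀ r, 0 ≤ r → r < R → Summable fun n => r ^ n * ‖c n‖)
    (hf : ∀ t, |t| < R → HasSum (fun n => t ^ n • c n) (f t)) (n : ℕ) :
    taylorCoeff f n = c n := by
  rw [taylorCoeff, iteratedDeriv_of_hasSum hR hs hf, inv_smul_smul₀]
  positivity

theorem taylorCoeff_comp [CompleteSpace F] {f : ℝ → F} (hf : AnalyticAt ℝ f 0) (L : F →L[ℝ] G) (n : ℕ) :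
    taylorCoeff (fun t => L (f t)) n = L (taylorCoeff f n) := by
  unfold taylorCoeff
  rw [map_smul, iteratedDeriv_eq_iteratedFDeriv, iteratedDeriv_eq_iteratedFDeriv]
  have := L.iteratedFDeriv_comp_left (f := f) (x := (0:ℝ)) (i := n) (n := n) hf.contDiffAt le_rfl
  congr 1
  exact congrArg (fun m => m fun _ => (1 : ℝ)) this

/-- Real analyticity on an interval does not force the Taylor series to converge on all of it, so
summability is a hypothesis. The sum is then analytic and agrees with `f` near `0`, hence on the
whole interval by the identity theorem. -/
theorem hasSum_taylorCoeff [CompleteSpace F] {f : ℝ → F} {R : ℝ} (hR : 0 < R)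
    (hf : AnalyticOnNhd ℝ f (Ioo (-R) R))
    (hs : ∀ r, 0 ≤ r → r < R → Summable fun n => r ^ n * ‖taylorCoeff f n‖) {t : ℝ}
    (ht : |t| < R) : HasSum (fun n => t ^ n • taylorCoeff f n) (f t) := by
  set g : ℝ → F := fun t => ∑' n, t ^ n • taylorCoeff f n with hg
  have hgs : ∀ t, |t| < R → HasSum (fun n => t ^ n • taylorCoeff f n) (g t) :=
    fun t ht => hasSum_tsum_pow_smul hs ht
  have h1 := hasFPowerSeriesOnBall_powSer hR hs hgs
  have h0 : (0 : ℝ) ∈ Ioo (-R) R := by constructor <;> linarith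
  obtain ⟨p, hp⟩ := hf 0 h0
  have hpc : p = powSer (taylorCoeff f) := by
    ext1 n
    rw [← p.mkPiRing_coeff_eq n, powSer]
    congr 1
    obtain ⟨r, hr⟩ := hp
    have h := hr.factorial_smul 1 n
    rw [FormalMultilinearSeries.apply_eq_pow_smul_coeff, one_pow, one_smul,
      ← iteratedDeriv_eq_iteratedFDeriv, ← Nat.cast_smul_eq_nsmul ℝ] at h
    rw [taylorCoeff, ← h, inv_smul_smul₀]
    positivity
  have h2 : f =ᶠ[𝓝 0] g := by
    have := h1.hasFPowerSeriesAt
    rw [← hpc] at this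
    have e1 := hasFPowerSeriesAt_iff.1 hp
    have e2 := hasFPowerSeriesAt_iff.1 this
    filter_upwards [e1, e2] with z hz1 hz2
    rw [zero_add] at hz1 hz2
    exact hz1.unique hz2
  have h3 := hf.eqOn_of_preconnected_of_eventuallyEq (analyticOnNhd_of_hasSum hR hs hgs)
    isPreconnected_Ioo h0 h2
  rw [h3 (abs_lt.1 ht)]
  exact hgs t ht

end PowerSeries

/-! ### The Taylor coefficients of the elements of `E_ρ` -/

/-- The weights `(ν+1) c_ν / ((4ρ)^ν (1-s)^(ν+1))` of the Taylor coefficients in `E_ρ`. -/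
def wt (ρ s : ℝ) (ν : ℕ) : ℝ := (ν + 1) * catalan ν / ((4 * ρ) ^ ν * (1 - s) ^ (ν + 1))

theorem catalan_pos (ν : ℕ) : 0 < catalan ν := by
  have h := succ_mul_catalan_eq_centralBinom ν
  have := Nat.centralBinom_pos ν
  rcases Nat.eq_zero_or_pos (catalan ν) with h0 | h0
  · rw [h0] at h; omega
  · exact h0

theorem succ_mul_catalan_le (ν : ℕ) : ((ν : ℝ) + 1) * catalan ν ≤ 4 ^ ν := by
  have h := succ_mul_catalan_eq_centralBinom ν
  have h2 := Nat.centralBinom_le_four_pow ν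
  rw [← h] at h2
  exact_mod_cast h2

theorem wt_pos {ρ s : ℝ} (hρ : 0 < ρ) (hs : s < 1) (ν : ℕ) : 0 < wt ρ s ν := by
  have := catalan_pos ν
  have := sub_pos.2 hs
  unfold wt
  positivity

/-- Since `(ν + 1) c_ν` is a central binomial coefficient, at most `4^ν`, the factor `4` beside `ρ`
compensates it and leaves a geometric series of ratio `r / (ρ (1 - s))`. -/
theorem summable_pow_mul_wt {ρ s r : ℝ} (hρ : 0 < ρ) (hs : s < 1) (hr : 0 ≤ r)
    (h : r < ρ * (1 - s)) : Summable fun ν => r ^ ν * wt ρ s ν := by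
  have h1 := sub_pos.2 hs
  have hq : r / (ρ * (1 - s)) < 1 := (div_lt_one (by positivity)).2 h
  refine Summable.of_nonneg_of_le (fun ν => mul_nonneg (pow_nonneg hr ν) (wt_pos hρ hs ν).le)
    (fun ν => ?_) ((summable_geometric_of_lt_one (by positivity) hq).mul_left (1 / (1 - s)))
  calc r ^ ν * wt ρ s ν ≤ r ^ ν * (4 ^ ν / ((4 * ρ) ^ ν * (1 - s) ^ (ν + 1))) := by
        unfold wt
        gcongr
        exact succ_mul_catalan_le ν
    _ = _ := by
        rw [mul_pow, div_pow, mul_pow, pow_succ]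
        field_simp

/-- The coefficients `β` satisfy the bounds in the definition of the norm of `E_ρ`. -/
def CoeffBound {d : ℕ} (k : ℕ) (ρ : ℝ) (β : ℕ → L2 d) (M : ℝ) : Prop :=
  ∀ s ∈ Ioo (0 : ℝ) 1, ∀ ν, β ν ∈ ySub d k s ∧ nrm k s (β ν) ≤ M * wt ρ s ν

theorem CoeffBound.summable {d k : ℕ} {ρ M : ℝ} {β : ℕ → L2 d} (h : CoeffBound k ρ β M)
    (hρ : 0 < ρ) {s : ℝ} (hs : s ∈ Ioo (0 : ℝ) 1) {r : ℝ} (hr : 0 ≤ r) (hr' : r < ρ * (1 - s)) :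
    Summable fun ν => r ^ ν * nrm k s (β ν) := by
  refine Summable.of_nonneg_of_le (fun ν => mul_nonneg (pow_nonneg hr ν) (nrm_nonneg k s _))
    (fun ν => ?_) ((summable_pow_mul_wt hρ hs.2 hr hr').mul_left M)
  calc r ^ ν * nrm k s (β ν) ≤ r ^ ν * (M * wt ρ s ν) := by
        gcongr
        exact (h s hs ν).2
    _ = _ := by ring

theorem eBound_iff {d k : ℕ} {ρ M : ℝ} {a : ℝ → L2 d} : EBound k ρ a M ↔
    ∀ s ∈ Ioo (0 : ℝ) 1, ∀ ν, ‖taylorCoeff (toY k s a) ν‖ ≤ M * wt ρ s ν := by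
  unfold EBound
  refine forall_congr' fun s => forall_congr' fun hs => forall_congr' fun ν => ?_
  have hf : (0 : ℝ) < ν.factorial := by positivity
  rw [taylorCoeff, norm_smul, norm_inv, Real.norm_of_nonneg hf.le, inv_mul_le_iff₀ hf]
  have : M / (1 - s) ^ (ν + 1) * (((ν + 1).factorial * catalan ν : ℝ) / (4 * ρ) ^ ν) =
      ν.factorial * (M * wt ρ s ν) := by
    rw [wt, Nat.factorial_succ, Nat.cast_mul, Nat.cast_succ, ← div_div]
    ring
  rw [this]

theorem incl_toY {d k : ℕ} {s : ℝ} {a : ℝ → L2 d} {t : ℝ} (h : a t ∈ ySub d k s) :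
    (toY k s a t).incl = a t := by
  have : toY k s a t = Y.mk (a t) h := dif_pos h
  rw [this, Y.incl_mk]

theorem taylorCoeff_congr {F : Type*} [NormedAddCommGroup F] [NormedSpace ℝ F] {f g : ℝ → F}
    (h : f =ᶠ[𝓝 0] g) (n : ℕ) : taylorCoeff f n = taylorCoeff g n := by
  rw [taylorCoeff, taylorCoeff, h.iteratedDeriv_eq]

/-- The interval of analyticity in `Y_s` grows to `(-ρ, ρ)` as `s` decreases to `0`, so each fixed
time can be treated in one suitable `Y_s`. -/
theorem exists_lt_mul_one_sub {ρ t : ℝ} (hρ : 0 < ρ) (ht : t ∈ Ioo (-ρ) ρ) :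
    ∃ s ∈ Ioo (0 : ℝ) 1, |t| < ρ * (1 - s) := by
  have h := abs_lt.2 ht
  refine ⟨(1 - |t| / ρ) / 2, ⟨?_, ?_⟩, ?_⟩
  · have := (div_lt_one hρ).2 h
    linarith
  · have : 0 ≤ |t| / ρ := by positivity
    linarith
  · have : ρ * (1 - (1 - |t| / ρ) / 2) = (ρ + |t|) / 2 := by field_simp; ring
    rw [this]; linarith

theorem normE_nonneg {d : ℕ} (k : ℕ) (ρ : ℝ) (a : ℝ → L2 d) : 0 ≤ normE k ρ a :=
  Real.sInf_nonneg fun _ hx => hx.1.le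

section

variable {d : ℕ} (hd : 2 ≤ d) {k : ℕ} (hk : ((d : ℝ) + 1) / 2 < k)

include hd hk

/-- The inclusion of `Y_s` in `L²` as a continuous real linear map. -/
def inclR {s : ℝ} (hs : 0 ≤ s) : Y d k s →L[ℝ] L2 d := (inclL hd hs hk).restrictScalars ℝ

theorem inclR_apply {s : ℝ} (hs : 0 ≤ s) (u : Y d k s) : inclR hd hk hs u = u.incl := rfl

theorem inclR_smul_mk {s : ℝ} (hs : 0 ≤ s) (t : ℝ) {u : L2 d} (hu : u ∈ ySub d k s) :
    inclR hd hk hs (t • Y.mk u hu) = t • u := by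
  rw [map_smul, inclR_apply, Y.incl_mk]

/-- The continuous inclusion into `L²` commutes with derivatives, so the coefficients computed in
different `Y_s` are one and the same sequence in `L²`. -/
theorem incl_taylorCoeff {ρ : ℝ} (hρ : 0 < ρ) {a : ℝ → L2 d} (ha : MemETilde k ρ a) {s : ℝ}
    (hs : s ∈ Ioo (0 : ℝ) 1) (ν : ℕ) :
    (taylorCoeff (toY k s a) ν).incl = taylorCoeff a ν := by
  have := completeSpace_Y hd hs.1.le hk
  obtain ⟨h1, h2⟩ := ha s hs
  have hR : 0 < ρ * (1 - s) := mul_pos hρ (sub_pos.2 hs.2)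
  have h0 : (0 : ℝ) ∈ Ioo (-(ρ * (1 - s))) (ρ * (1 - s)) := by constructor <;> linarith
  have h3 := taylorCoeff_comp (h2 0 h0) (inclR hd hk hs.1.le) ν
  refine h3.symm.trans (taylorCoeff_congr ?_ ν)
  filter_upwards [isOpen_Ioo.mem_nhds h0] with t ht
  exact incl_toY (h1 t ht)

theorem coeffBound_of_eBound {ρ : ℝ} (hρ : 0 < ρ) {a : ℝ → L2 d} (ha : MemETilde k ρ a) {M : ℝ}
    (hM : EBound k ρ a M) : CoeffBound k ρ (taylorCoeff a) M := by
  intro s hs ν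
  rw [← incl_taylorCoeff hd hk hρ ha hs ν]
  exact ⟨Y.mem _, eBound_iff.1 hM s hs ν⟩

/-- The bounds are closed conditions on `M`, so they pass to the infimum defining the norm. -/
theorem coeffBound_normE {ρ : ℝ} (hρ : 0 < ρ) {a : ℝ → L2 d} (ha : MemE k ρ a) :
    CoeffBound k ρ (taylorCoeff a) (normE k ρ a) := by
  obtain ⟨h1, M, hM, hM'⟩ := ha
  refine coeffBound_of_eBound hd hk hρ h1 (eBound_iff.2 fun s hs ν => ?_)
  have hw := wt_pos hρ hs.2 ν
  rw [← div_le_iff₀ hw]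
  refine le_csInf ⟨M, hM, hM'⟩ fun M' hM' => ?_
  rw [div_le_iff₀ hw]
  exact eBound_iff.1 hM'.2 s hs ν

/-- A series of elements of `Y_s` whose norms are summable converges in `Y_s`. -/
theorem exists_hasSum_Y {s : ℝ} (hs : 0 ≤ s) {ι : Type*} {u : ι → L2 d}
    (hu : ∀ i, u i ∈ ySub d k s) (hsum : Summable fun i => nrm k s (u i)) :
    ∃ U : Y d k s, HasSum (fun i => Y.mk (u i) (hu i)) U ∧ HasSum u U.incl := by
  have := completeSpace_Y hd hs hk
  have h1 : Summable fun i => Y.mk (u i) (hu i) := Summable.of_norm hsum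
  obtain ⟨U, hU⟩ := h1
  exact ⟨U, hU, (inclL hd hs hk).hasSum hU⟩

theorem CoeffBound.exists_hasSum {ρ M : ℝ} {β : ℕ → L2 d} (h : CoeffBound k ρ β M)
    (hρ : 0 < ρ) {s : ℝ} (hs : s ∈ Ioo (0 : ℝ) 1) {t : ℝ} (ht : |t| < ρ * (1 - s)) :
    ∃ U : Y d k s, HasSum (fun ν => t ^ ν • Y.mk (β ν) (h s hs ν).1) U ∧
      HasSum (fun ν => t ^ ν • β ν) U.incl := by
  have := completeSpace_Y hd hs.1.le hk
  have h1 : Summable fun ν => t ^ ν • Y.mk (β ν) (h s hs ν).1 := by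
    refine Summable.of_norm ((h.summable hρ hs (abs_nonneg t) ht).congr fun ν => ?_)
    rw [norm_smul, norm_pow, Real.norm_eq_abs]
    rfl
  obtain ⟨U, hU⟩ := h1
  refine ⟨U, hU, ?_⟩
  have h2 := (inclR hd hk hs.1.le).hasSum hU
  rw [inclR_apply] at h2
  exact h2.congr_fun fun ν => (inclR_smul_mk hd hk hs.1.le _ _).symm

theorem hasSum_toY {ρ : ℝ} (hρ : 0 < ρ) {a : ℝ → L2 d} (ha : MemE k ρ a) {s : ℝ}
    (hs : s ∈ Ioo (0 : ℝ) 1) {t : ℝ} (ht : |t| < ρ * (1 - s)) :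
    HasSum (fun ν => t ^ ν • taylorCoeff (toY k s a) ν) (toY k s a t) := by
  have := completeSpace_Y hd hs.1.le hk
  refine hasSum_taylorCoeff (mul_pos hρ (sub_pos.2 hs.2)) (ha.1 s hs).2 (fun r hr hr' => ?_) ht
  refine ((coeffBound_normE hd hk hρ ha).summable hρ hs hr hr').congr fun ν => ?_
  rw [Y.norm_eq_nrm, incl_taylorCoeff hd hk hρ ha.1 hs ν]

theorem hasSum_of_memE {ρ : ℝ} (hρ : 0 < ρ) {a : ℝ → L2 d} (ha : MemE k ρ a) {t : ℝ}
    (ht : t ∈ Ioo (-ρ) ρ) : HasSum (fun ν => t ^ ν • taylorCoeff a ν) (a t) := by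
  obtain ⟨s, hs, hst⟩ := exists_lt_mul_one_sub hρ ht
  have h1 := (inclR hd hk hs.1.le).hasSum (hasSum_toY hd hk hρ ha hs hst)
  have h2 : a t ∈ ySub d k s := (ha.1 s hs).1 t (abs_lt.1 hst)
  rw [inclR_apply, incl_toY h2] at h1
  refine h1.congr_fun fun ν => ?_
  rw [← incl_taylorCoeff hd hk hρ ha.1 hs ν, map_smul, inclR_apply]

/-- A function given by its Taylor series. -/
theorem memE_of_coeffBound {ρ M : ℝ} (hρ : 0 < ρ) {β : ℕ → L2 d} (h : CoeffBound k ρ β M)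
    (hM : 0 ≤ M) {b : ℝ → L2 d} (hb : ∀ t ∈ Ioo (-ρ) ρ, HasSum (fun ν => t ^ ν • β ν) (b t)) :
    MemE k ρ b ∧ normE k ρ b ≤ M := by
  have key : ∀ s (hs : s ∈ Ioo (0 : ℝ) 1), ∀ t, |t| < ρ * (1 - s) → b t ∈ ySub d k s ∧
      HasSum (fun ν => t ^ ν • Y.mk (β ν) (h s hs ν).1) (toY k s b t) := by
    intro s hs t ht
    obtain ⟨U, hU1, hU2⟩ := h.exists_hasSum hd hk hρ hs ht
    have h2 : ρ * (1 - s) < ρ := by nlinarith [hs.1]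
    have h1 : t ∈ Ioo (-ρ) ρ := abs_lt.1 (ht.trans h2)
    have h3 := (hb t h1).unique hU2
    have h4 : b t ∈ ySub d k s := h3 ▸ U.mem
    refine ⟨h4, ?_⟩
    have h5 : toY k s b t = U := Y.incl_injective ((incl_toY h4).trans h3)
    rwa [h5]
  have hR : ∀ s ∈ Ioo (0 : ℝ) 1, 0 < ρ * (1 - s) := fun s hs => mul_pos hρ (sub_pos.2 hs.2)
  have hsum : ∀ s (hs : s ∈ Ioo (0 : ℝ) 1), ∀ r, 0 ≤ r → r < ρ * (1 - s) →
      Summable fun ν => r ^ ν * ‖Y.mk (β ν) (h s hs ν).1‖ := by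
    intro s hs r hr hr'
    simp only [Y.norm_eq_nrm, Y.incl_mk]
    exact h.summable hρ hs hr hr'
  have h1 : MemETilde k ρ b := by
    intro s hs
    have := completeSpace_Y hd hs.1.le hk
    exact ⟨fun t ht => (key s hs t (abs_lt.2 ht)).1,
      analyticOnNhd_of_hasSum (hR s hs) (hsum s hs)
        fun t ht => (key s hs t ht).2⟩
  have h2 : ∀ s (hs : s ∈ Ioo (0 : ℝ) 1), ∀ ν, taylorCoeff (toY k s b) ν =
      Y.mk (β ν) (h s hs ν).1 := by
    intro s hs ν
    have := completeSpace_Y hd hs.1.le hk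
    exact taylorCoeff_of_hasSum (hR s hs) (hsum s hs)
      (fun t ht => (key s hs t ht).2) ν
  have h3 : ∀ M', M ≤ M' → EBound k ρ b M' := by
    intro M' hM'
    rw [eBound_iff]
    intro s hs ν
    rw [h2 s hs ν, Y.norm_eq_nrm, Y.incl_mk]
    refine (h s hs ν).2.trans ?_
    have := (wt_pos hρ hs.2 ν).le
    gcongr
  -- Admissible constants must be strictly positive whereas `M` may vanish, hence `M + 1` here and
  -- an arbitrary `ε` for the norm.
  refine ⟨⟨h1, M + 1, by linarith, h3 _ (by linarith)⟩, ?_⟩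
  refine le_of_forall_pos_le_add fun ε hε => ?_
  exact csInf_le ⟨0, fun x hx => hx.1.le⟩ ⟨by linarith, h3 _ (by linarith)⟩

/-- The Taylor series of a primitive. -/
theorem hasSum_integral {ρ M : ℝ} (hρ : 0 < ρ) {β : ℕ → L2 d} (h : CoeffBound k ρ β M)
    {b : ℝ → L2 d} (hb : ∀ t ∈ Ioo (-ρ) ρ, HasSum (fun ν => t ^ ν • β ν) (b t)) {t : ℝ}
    (ht : t ∈ Ioo (-ρ) ρ) :
    HasSum (fun ν : ℕ => (t ^ (ν + 1) / (ν + 1)) • β ν) (∫ σ in (0 : ℝ)..t, b σ) := by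
  obtain ⟨s, hs, hst⟩ := exists_lt_mul_one_sub hρ ht
  have hsub : ∀ σ ∈ Set.uIcc 0 t, |σ| ≤ |t| := by
    intro σ hσ
    have := Set.abs_sub_left_of_mem_uIcc hσ
    simpa using this
  have h1 : ∀ ν : ℕ, ∫ σ in (0 : ℝ)..t, σ ^ ν • β ν = (t ^ (ν + 1) / (ν + 1)) • β ν := by
    intro ν
    rw [intervalIntegral.integral_smul_const, integral_pow]
    simp
  -- On the segment from `0` to `t` the terms are dominated by their size at `t`, a summable
  -- constant.
  have h2 := intervalIntegral.hasSum_integral_of_dominated_convergence (a := (0 : ℝ)) (b := t)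
    (μ := volume) (F := fun ν σ => σ ^ ν • β ν) (f := b)
    (fun ν _ => (kap d)⁻¹ * (|t| ^ ν * nrm k s (β ν)))
    (fun ν => (by fun_prop : Continuous fun σ : ℝ => σ ^ ν • β ν).aestronglyMeasurable)
    (fun ν => ae_of_all _ fun σ hσ => ?_)
    (ae_of_all _ fun σ hσ => (h.summable hρ hs (abs_nonneg t) hst).mul_left _)
    (by simp) (ae_of_all _ fun σ hσ => ?_)
  · simpa only [h1] using h2
  · have := hsub σ (Set.uIoc_subset_uIcc hσ)
    rw [norm_smul, norm_pow, Real.norm_eq_abs]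
    calc |σ| ^ ν * ‖β ν‖ ≤ |t| ^ ν * ((kap d)⁻¹ * nrm k s (β ν)) := by
          gcongr
          exact norm_le_nrm hd hs.1.le (h s hs ν).1 hk
      _ = _ := by ring
  · have := hsub σ (Set.uIoc_subset_uIcc hσ)
    exact hb σ (abs_lt.1 (this.trans_lt (abs_lt.2 ht)))

end

open Finset.HasAntidiagonal (antidiagonal)

/-! ### A majorant for quadratic recursions -/

/-- For `k = 1` the ratio is at most `2 (x + y)`, with `x` and `y` the inverse squared brackets. As
`x, y ≤ 1`, all but one of the `k` factors are bounded by `4`, and the last keeps the summable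
decay. -/
theorem japanese_ratio_le {k : ℕ} (hk : 1 ≤ k) (i j : ℕ) :
    (1 + ((i + j : ℕ) : ℝ) ^ 2) ^ k / ((1 + (i : ℝ) ^ 2) ^ k * (1 + (j : ℝ) ^ 2) ^ k) ≤
      4 ^ k / 2 * (1 / (1 + (i : ℝ) ^ 2) + 1 / (1 + (j : ℝ) ^ 2)) := by
  set x : ℝ := 1 / (1 + (i : ℝ) ^ 2) with hx
  set y : ℝ := 1 / (1 + (j : ℝ) ^ 2) with hy
  have hx0 : 0 < x := by positivity
  have hy0 : 0 < y := by positivity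
  have hx1 : x ≤ 1 := by
    rw [hx, div_le_one (by positivity)]; nlinarith [sq_nonneg (i : ℝ)]
  have hy1 : y ≤ 1 := by
    rw [hy, div_le_one (by positivity)]; nlinarith [sq_nonneg (j : ℝ)]
  have h1 : (1 + ((i + j : ℕ) : ℝ) ^ 2) / ((1 + (i : ℝ) ^ 2) * (1 + (j : ℝ) ^ 2)) ≤
      2 * (x + y) := by
    rw [div_le_iff₀ (by positivity)]
    have : 2 * (x + y) * ((1 + (i : ℝ) ^ 2) * (1 + (j : ℝ) ^ 2)) =
        2 * (1 + (j : ℝ) ^ 2) + 2 * (1 + (i : ℝ) ^ 2) := by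
      rw [hx, hy]; field_simp
    rw [this]
    push_cast
    nlinarith [sq_nonneg ((i : ℝ) - j)]
  obtain ⟨m, rfl⟩ : ∃ m, k = m + 1 := ⟨k - 1, by omega⟩
  calc _ = ((1 + ((i + j : ℕ) : ℝ) ^ 2) / ((1 + (i : ℝ) ^ 2) * (1 + (j : ℝ) ^ 2))) ^ (m + 1) := by
        rw [div_pow, mul_pow]
    _ ≤ (2 * (x + y)) ^ (m + 1) := by gcongr
    _ = (2 * (x + y)) ^ m * (2 * (x + y)) := pow_succ _ _
    _ ≤ 4 ^ m * (2 * (x + y)) := by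
        gcongr
        linarith
    _ = _ := by rw [pow_succ]; ring

/-- The weights of the spaces of sequences. -/
def seqWt (k : ℕ) (ρ : ℝ) (n : ℕ) : ℝ := Real.exp (2 * ρ * n) * (1 + (n : ℝ) ^ 2) ^ k

theorem seqWt_pos (k : ℕ) (ρ : ℝ) (n : ℕ) : 0 < seqWt k ρ n := by unfold seqWt; positivity

theorem one_le_seqWt (k : ℕ) {ρ : ℝ} (hρ : 0 ≤ ρ) (n : ℕ) : 1 ≤ seqWt k ρ n := by
  unfold seqWt
  have h1 : 1 ≤ Real.exp (2 * ρ * n) := Real.one_le_exp (by positivity)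
  have h2 : 1 ≤ (1 + (n : ℝ) ^ 2) ^ k := one_le_pow₀ (by nlinarith [sq_nonneg (n : ℝ)])
  nlinarith

theorem summable_inv_one_add_sq : Summable fun n : ℕ => 1 / (1 + (n : ℝ) ^ 2) := by
  refine Summable.of_nonneg_of_le (fun n => by positivity) (fun n => ?_)
    (((summable_nat_add_iff 1).2 (Real.summable_one_div_nat_pow.2 one_lt_two)).mul_left 2)
  push_cast
  rw [mul_one_div, div_le_div_iff₀ (by positivity) (by positivity)]
  nlinarith [sq_nonneg ((n : ℝ) - 1)]

/-- The constant of the algebra property of the weighted `ℓ²` spaces. -/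
def seqConst (k : ℕ) : ℝ := 4 ^ k * ∑' n : ℕ, 1 / (1 + (n : ℝ) ^ 2)

theorem seqConst_nonneg (k : ℕ) : 0 ≤ seqConst k :=
  mul_nonneg (by positivity) (tsum_nonneg fun n => by positivity)

/-- Cauchy–Schwarz with the weights of the two factors. The exponentials cancel because they are
multiplicative, and `japanese_ratio_le` bounds the remaining sum uniformly in `n`, so the constant
does not depend on `ρ`. -/
theorem seqWt_mul_conv_sq_le {k : ℕ} (hk : 1 ≤ k) (ρ : ℝ) (β : ℕ → ℝ) (n : ℕ) :
    seqWt k ρ n * (∑ p ∈ antidiagonal n, β p.1 * β p.2) ^ 2 ≤ seqConst k *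
      ∑ p ∈ antidiagonal n, (seqWt k ρ p.1 * β p.1 ^ 2) * (seqWt k ρ p.2 * β p.2 ^ 2) := by
  have hcs := Finset.sum_mul_sq_le_sq_mul_sq (antidiagonal n)
    (fun p => 1 / Real.sqrt (seqWt k ρ p.1 * seqWt k ρ p.2))
    (fun p => Real.sqrt (seqWt k ρ p.1 * seqWt k ρ p.2) * (β p.1 * β p.2))
  have hpos : ∀ p : ℕ × ℕ, 0 < seqWt k ρ p.1 * seqWt k ρ p.2 := fun p =>
    mul_pos (seqWt_pos _ _ _) (seqWt_pos _ _ _)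
  have e1 : ∀ p : ℕ × ℕ, 1 / Real.sqrt (seqWt k ρ p.1 * seqWt k ρ p.2) *
      (Real.sqrt (seqWt k ρ p.1 * seqWt k ρ p.2) * (β p.1 * β p.2)) = β p.1 * β p.2 := by
    intro p
    have := Real.sqrt_pos.2 (hpos p)
    field_simp
  have e2 : ∀ p : ℕ × ℕ, (1 / Real.sqrt (seqWt k ρ p.1 * seqWt k ρ p.2)) ^ 2 =
      1 / (seqWt k ρ p.1 * seqWt k ρ p.2) := by
    intro p
    rw [div_pow, Real.sq_sqrt (hpos p).le, one_pow]
  have e3 : ∀ p : ℕ × ℕ, (Real.sqrt (seqWt k ρ p.1 * seqWt k ρ p.2) * (β p.1 * β p.2)) ^ 2 =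
      (seqWt k ρ p.1 * β p.1 ^ 2) * (seqWt k ρ p.2 * β p.2 ^ 2) := by
    intro p
    rw [mul_pow, Real.sq_sqrt (hpos p).le]; ring
  simp only [e1, e2, e3] at hcs
  have hZ : seqWt k ρ n * ∑ p ∈ antidiagonal n, 1 / (seqWt k ρ p.1 * seqWt k ρ p.2) ≤
      seqConst k := by
    have hle : ∑ i ∈ Finset.range (n + 1), 1 / (1 + (i : ℝ) ^ 2) ≤
        ∑' n : ℕ, 1 / (1 + (n : ℝ) ^ 2) :=
      summable_inv_one_add_sq.sum_le_tsum _ fun _ _ => by positivity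
    have s1 : ∑ p ∈ antidiagonal n, 1 / (1 + (p.1 : ℝ) ^ 2) =
        ∑ i ∈ Finset.range (n + 1), 1 / (1 + (i : ℝ) ^ 2) :=
      Finset.Nat.sum_antidiagonal_eq_sum_range_succ_mk _ _
    have s2 : ∑ p ∈ antidiagonal n, 1 / (1 + (p.2 : ℝ) ^ 2) =
        ∑ p ∈ antidiagonal n, 1 / (1 + (p.1 : ℝ) ^ 2) :=
      Finset.Nat.sum_antidiagonal_swap (f := fun p => 1 / (1 + (p.1 : ℝ) ^ 2))
    calc _ = ∑ p ∈ antidiagonal n, seqWt k ρ n / (seqWt k ρ p.1 * seqWt k ρ p.2) := by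
          rw [Finset.mul_sum]
          exact Finset.sum_congr rfl fun p _ => by ring
      _ ≤ ∑ p ∈ antidiagonal n,
          4 ^ k / 2 * (1 / (1 + (p.1 : ℝ) ^ 2) + 1 / (1 + (p.2 : ℝ) ^ 2)) := by
          refine Finset.sum_le_sum fun p hp => ?_
          rw [Finset.HasAntidiagonal.mem_antidiagonal] at hp
          rw [← hp]
          refine le_of_eq_of_le ?_ (japanese_ratio_le hk p.1 p.2)
          unfold seqWt
          have : Real.exp (2 * ρ * ((p.1 + p.2 : ℕ) : ℝ)) =
              Real.exp (2 * ρ * p.1) * Real.exp (2 * ρ * p.2) := by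
            rw [← Real.exp_add]; push_cast; ring_nf
          rw [this]
          field_simp
      _ = 4 ^ k / 2 * (∑ i ∈ Finset.range (n + 1), 1 / (1 + (i : ℝ) ^ 2) +
          ∑ i ∈ Finset.range (n + 1), 1 / (1 + (i : ℝ) ^ 2)) := by
          rw [← Finset.mul_sum, Finset.sum_add_distrib, s2, s1]
      _ ≤ 4 ^ k / 2 * (∑' n : ℕ, 1 / (1 + (n : ℝ) ^ 2) + ∑' n : ℕ, 1 / (1 + (n : ℝ) ^ 2)) := by
          gcongr
      _ = seqConst k := by rw [seqConst]; ring
  have hnn : 0 ≤ ∑ p ∈ antidiagonal n,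
      (seqWt k ρ p.1 * β p.1 ^ 2) * (seqWt k ρ p.2 * β p.2 ^ 2) :=
    Finset.sum_nonneg fun p _ => by
      have := seqWt_pos k ρ p.1
      have := seqWt_pos k ρ p.2
      positivity
  calc _ ≤ seqWt k ρ n * ((∑ p ∈ antidiagonal n, 1 / (seqWt k ρ p.1 * seqWt k ρ p.2)) *
        ∑ p ∈ antidiagonal n,
          (seqWt k ρ p.1 * β p.1 ^ 2) * (seqWt k ρ p.2 * β p.2 ^ 2)) :=
        mul_le_mul_of_nonneg_left hcs (seqWt_pos _ _ _).le
    _ = (seqWt k ρ n * ∑ p ∈ antidiagonal n, 1 / (seqWt k ρ p.1 * seqWt k ρ p.2)) *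
        ∑ p ∈ antidiagonal n,
          (seqWt k ρ p.1 * β p.1 ^ 2) * (seqWt k ρ p.2 * β p.2 ^ 2) := by ring
    _ ≤ _ := mul_le_mul_of_nonneg_right hZ hnn

/-- Since `f 0 = 0`, only pairs of positive indices contribute, and both are below `N` when their
sum is at most `N`. The gain of one index lets the estimate of partial sums proceed by induction. -/
theorem sum_antidiagonal_le_sq {f : ℕ → ℝ} (hf : ∀ n, 0 ≤ f n) (h0 : f 0 = 0) (N : ℕ) :
    ∑ n ∈ Finset.range (N + 1), ∑ p ∈ antidiagonal n, f p.1 * f p.2 ≤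
      (∑ n ∈ Finset.range N, f n) ^ 2 := by
  classical
  rw [← Finset.sum_biUnion (t := fun n => antidiagonal n)
    (fun a _ b _ hab => Finset.disjoint_left.2 fun (p : ℕ × ℕ) (hp : p ∈ antidiagonal a)
      (hp' : p ∈ antidiagonal b) => hab (by
      rw [Finset.HasAntidiagonal.mem_antidiagonal] at hp hp'
      exact hp.symm.trans hp')), sq, Finset.sum_mul_sum, ← Finset.sum_product',
    ← Finset.sum_filter_ne_zero]
  refine Finset.sum_le_sum_of_subset_of_nonneg (fun p hp => ?_) fun p _ _ => mul_nonneg (hf _) (hf _)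
  rw [Finset.mem_filter, Finset.mem_biUnion] at hp
  obtain ⟨⟨n, hn, hp⟩, hne⟩ := hp
  rw [Finset.HasAntidiagonal.mem_antidiagonal] at hp
  rw [Finset.mem_range] at hn
  obtain ⟨h1, h2⟩ := mul_ne_zero_iff.1 hne
  have h3 : p.1 ≠ 0 := fun h => h1 (h ▸ h0)
  have h4 : p.2 ≠ 0 := fun h => h2 (h ▸ h0)
  rw [Finset.mem_product, Finset.mem_range, Finset.mem_range]
  omega

/-- The solution of the recursion `β_n = 2 (h_n + ε ∑_{i + j = n, i, j ≥ 1} β_i β_j)`. -/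
def majSeq (h : ℕ → ℝ) (ε : ℝ) (n : ℕ) : ℝ :=
  2 * (h n + ε * ∑ i : Fin (n - 1), majSeq h ε (i + 1) * majSeq h ε (n - 1 - i))
termination_by n
decreasing_by
  all_goals have := i.2; omega

theorem majSeq_zero {h : ℕ → ℝ} (h0 : h 0 = 0) (ε : ℝ) : majSeq h ε 0 = 0 := by
  rw [majSeq, h0]; simp

theorem majSeq_eq {h : ℕ → ℝ} (h0 : h 0 = 0) (ε : ℝ) (n : ℕ) : majSeq h ε n =
    2 * (h n + ε * ∑ p ∈ antidiagonal n, majSeq h ε p.1 * majSeq h ε p.2) := by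
  have hz := majSeq_zero h0 ε
  rcases n with _ | _ | n
  · simp [hz, h0]
  · rw [majSeq]
    simp [Finset.Nat.antidiagonal_succ, hz]
  · rw [majSeq, Finset.Nat.sum_antidiagonal_eq_sum_range_succ_mk, Finset.sum_range_succ,
      Finset.sum_range_succ', hz, Finset.sum_range]
    simp only [Nat.sub_self, hz, mul_zero, zero_mul, add_zero, Nat.add_sub_cancel]
    congr 3
    refine Finset.sum_congr rfl fun i _ => ?_
    congr 2
    omega

theorem majSeq_nonneg {h : ℕ → ℝ} (hh : ∀ n, 0 ≤ h n) {ε : ℝ} (hε : 0 ≤ ε) (n : ℕ) :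
    0 ≤ majSeq h ε n := by
  induction n using Nat.strong_induction_on with
  | _ n ih =>
    rw [majSeq]
    have : 0 ≤ ∑ i : Fin (n - 1), majSeq h ε (i + 1) * majSeq h ε (n - 1 - i) :=
      Finset.sum_nonneg fun i _ => mul_nonneg (ih _ (by have := i.2; omega))
        (ih _ (by have := i.2; omega))
    have := hh n
    positivity

/-- If `S_N` is the partial sum, then `S_{N+1} ≤ 8 A + 8 ε² c S_N²` with `c` the algebra constant.
The smallness of `ε` makes the bound `16 A` stable under this step. -/
theorem sum_majSeq_sq_le {k : ℕ} (hk : 1 ≤ k) {ρ ε A : ℝ} {h : ℕ → ℝ} (h0 : h 0 = 0)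
    (hA : 0 < A) (hsum : Summable fun n => seqWt k ρ n * h n ^ 2)
    (hle : ∑' n, seqWt k ρ n * h n ^ 2 ≤ A) (hε : 256 * ε ^ 2 * seqConst k * A ≤ 1) (N : ℕ) :
    ∑ n ∈ Finset.range N, seqWt k ρ n * majSeq h ε n ^ 2 ≤ 16 * A := by
  set f : ℕ → ℝ := fun n => seqWt k ρ n * majSeq h ε n ^ 2 with hf
  have hf0 : ∀ n, 0 ≤ f n := fun n => mul_nonneg (seqWt_pos _ _ _).le (sq_nonneg _)
  have hfz : f 0 = 0 := by simp [hf, majSeq_zero h0]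
  induction N with
  | zero => simp; positivity
  | succ N ih =>
    have h1 : ∀ n, f n ≤ 8 * (seqWt k ρ n * h n ^ 2) + 8 * ε ^ 2 * (seqConst k *
        ∑ p ∈ antidiagonal n, f p.1 * f p.2) := by
      intro n
      have h2 := seqWt_mul_conv_sq_le hk ρ (majSeq h ε) n
      have h3 : f n = seqWt k ρ n *
          (2 * (h n + ε * ∑ p ∈ antidiagonal n, majSeq h ε p.1 * majSeq h ε p.2)) ^ 2 := by
        simp only [hf]
        rw [← majSeq_eq h0]
      rw [h3]
      set γ := ∑ p ∈ antidiagonal n, majSeq h ε p.1 * majSeq h ε p.2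
      have hw := seqWt_pos k ρ n
      calc _ ≤ seqWt k ρ n * (8 * h n ^ 2 + 8 * ε ^ 2 * γ ^ 2) := by
            gcongr
            nlinarith [sq_nonneg (h n - ε * γ)]
        _ = 8 * (seqWt k ρ n * h n ^ 2) + 8 * ε ^ 2 * (seqWt k ρ n * γ ^ 2) := by ring
        _ ≤ _ := by gcongr
    have hh : ∑ n ∈ Finset.range (N + 1), seqWt k ρ n * h n ^ 2 ≤ A :=
      (hsum.sum_le_tsum _ fun n _ => mul_nonneg (seqWt_pos _ _ _).le (sq_nonneg _)).trans hle
    have hC := seqConst_nonneg k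
    have hs0 : 0 ≤ ∑ n ∈ Finset.range N, f n := Finset.sum_nonneg fun n _ => hf0 n
    calc ∑ n ∈ Finset.range (N + 1), f n ≤ ∑ n ∈ Finset.range (N + 1),
          (8 * (seqWt k ρ n * h n ^ 2) + 8 * ε ^ 2 * (seqConst k *
            ∑ p ∈ antidiagonal n, f p.1 * f p.2)) := Finset.sum_le_sum fun n _ => h1 n
      _ = 8 * ∑ n ∈ Finset.range (N + 1), seqWt k ρ n * h n ^ 2 + 8 * ε ^ 2 * (seqConst k *
            ∑ n ∈ Finset.range (N + 1), ∑ p ∈ antidiagonal n, f p.1 * f p.2) := by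
          rw [Finset.sum_add_distrib, Finset.mul_sum, Finset.mul_sum, Finset.mul_sum]
      _ ≤ 8 * A + 8 * ε ^ 2 * (seqConst k * (16 * A) ^ 2) := by
          gcongr
          exact (sum_antidiagonal_le_sq hf0 hfz N).trans (by gcongr)
      _ = 8 * A + 8 * A * (256 * ε ^ 2 * seqConst k * A) := by ring
      _ ≤ 8 * A + 8 * A * 1 := by gcongr
      _ = 16 * A := by ring

/-- Sequences `β` such that `h_n + ε (β_n + β_1 β_n + ∑_{i + j = n} β_i β_j) ≤ β_n`. -/
theorem exists_majorant {k : ℕ} (hk : 1 ≤ k) {A : ℝ} (hA : 0 < A) : ∃ ε₀ > 0, ∀ ρ ε : ℝ, 0 ≤ ρ →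
    0 ≤ ε → ε ≤ ε₀ → ∀ h : ℕ → ℝ, (∀ n, 0 ≤ h n) → h 0 = 0 →
    (Summable fun n => seqWt k ρ n * h n ^ 2) → ∑' n, seqWt k ρ n * h n ^ 2 ≤ A →
    ∃ β : ℕ → ℝ, (∀ n, 0 ≤ β n) ∧ (Summable fun n => seqWt k ρ n * β n ^ 2) ∧
      ∀ n, h n + ε * (β n + β 1 * β n + ∑ p ∈ antidiagonal n, β p.1 * β p.2) ≤ β n := by
  have hC := seqConst_nonneg k
  set B := 4 * Real.sqrt A with hB
  have hB0 : 0 ≤ B := by positivity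
  set K := 256 * seqConst k * A with hK
  have hK0 : 0 ≤ K := by positivity
  -- `B` bounds the first term of the majorant. The first threshold absorbs the terms linear in `β
  -- n`, and the second is the smallness needed for the partial sums. Neither involves `ρ`, so `ρ`
  -- can be chosen afterwards.
  refine ⟨min (1 / (2 * (1 + B))) (1 / (1 + K)), by positivity,
    fun ρ ε hρ hε hε0 h hh h0 hsum hle => ⟨majSeq h ε, majSeq_nonneg hh hε, ?_⟩⟩
  have h1 : ε * (1 + B) ≤ 1 / 2 := by
    have := hε0.trans (min_le_left _ _)
    rw [le_div_iff₀ (by positivity)] at this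
    linarith
  have h2 : ε * (1 + K) ≤ 1 := by
    have := hε0.trans (min_le_right _ _)
    rwa [le_div_iff₀ (by positivity)] at this
  have h3 : 256 * ε ^ 2 * seqConst k * A ≤ 1 := by
    have e1 : ε ≤ 1 := by nlinarith
    have : 256 * ε ^ 2 * seqConst k * A = ε * (ε * K) := by rw [hK]; ring
    rw [this]
    have e2 : ε * K ≤ 1 := by nlinarith
    exact mul_le_one₀ e1 (by positivity) e2
  have hS := sum_majSeq_sq_le hk h0 hA hsum hle h3
  have hf0 : ∀ n, 0 ≤ seqWt k ρ n * majSeq h ε n ^ 2 :=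
    fun n => mul_nonneg (seqWt_pos _ _ _).le (sq_nonneg _)
  refine ⟨summable_of_sum_range_le hf0 hS, fun n => ?_⟩
  have hβ1 : majSeq h ε 1 ≤ B := by
    have e1 : majSeq h ε 1 ^ 2 ≤ 16 * A := by
      have := hS 2
      rw [Finset.sum_range_succ, Finset.sum_range_one] at this
      have e2 := hf0 0
      have e3 := mul_le_mul_of_nonneg_right (one_le_seqWt k hρ 1) (sq_nonneg (majSeq h ε 1))
      linarith
    have e4 : B = Real.sqrt (16 * A) := by
      rw [Real.sqrt_mul (by norm_num), hB]
      congr 1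
      rw [show (16 : ℝ) = 4 ^ 2 by norm_num, Real.sqrt_sq (by norm_num)]
    rw [e4]
    exact Real.le_sqrt_of_sq_le e1
  have hn := majSeq_nonneg hh hε n
  have heq := majSeq_eq h0 ε n
  have h5 : ε * (1 + majSeq h ε 1) ≤ 1 / 2 := by
    have : ε * (1 + majSeq h ε 1) ≤ ε * (1 + B) := by gcongr
    linarith
  -- The factor `2` in the recursion of `majSeq` means that the source and quadratic terms make up
  -- exactly half of `β n`; the other half is available for the linear terms.
  have h6 := mul_le_mul_of_nonneg_right h5 hn
  linarith

/-! ### Operators applied to power series -/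

theorem nrm_real_smul {d k : ℕ} {s : ℝ} {u : L2 d} (hu : u ∈ ySub d k s) (r : ℝ) :
    r • u ∈ ySub d k s ∧ nrm k s (r • u) = |r| * nrm k s u := by
  have h : r • u = (r : ℂ) • u := (algebraMap_smul ℂ r u).symm
  rw [h, nrm_smul hu, Complex.norm_real, Real.norm_eq_abs]
  exact ⟨Submodule.smul_mem _ _ hu, rfl⟩

theorem eq_of_hasSum_pow_smul {F : Type*} [NormedAddCommGroup F] [NormedSpace ℝ F] {c c' : ℕ → F}
    {f : ℝ → F} {R : ℝ} (hR : 0 < R) (h : ∀ t ∈ Ioo (-R) R, HasSum (fun n => t ^ n • c n) (f t))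
    (h' : ∀ t ∈ Ioo (-R) R, HasSum (fun n => t ^ n • c' n) (f t)) : c = c' := by
  have key : ∀ c : ℕ → F, (∀ t ∈ Ioo (-R) R, HasSum (fun n => t ^ n • c n) (f t)) →
      HasFPowerSeriesAt f (powSer c) 0 := by
    intro c h
    rw [hasFPowerSeriesAt_iff]
    have h0 : (0 : ℝ) ∈ Ioo (-R) R := by constructor <;> linarith
    filter_upwards [isOpen_Ioo.mem_nhds h0] with t ht
    simp only [coeff_powSer, zero_add]
    exact h t ht
  have h1 := (key c h).eq_formalMultilinearSeries (key c' h')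
  funext n
  rw [← coeff_powSer c n, h1, coeff_powSer]

section

variable {d : ℕ} (hd : 2 ≤ d) {k : ℕ} (hk : ((d : ℝ) + 1) / 2 < k)

include hd hk

/-- The operators are linear and bounded only on `Y_s`. The series is therefore first summed there
and then sent to `L²` by the continuous linear map induced by `T`. -/
theorem hasSum_map_of_bound {s M : ℝ} (hs : 0 ≤ s) {T : L2 d → L2 d}
    (hadd : ∀ u v, u ∈ ySub d k s → v ∈ ySub d k s → T (u + v) = T u + T v)
    (hsmul : ∀ (c : ℂ) u, u ∈ ySub d k s → T (c • u) = c • T u)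
    (hle : ∀ u ∈ ySub d k s, ‖T u‖ ≤ M * nrm k s u) {ι : Type*} {u : ι → L2 d} {U : L2 d}
    (hu : ∀ i, u i ∈ ySub d k s) (hsum : Summable fun i => nrm k s (u i)) (hU : HasSum u U) :
    U ∈ ySub d k s ∧ HasSum (fun i => T (u i)) (T U) := by
  obtain ⟨V, hV, hV'⟩ := exists_hasSum_Y hd hk hs hu hsum
  obtain rfl := hU.unique hV'
  let TL : Y d k s →ₗ[ℂ] L2 d :=
    { toFun := fun v => T v.incl
      map_add' := fun v w => by rw [map_add]; exact hadd _ _ v.mem w.mem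
      map_smul' := fun c v => by rw [map_smul]; exact hsmul c _ v.mem }
  exact ⟨V.mem, (TL.mkContinuous M fun v => hle _ v.mem).hasSum hV⟩

theorem LinLoss.norm_le {C : ℝ} {L : L2 d → L2 d} (hL : LinLoss k C L) {s : ℝ}
    (hs : s ∈ Ioo (0 : ℝ) 1) {u : L2 d} (hu : u ∈ ySub d k s) :
    ‖L u‖ ≤ (kap d)⁻¹ * (C / (s - s / 2)) * nrm k s u := by
  have h1 : 0 < s / 2 := half_pos hs.1
  have h2 : s / 2 < s := half_lt_self hs.1
  have := kap_pos d
  calc ‖L u‖ ≤ (kap d)⁻¹ * nrm k (s / 2) (L u) :=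
        norm_le_nrm hd h1.le (hL.mem h1 h2 hs.2 hu) hk
    _ ≤ (kap d)⁻¹ * (C / (s - s / 2) * nrm k s u) := by
        gcongr
        exact hL.le h1 h2 hs.2 hu
    _ = _ := by ring

theorem BilLoss.norm_le {C : ℝ} {B : L2 d → L2 d → L2 d} (hB : BilLoss k C B) {s : ℝ}
    (hs : s ∈ Ioo (0 : ℝ) 1) {u v : L2 d} (hu : u ∈ ySub d k s) (hv : v ∈ ySub d k s) :
    ‖B u v‖ ≤ (kap d)⁻¹ * (C / (s - s / 2)) * (nrm k s u * nrm k s v) := by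
  have h1 : 0 < s / 2 := half_pos hs.1
  have h2 : s / 2 < s := half_lt_self hs.1
  have := kap_pos d
  calc ‖B u v‖ ≤ (kap d)⁻¹ * nrm k (s / 2) (B u v) :=
        norm_le_nrm hd h1.le (hB.mem h1 h2 hs.2 hu hv) hk
    _ ≤ (kap d)⁻¹ * (C / (s - s / 2) * (nrm k s u * nrm k s v)) := by
        gcongr
        exact hB.le h1 h2 hs.2 hu hv
    _ = _ := by ring

theorem LinLoss.hasSum {C : ℝ} {L : L2 d → L2 d} (hL : LinLoss k C L) {s : ℝ}
    (hs : s ∈ Ioo (0 : ℝ) 1) {u : ℕ → L2 d} {U : L2 d} (hu : ∀ i, u i ∈ ySub d k s)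
    (hsum : Summable fun i => nrm k s (u i)) (hU : HasSum u U) :
    HasSum (fun i => L (u i)) (L U) :=
  (hasSum_map_of_bound hd hk hs.1.le (fun _ _ => hL.map_add hs.1 hs.2)
    (fun c _ => hL.map_smul c hs.1 hs.2) (fun _ => hL.norm_le hd hk hs) hu hsum hU).2

/-- The Cauchy product of two series. -/
theorem BilLoss.hasSum {C : ℝ} {B : L2 d → L2 d → L2 d} (hB : BilLoss k C B) {s : ℝ}
    (hs : s ∈ Ioo (0 : ℝ) 1) {u v : ℕ → L2 d} {U V : L2 d} (hu : ∀ i, u i ∈ ySub d k s)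
    (hv : ∀ i, v i ∈ ySub d k s) (husum : Summable fun i => nrm k s (u i))
    (hvsum : Summable fun i => nrm k s (v i)) (hU : HasSum u U) (hV : HasSum v V) :
    HasSum (fun n => ∑ p ∈ antidiagonal n, B (u p.1) (v p.2)) (B U V) := by
  set K := (kap d)⁻¹ * (C / (s - s / 2)) with hK
  have hright : ∀ w ∈ ySub d k s, V ∈ ySub d k s ∧ HasSum (fun j => B w (v j)) (B w V) := by
    intro w hw
    refine hasSum_map_of_bound hd hk hs.1.le (M := K * nrm k s w) (T := B w)
      (fun _ _ => hB.add_right hs.1 hs.2 hw)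
      (fun c _ => hB.smul_right c hs.1 hs.2 hw) (fun x hx => ?_) hv hvsum hV
    rw [mul_assoc]
    exact hB.norm_le hd hk hs hw hx
  have hVm := (hright _ (hu 0)).1
  have hleft : HasSum (fun i => B (u i) V) (B U V) := by
    refine (hasSum_map_of_bound hd hk hs.1.le (M := K * nrm k s V) (T := fun w => B w V)
      (fun _ _ hu hu' => hB.add_left hs.1 hs.2 hu hu' hVm)
      (fun c _ hu => hB.smul_left c hs.1 hs.2 hu hVm) (fun x hx => ?_) hu husum hU).2
    rw [mul_assoc, mul_comm (nrm k s V)]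
    exact hB.norm_le hd hk hs hx hVm
  -- Absolute summability of the double family permits regrouping by antidiagonals; the iterated sum
  -- identifies its value.
  have hprod : Summable fun p : ℕ × ℕ => B (u p.1) (v p.2) := by
    refine Summable.of_norm_bounded (g := fun p : ℕ × ℕ => K * (nrm k s (u p.1) * nrm k s (v p.2)))
      ?_ fun p => hB.norm_le hd hk hs (hu _) (hv _)
    exact (husum.mul_of_nonneg hvsum (fun _ => nrm_nonneg _ _ _)
      (fun _ => nrm_nonneg _ _ _)).mul_left K
  obtain ⟨S, hS⟩ := hprod
  have h1 := (hS.prod_fiberwise fun i => (hright _ (hu i)).2).unique hleft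
  rw [h1] at hS
  have h2 := (Finset.HasAntidiagonal.sigmaAntidiagonalEquivProd (A := ℕ)).hasSum_iff.2 hS
  refine h2.sigma fun n => ?_
  exact Finset.hasSum (antidiagonal n) fun p => B (u p.1) (v p.2)

end

/-! ### The system for the Taylor coefficients -/

/-- The Taylor coefficients of a primitive. -/
def intCoeff {X : Type*} [AddCommGroup X] [Module ℝ X] (β : ℕ → X) : ℕ → X
  | 0 => 0
  | ν + 1 => ((ν : ℝ) + 1)⁻¹ • β ν

section

variable {d : ℕ} (L : Fin 2 → L2 d → L2 d) (Q R : Fin 2 → L2 d → L2 d → L2 d)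

/-- The right hand side `L a_n + Q(a_1, a_n) + ∑_k R(a_k, a_{n-k})`. -/
def opRhs (a : Fin 2 → ℕ+ → L2 d) (ζ : Fin 2) (n : ℕ+) : L2 d :=
  L ζ (a ζ n) + Q ζ (a ζ 1) (a ζ n) + ∑ k ∈ Finset.Ico 1 n, R ζ (a 0 k) (a 1 (n - k))

/-- The Taylor coefficient of order `ν` of `opRhs` in terms of those of its argument. -/
def opCoeff (A : ℕ → Fin 2 → ℕ+ → L2 d) (ν : ℕ) (ζ : Fin 2) (n : ℕ+) : L2 d :=
  L ζ (A ν ζ n) + ∑ p ∈ antidiagonal ν, Q ζ (A p.1 ζ 1) (A p.2 ζ n) +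
    ∑ k ∈ Finset.Ico 1 n, ∑ p ∈ antidiagonal ν, R ζ (A p.1 0 k) (A p.2 1 (n - k))

theorem opCoeff_congr {A A' : ℕ → Fin 2 → ℕ+ → L2 d} {ν : ℕ} (h : ∀ i ≤ ν, A i = A' i) :
    opCoeff L Q R A ν = opCoeff L Q R A' ν := by
  have h1 : ∀ p ∈ antidiagonal ν, A p.1 = A' p.1 ∧ A p.2 = A' p.2 := by
    intro p hp
    have := Finset.HasAntidiagonal.mem_antidiagonal.1 hp
    exact ⟨h _ (by omega), h _ (by omega)⟩
  funext ζ n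
  unfold opCoeff
  rw [h ν le_rfl]
  congr 1
  · congr 1
    exact Finset.sum_congr rfl fun p hp => by rw [(h1 p hp).1, (h1 p hp).2]
  · exact Finset.sum_congr rfl fun k _ => Finset.sum_congr rfl fun p hp => by
      rw [(h1 p hp).1, (h1 p hp).2]

theorem intCoeff_congr {X : Type*} [AddCommGroup X] [Module ℝ X] {β β' : ℕ → X} {ν : ℕ}
    (h : ∀ i < ν, β i = β' i) : ∀ i ≤ ν, intCoeff β i = intCoeff β' i
  | 0, _ => rfl
  | i + 1, hi => by rw [intCoeff, intCoeff, h i hi]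

/-- The Taylor coefficients of the solution. -/
def solCoeff (H : ℕ → Fin 2 → ℕ+ → L2 d) (ν : ℕ) : Fin 2 → ℕ+ → L2 d :=
  opCoeff L Q R (intCoeff fun i => if _h : i < ν then solCoeff H i else 0) ν + H ν
termination_by ν

/-- Up to order `ν`, the coefficients of a primitive read only orders below `ν`, so the guard that
made the recursion well founded has no effect. -/
theorem solCoeff_eq (H : ℕ → Fin 2 → ℕ+ → L2 d) (ν : ℕ) : solCoeff L Q R H ν =
    opCoeff L Q R (intCoeff (solCoeff L Q R H)) ν + H ν := by
  rw [solCoeff]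
  congr 1
  refine opCoeff_congr L Q R (intCoeff_congr fun i hi => ?_)
  rw [dif_pos hi]

/-- Strong induction on the order. Uniqueness is thus purely algebraic and needs no bound on `β`. -/
theorem eq_solCoeff {H β : ℕ → Fin 2 → ℕ+ → L2 d}
    (h : ∀ ν, β ν = opCoeff L Q R (intCoeff β) ν + H ν) : β = solCoeff L Q R H := by
  funext ν
  induction ν using Nat.strong_induction_on with
  | _ ν ih =>
    rw [h, solCoeff_eq, opCoeff_congr L Q R (intCoeff_congr ih)]

end

/-! ### Catalan weights under integration, products and loss of a derivative. -/

theorem catalan_le_succ (n : ℕ) : catalan n ≤ catalan (n + 1) := by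
  rw [catalan_succ']
  have := Finset.single_le_sum (f := fun p : ℕ × ℕ => catalan p.1 * catalan p.2)
    (fun _ _ => Nat.zero_le _) (a := (n, 0))
    (Finset.HasAntidiagonal.mem_antidiagonal.2 (add_zero n))
  simpa using this

/-- The bounds of the Taylor coefficients of a primitive. -/
def intWt (ρ s : ℝ) : ℕ → ℝ
  | 0 => 0
  | ν + 1 => wt ρ s ν / (ν + 1)

theorem intWt_nonneg {ρ s : ℝ} (hρ : 0 < ρ) (hs : s < 1) : ∀ ν, 0 ≤ intWt ρ s ν
  | 0 => le_rfl
  | ν + 1 => div_nonneg (wt_pos hρ hs ν).le (by positivity)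

theorem intWt_succ {ρ s : ℝ} (ν : ℕ) : intWt ρ s (ν + 1) =
    catalan ν / ((4 * ρ) ^ ν * (1 - s) ^ (ν + 1)) := by
  rw [intWt, wt]
  field_simp

/-- Integration removes the factor `ν + 1` and leaves pure Catalan numbers, whose quadratic
recursion evaluates the sum exactly. The two end terms vanish because a primitive has no constant
term. -/
theorem sum_intWt {ρ s : ℝ} (hρ : 0 < ρ) (hs : s < 1) (ν : ℕ) :
    ∑ p ∈ antidiagonal (ν + 2), intWt ρ s p.1 * intWt ρ s p.2 =
      catalan (ν + 1) / ((4 * ρ) ^ ν * (1 - s) ^ (ν + 2)) := by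
  have h1 := sub_pos.2 hs
  rw [Finset.Nat.sum_antidiagonal_succ, Finset.Nat.sum_antidiagonal_succ', catalan_succ',
    Nat.cast_sum, Finset.sum_div]
  simp only [intWt, zero_mul, mul_zero, zero_add]
  refine Finset.sum_congr rfl fun p hp => ?_
  rw [Finset.HasAntidiagonal.mem_antidiagonal] at hp
  rw [← hp, wt, wt]
  push_cast
  field_simp
  ring

/-- The shift by `(1 - s)/(ν + 2)` divides `1 - s` by `1 + 1/(ν + 1)`, whose `ν`-th power stays
below `e`. A shift depending on the order is what keeps the cost of the loss bounded. -/
theorem one_sub_pow_le {s : ℝ} (hs : s < 1) (ν : ℕ) :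
    1 / (1 - (s + (1 - s) / (ν + 2))) ^ ν ≤ 4 / (1 - s) ^ ν := by
  have h1 := sub_pos.2 hs
  have e1 : 1 - (s + (1 - s) / ((ν : ℝ) + 2)) = (1 - s) / (1 + 1 / ((ν : ℝ) + 1)) := by
    field_simp
    ring
  have e2 : (1 + 1 / ((ν : ℝ) + 1)) ^ ν ≤ 4 := by
    have h2 : 1 + 1 / ((ν : ℝ) + 1) ≤ Real.exp (1 / ((ν : ℝ) + 1)) := by
      have := Real.add_one_le_exp (1 / ((ν : ℝ) + 1))
      linarith
    calc (1 + 1 / ((ν : ℝ) + 1)) ^ ν ≤ Real.exp (1 / ((ν : ℝ) + 1)) ^ ν := by gcongr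
      _ = Real.exp (ν * (1 / ((ν : ℝ) + 1))) := by rw [← Real.exp_nat_mul]
      _ ≤ Real.exp 1 := by
          gcongr
          rw [mul_one_div, div_le_one (by positivity)]
          linarith
      _ ≤ 4 := by have := Real.exp_one_lt_d9; linarith
  rw [e1, div_pow, one_div_div]
  gcongr

/-- The loss `(ν + 2)/(1 - s)` is compensated by the factor `ν + 1` and the extra power of `1 - s`
in `wt`. The primitive has one power of `4 ρ` fewer in its denominator, hence the gain of `ρ`. -/
theorem loss_mul_intWt_le {ρ s : ℝ} (hρ : 0 < ρ) (hs : s < 1) (ν : ℕ) :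
    1 / ((1 - s) / (ν + 2)) * intWt ρ (s + (1 - s) / (ν + 2)) ν ≤ 128 * ρ * wt ρ s ν := by
  have h1 := sub_pos.2 hs
  have hw := wt_pos hρ hs ν
  rcases ν with _ | ν
  · simp only [intWt, mul_zero]; positivity
  · rw [intWt_succ]
    have h2 := one_sub_pow_le hs (ν + 1)
    have h3 : (catalan ν : ℝ) ≤ catalan (ν + 1) := by exact_mod_cast catalan_le_succ ν
    have h4 : (0 : ℝ) ≤ catalan (ν + 1) := Nat.cast_nonneg _
    push_cast at h2 ⊢
    have h5 : 0 ≤ 1 / (1 - (s + (1 - s) / ((ν : ℝ) + 1 + 2))) ^ (ν + 1) := by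
      have : 1 - (s + (1 - s) / ((ν : ℝ) + 1 + 2)) = (1 - s) * ((ν + 2) / (ν + 3)) := by
        field_simp; ring
      rw [this]
      positivity
    calc _ = 1 / ((1 - s) / ((ν : ℝ) + 1 + 2)) * (catalan ν / (4 * ρ) ^ ν *
          (1 / (1 - (s + (1 - s) / ((ν : ℝ) + 1 + 2))) ^ (ν + 1))) := by
          rw [← div_div]; ring
      _ ≤ 1 / ((1 - s) / ((ν : ℝ) + 1 + 2)) *
          (catalan (ν + 1) / (4 * ρ) ^ ν * (4 / (1 - s) ^ (ν + 1))) := by gcongr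
      _ = 16 * ρ * (ν + 3) * catalan (ν + 1) / ((4 * ρ) ^ (ν + 1) * (1 - s) ^ (ν + 2)) := by
          field_simp
          ring
      _ ≤ 128 * ρ * (ν + 2) * catalan (ν + 1) / ((4 * ρ) ^ (ν + 1) * (1 - s) ^ (ν + 2)) := by
          gcongr ?_ * _ / _
          nlinarith
      _ = _ := by
          rw [wt]; push_cast; ring

/-- Two primitives gain `ρ²`, reduced to `ρ` by `ρ ≤ 1` so that linear and bilinear terms share one
bound. Orders `0` and `1` contribute nothing. -/
theorem loss_mul_sum_intWt_le {ρ s : ℝ} (hρ : 0 < ρ) (hρ1 : ρ ≤ 1) (hs : s < 1) (ν : ℕ) :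
    1 / ((1 - s) / (ν + 2)) * ∑ p ∈ antidiagonal ν,
      intWt ρ (s + (1 - s) / (ν + 2)) p.1 * intWt ρ (s + (1 - s) / (ν + 2)) p.2 ≤
      128 * ρ * wt ρ s ν := by
  have h1 := sub_pos.2 hs
  have hw := wt_pos hρ hs ν
  rcases ν with _ | _ | ν
  · simp [intWt]; positivity
  · simp [intWt, Finset.Nat.antidiagonal_succ]; positivity
  · have h2 := one_sub_pow_le hs (ν + 2)
    have hs' : s + (1 - s) / (((ν + 2 : ℕ) : ℝ) + 2) < 1 := by
      have : 1 - (s + (1 - s) / (((ν + 2 : ℕ) : ℝ) + 2)) = (1 - s) * ((ν + 3) / (ν + 4)) := by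
        push_cast; field_simp; ring
      have h3 : 0 < (1 - s) * (((ν : ℝ) + 3) / (ν + 4)) := by positivity
      linarith
    rw [sum_intWt hρ hs']
    have h3 : (catalan (ν + 1) : ℝ) ≤ catalan (ν + 2) := by exact_mod_cast catalan_le_succ (ν + 1)
    have h4 : (0 : ℝ) ≤ catalan (ν + 2) := Nat.cast_nonneg _
    have h5 := sub_pos.2 hs'
    calc _ = 1 / ((1 - s) / (((ν + 2 : ℕ) : ℝ) + 2)) * (catalan (ν + 1) / (4 * ρ) ^ ν *
          (1 / (1 - (s + (1 - s) / (((ν + 2 : ℕ) : ℝ) + 2))) ^ (ν + 2))) := by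
          rw [← div_div]; ring
      _ ≤ 1 / ((1 - s) / (((ν + 2 : ℕ) : ℝ) + 2)) *
          (catalan (ν + 2) / (4 * ρ) ^ ν * (4 / (1 - s) ^ (ν + 2))) := by gcongr
      _ = 64 * (ρ * ρ) * (ν + 4) * catalan (ν + 2) / ((4 * ρ) ^ (ν + 2) * (1 - s) ^ (ν + 3)) := by
          push_cast
          field_simp
          ring
      _ ≤ 128 * ρ * (ν + 3) * catalan (ν + 2) / ((4 * ρ) ^ (ν + 2) * (1 - s) ^ (ν + 3)) := by
          gcongr ?_ * _ / _
          have : ρ * ρ ≤ ρ := by nlinarith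
          nlinarith
      _ = _ := by
          rw [wt]; push_cast; ring

theorem sum_Ico_pnat_le {f : ℕ → ℕ → ℝ} (hf : ∀ i j, 0 ≤ f i j) (n : ℕ+) :
    ∑ k ∈ Finset.Ico 1 n, f k ((n - k : ℕ+) : ℕ) ≤ ∑ p ∈ antidiagonal (n : ℕ), f p.1 p.2 := by
  classical
  rw [← Finset.sum_image (s := Finset.Ico 1 n) (g := fun k : ℕ+ => ((k : ℕ), ((n - k : ℕ+) : ℕ)))
    (f := fun p : ℕ × ℕ => f p.1 p.2) (fun a _ b _ hab => PNat.coe_injective (Prod.ext_iff.1 hab).1)]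
  refine Finset.sum_le_sum_of_subset_of_nonneg (fun p hp => ?_) fun p _ _ => hf _ _
  obtain ⟨k, hk, rfl⟩ := Finset.mem_image.1 hp
  have h1 := (Finset.mem_Ico.1 hk).2
  rw [Finset.HasAntidiagonal.mem_antidiagonal]
  simp only
  rw [PNat.sub_coe, if_pos h1]
  have : (k : ℕ) < n := h1
  omega

/-! ### Bounds for the formal solution, and return from coefficients to functions of time. -/

section

variable {d k : ℕ} {L : Fin 2 → L2 d → L2 d} {Q R : Fin 2 → L2 d → L2 d → L2 d} {C : ℝ}

theorem intCoeff_bound {ρ s : ℝ} {β : ℕ → Fin 2 → ℕ+ → L2 d} {M : ℝ} {ζ : Fin 2} {n : ℕ+}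
    {ν : ℕ} (h : ∀ i < ν, β i ζ n ∈ ySub d k s ∧ nrm k s (β i ζ n) ≤ M * wt ρ s i) :
    ∀ i ≤ ν, intCoeff β i ζ n ∈ ySub d k s ∧ nrm k s (intCoeff β i ζ n) ≤ M * intWt ρ s i
  | 0, _ => by
    have : intCoeff β 0 ζ n = 0 := rfl
    rw [this, nrm_zero, intWt, mul_zero]
    exact ⟨Submodule.zero_mem _, le_rfl⟩
  | i + 1, hi => by
    obtain ⟨h1, h2⟩ := h i hi
    have h3 : intCoeff β (i + 1) ζ n = ((i : ℝ) + 1)⁻¹ • β i ζ n := rfl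
    obtain ⟨h4, h5⟩ := nrm_real_smul h1 ((i : ℝ) + 1)⁻¹
    have h6 : (0 : ℝ) < (i : ℝ) + 1 := by positivity
    rw [h3, h5, abs_of_pos (inv_pos.2 h6), intWt]
    refine ⟨h4, ?_⟩
    calc ((i : ℝ) + 1)⁻¹ * nrm k s (β i ζ n) ≤ ((i : ℝ) + 1)⁻¹ * (M * wt ρ s i) := by gcongr
      _ = _ := by ring

/-- The dependence on the order is kept in `x` and that on the profiles in `M` and `N`. The same
weight estimate then serves for the self-interactions and the cross-interactions. -/
theorem BilLoss.conv_bound {B : L2 d → L2 d → L2 d} (hB : BilLoss k C B) (hC : 0 ≤ C) {s s' : ℝ}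
    (hs : 0 < s) (hss : s < s') (hs' : s' < 1) {u v : ℕ → L2 d} {x : ℕ → ℝ} {M N : ℝ} {ν : ℕ}
    (hx : ∀ i, 0 ≤ x i) (hM : 0 ≤ M)
    (hu : ∀ i ≤ ν, u i ∈ ySub d k s' ∧ nrm k s' (u i) ≤ M * x i)
    (hv : ∀ i ≤ ν, v i ∈ ySub d k s' ∧ nrm k s' (v i) ≤ N * x i) :
    ∑ p ∈ antidiagonal ν, B (u p.1) (v p.2) ∈ ySub d k s ∧
      nrm k s (∑ p ∈ antidiagonal ν, B (u p.1) (v p.2)) ≤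
        C * (M * N) * (1 / (s' - s) * ∑ p ∈ antidiagonal ν, x p.1 * x p.2) := by
  have hp : ∀ p ∈ antidiagonal ν, p.1 ≤ ν ∧ p.2 ≤ ν := fun p hp => by
    have := Finset.HasAntidiagonal.mem_antidiagonal.1 hp
    omega
  have hmem : ∀ p ∈ antidiagonal ν, B (u p.1) (v p.2) ∈ ySub d k s := fun p h =>
    hB.mem hs hss hs' (hu _ (hp p h).1).1 (hv _ (hp p h).2).1
  have h0 := sub_pos.2 hss
  refine ⟨Submodule.sum_mem _ hmem, (nrm_sum_le _ hmem).trans ?_⟩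
  rw [Finset.mul_sum, Finset.mul_sum]
  refine Finset.sum_le_sum fun p h => ?_
  obtain ⟨h1, h2⟩ := hu _ (hp p h).1
  obtain ⟨h3, h4⟩ := hv _ (hp p h).2
  have := hx p.1
  calc nrm k s (B (u p.1) (v p.2)) ≤ C / (s' - s) * (nrm k s' (u p.1) * nrm k s' (v p.2)) :=
        hB.le hs hss hs' h1 h3
    _ ≤ C / (s' - s) * ((M * x p.1) * (N * x p.2)) := by
        have := nrm_nonneg k s' (v p.2)
        gcongr
    _ = _ := by ring

variable (hL : ∀ ζ, LinLoss k C (L ζ)) (hQ : ∀ ζ, BilLoss k C (Q ζ)) (hR : ∀ ζ, BilLoss k C (R ζ))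

include hL hQ hR

/-- The Taylor coefficients of the solution are controlled by the majorant. -/
theorem solCoeff_bound (hC : 0 ≤ C) {ρ : ℝ} (hρ : 0 < ρ) (hρ1 : ρ ≤ 1)
    {H : ℕ → Fin 2 → ℕ+ → L2 d} {h β : ℕ → ℝ}
    (hH : ∀ ζ (n : ℕ+), CoeffBound k ρ (fun ν => H ν ζ n) (h n)) (hβ : ∀ n, 0 ≤ β n)
    (hle : ∀ n, h n + C * (128 * ρ) * (β n + β 1 * β n +
      ∑ p ∈ antidiagonal n, β p.1 * β p.2) ≤ β n) (ζ : Fin 2) (n : ℕ+) :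
    CoeffBound k ρ (fun ν => solCoeff L Q R H ν ζ n) (β n) := by
  suffices key : ∀ ν, ∀ s ∈ Ioo (0 : ℝ) 1, ∀ ζ (n : ℕ+),
      solCoeff L Q R H ν ζ n ∈ ySub d k s ∧
        nrm k s (solCoeff L Q R H ν ζ n) ≤ β n * wt ρ s ν from
    fun s hs ν => key ν s hs ζ n
  intro ν
  induction ν using Nat.strong_induction_on with
  | _ ν ih =>
    intro s hs ζ n
    have h1 := sub_pos.2 hs.2
    -- The induction hypothesis is applied at the larger index `s'`, which is why it is stated for
    -- all `s` simultaneously.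
    set s' := s + (1 - s) / ((ν : ℝ) + 2) with hs'
    have hgap : s' - s = (1 - s) / ((ν : ℝ) + 2) := by rw [hs']; ring
    have hss : s < s' := by
      rw [← sub_pos, hgap]; positivity
    have hs1 : s' < 1 := by
      have e : 1 - s' = (1 - s) * (((ν : ℝ) + 1) / (ν + 2)) := by
        rw [hs']; field_simp; ring
      have : 0 < 1 - s' := by rw [e]; positivity
      linarith
    have hs0 : 0 < s' := hs.1.trans hss
    set A := intCoeff (solCoeff L Q R H) with hA
    set x := intWt ρ s' with hx
    have hx0 : ∀ i, 0 ≤ x i := intWt_nonneg hρ hs1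
    have hAb : ∀ ζ (n : ℕ+), ∀ i ≤ ν, A i ζ n ∈ ySub d k s' ∧ nrm k s' (A i ζ n) ≤ β n * x i :=
      fun ζ n => intCoeff_bound fun i hi => ih i hi s' ⟨hs0, hs1⟩ ζ n
    set w := 128 * ρ * wt ρ s ν with hw
    have hw1 : 1 / (s' - s) * x ν ≤ w := by
      rw [hgap]; exact loss_mul_intWt_le hρ hs.2 ν
    have hw2 : 1 / (s' - s) * ∑ p ∈ antidiagonal ν, x p.1 * x p.2 ≤ w := by
      rw [hgap]; exact loss_mul_sum_intWt_le hρ hρ1 hs.2 ν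
    have hLm := (hL ζ).mem hs.1 hss hs1 (hAb ζ n ν le_rfl).1
    have hLb : nrm k s (L ζ (A ν ζ n)) ≤ C * β n * w := by
      have h0 := sub_pos.2 hss
      calc nrm k s (L ζ (A ν ζ n)) ≤ C / (s' - s) * nrm k s' (A ν ζ n) :=
            (hL ζ).le hs.1 hss hs1 (hAb ζ n ν le_rfl).1
        _ ≤ C / (s' - s) * (β n * x ν) := by
            gcongr
            exact (hAb ζ n ν le_rfl).2
        _ = C * β n * (1 / (s' - s) * x ν) := by ring
        _ ≤ C * β n * w := by
            have := hβ n
            gcongr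
    obtain ⟨hQm, hQb⟩ := (hQ ζ).conv_bound hC hs.1 hss hs1 hx0 (hβ (1 : ℕ+)) (hAb ζ 1) (hAb ζ n)
    have hRk := fun j : ℕ+ => (hR ζ).conv_bound hC hs.1 hss hs1 hx0 (hβ j) (hAb 0 j) (hAb 1 (n - j))
    have hRm := Submodule.sum_mem (ySub d k s) (t := Finset.Ico 1 n) fun j _ => (hRk j).1
    have hRb : nrm k s (∑ j ∈ Finset.Ico 1 n, ∑ p ∈ antidiagonal ν,
        R ζ (A p.1 0 j) (A p.2 1 (n - j))) ≤
        C * (∑ p ∈ antidiagonal (n : ℕ), β p.1 * β p.2) * w := by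
      refine (nrm_sum_le _ fun j _ => (hRk j).1).trans ?_
      calc _ ≤ ∑ j ∈ Finset.Ico 1 n, C * (β j * β ((n - j : ℕ+) : ℕ)) * w := by
            refine Finset.sum_le_sum fun j _ => (hRk j).2.trans ?_
            have := mul_nonneg (hβ j) (hβ ((n - j : ℕ+) : ℕ))
            gcongr
        _ = C * (∑ j ∈ Finset.Ico 1 n, β j * β ((n - j : ℕ+) : ℕ)) * w := by
            rw [Finset.mul_sum, Finset.sum_mul]
        _ ≤ _ := by
            have hw0 : 0 ≤ w := by
              have := (wt_pos hρ hs.2 ν).le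
              positivity
            gcongr
            exact sum_Ico_pnat_le (f := fun i j => β i * β j)
              (fun i j => mul_nonneg (hβ i) (hβ j)) n
    obtain ⟨hHm, hHb⟩ := hH ζ n s hs ν
    have heq : solCoeff L Q R H ν ζ n = L ζ (A ν ζ n) +
        ∑ p ∈ antidiagonal ν, Q ζ (A p.1 ζ 1) (A p.2 ζ n) +
        ∑ k ∈ Finset.Ico 1 n, ∑ p ∈ antidiagonal ν, R ζ (A p.1 0 k) (A p.2 1 (n - k)) +
        H ν ζ n := by
      rw [solCoeff_eq]; rfl
    rw [heq]
    have hLQ := Submodule.add_mem _ hLm hQm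
    have hLQR := Submodule.add_mem _ hLQ hRm
    refine ⟨Submodule.add_mem _ hLQR hHm, ?_⟩
    have t1 := nrm_add_le hLQR hHm
    have t2 := nrm_add_le hLQ hRm
    have t3 := nrm_add_le hLm hQm
    have hQb' : nrm k s (∑ p ∈ antidiagonal ν, Q ζ (A p.1 ζ 1) (A p.2 ζ n)) ≤
        C * (β 1 * β n) * w := by
      refine hQb.trans ?_
      have := mul_nonneg (hβ (1 : ℕ+)) (hβ n)
      rw [PNat.one_coe] at this ⊢
      gcongr
    -- All terms now carry the same weight `wt ρ s ν`, so only the numerical inequality in `n`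
    -- remains.
    have hfin := mul_le_mul_of_nonneg_right (hle n) (wt_pos hρ hs.2 ν).le
    calc _ ≤ C * β n * w + C * (β 1 * β n) * w +
          C * (∑ p ∈ antidiagonal (n : ℕ), β p.1 * β p.2) * w + h n * wt ρ s ν := by linarith
      _ = (h n + C * (128 * ρ) * (β n + β 1 * β n +
          ∑ p ∈ antidiagonal (n : ℕ), β p.1 * β p.2)) * wt ρ s ν := by rw [hw]; ring
      _ ≤ _ := hfin

variable (hd : 2 ≤ d) (hk : ((d : ℝ) + 1) / 2 < k)

include hd hk

/-- The Taylor series of the right hand side at the primitive of `b`. -/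
theorem hasSum_opRhs {ρ : ℝ} (hρ : 0 < ρ) {β : ℕ → Fin 2 → ℕ+ → L2 d} {M : Fin 2 → ℕ+ → ℝ}
    (hβ : ∀ ζ n, CoeffBound k ρ (fun ν => β ν ζ n) (M ζ n)) {b : Fin 2 → ℕ+ → ℝ → L2 d}
    (hb : ∀ ζ n, ∀ t ∈ Ioo (-ρ) ρ, HasSum (fun ν => t ^ ν • β ν ζ n) (b ζ n t)) {t : ℝ}
    (ht : t ∈ Ioo (-ρ) ρ) (ζ : Fin 2) (n : ℕ+) :
    HasSum (fun ν => t ^ ν • opCoeff L Q R (intCoeff β) ν ζ n)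
      (opRhs L Q R (fun ζ' n' => ∫ σ in (0 : ℝ)..t, b ζ' n' σ) ζ n) := by
  obtain ⟨s, hs, hst⟩ := exists_lt_mul_one_sub hρ ht
  set a : Fin 2 → ℕ+ → L2 d := fun ζ' n' => ∫ σ in (0 : ℝ)..t, b ζ' n' σ with ha
  set A := intCoeff β with hA
  have hAm : ∀ ζ n i, A i ζ n ∈ ySub d k s := fun ζ n i =>
    (intCoeff_bound (ν := i) (fun j _ => hβ ζ n s hs j) i le_rfl).1
  have hAs : ∀ ζ n i, t ^ i • A i ζ n ∈ ySub d k s := fun ζ n i =>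
    (nrm_real_smul (hAm ζ n i) _).1
  have hA0 : ∀ ζ n, A 0 ζ n = 0 := fun ζ n => rfl
  have hA1 : ∀ ζ n i, t ^ (i + 1) • A (i + 1) ζ n = (t ^ (i + 1) / ((i : ℝ) + 1)) • β i ζ n := by
    intro ζ n i
    have : A (i + 1) ζ n = ((i : ℝ) + 1)⁻¹ • β i ζ n := rfl
    rw [this, smul_smul, div_eq_mul_inv]
  have hsumA : ∀ ζ n, HasSum (fun i => t ^ i • A i ζ n) (a ζ n) := by
    intro ζ n
    -- The constant term of a primitive vanishes, so its series is that of `hasSum_integral` shifted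
    -- by one index.
    rw [← hasSum_nat_add_iff' 1]
    have := hasSum_integral hd hk hρ (hβ ζ n) (hb ζ n) ht
    simp only [hA1, Finset.sum_range_one, hA0, smul_zero, sub_zero]
    exact this
  have hnrm : ∀ ζ n, Summable fun i => nrm k s (t ^ i • A i ζ n) := by
    intro ζ n
    rw [← summable_nat_add_iff 1]
    refine Summable.of_nonneg_of_le (fun i => nrm_nonneg _ _ _) (fun i => ?_)
      (((hβ ζ n).summable hρ hs (abs_nonneg t) hst).mul_left |t|)
    rw [hA1, (nrm_real_smul (hβ ζ n s hs i).1 _).2, abs_div, abs_pow, pow_succ]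
    have h1 : (0 : ℝ) < (i : ℝ) + 1 := by positivity
    rw [abs_of_pos h1]
    have h2 := nrm_nonneg k s (β i ζ n)
    calc |t| ^ i * |t| / ((i : ℝ) + 1) * nrm k s (β i ζ n)
        ≤ |t| ^ i * |t| / 1 * nrm k s (β i ζ n) := by
          gcongr
          linarith [(Nat.cast_nonneg i : (0 : ℝ) ≤ i)]
      _ = _ := by ring
  have real_smul : ∀ (r : ℝ) (u : L2 d), r • u = (r : ℂ) • u := fun r u =>
    (algebraMap_smul ℂ r u).symm
  have hbil : ∀ {B : L2 d → L2 d → L2 d}, BilLoss k C B → ∀ ζ₁ n₁ ζ₂ n₂,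
      HasSum (fun ν => t ^ ν • ∑ p ∈ antidiagonal ν, B (A p.1 ζ₁ n₁) (A p.2 ζ₂ n₂))
        (B (a ζ₁ n₁) (a ζ₂ n₂)) := by
    intro B hB ζ₁ n₁ ζ₂ n₂
    have := hB.hasSum hd hk hs (hAs ζ₁ n₁) (hAs ζ₂ n₂) (hnrm ζ₁ n₁) (hnrm ζ₂ n₂)
      (hsumA ζ₁ n₁) (hsumA ζ₂ n₂)
    refine this.congr_fun fun ν => ?_
    rw [Finset.smul_sum]
    refine Finset.sum_congr rfl fun p hp => ?_
    rw [Finset.HasAntidiagonal.mem_antidiagonal] at hp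
    rw [← hp, pow_add, mul_smul, real_smul (t ^ p.1) (A p.1 ζ₁ n₁),
      real_smul (t ^ p.2) (A p.2 ζ₂ n₂), real_smul, real_smul,
      hB.smul_left _ hs.1 hs.2 (hAm _ _ _) (Submodule.smul_mem _ _ (hAm _ _ _)),
      hB.smul_right _ hs.1 hs.2 (hAm _ _ _) (hAm _ _ _)]
  have hlin : HasSum (fun ν => t ^ ν • L ζ (A ν ζ n)) (L ζ (a ζ n)) := by
    refine ((hL ζ).hasSum hd hk hs (hAs ζ n) (hnrm ζ n) (hsumA ζ n)).congr_fun fun ν => ?_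
    rw [real_smul, real_smul, (hL ζ).map_smul _ hs.1 hs.2 (hAm _ _ _)]
  have hR' : HasSum (fun ν => ∑ j ∈ Finset.Ico 1 n, t ^ ν • ∑ p ∈ antidiagonal ν,
      R ζ (A p.1 0 j) (A p.2 1 (n - j))) (∑ j ∈ Finset.Ico 1 n, R ζ (a 0 j) (a 1 (n - j))) :=
    hasSum_sum fun j _ => hbil (hR ζ) 0 j 1 (n - j)
  refine ((hlin.add (hbil (hQ ζ) ζ 1 ζ n)).add hR').congr_fun fun ν => ?_
  rw [opCoeff, smul_add, smul_add, Finset.smul_sum (s := Finset.Ico 1 n)]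

/-- A majorant of the source term yields a unique solution of the boundary system. -/
theorem exists_unique_solution_of_majorant (hC : 0 ≤ C) {ρ : ℝ} (hρ : 0 < ρ) (hρ1 : ρ ≤ 1)
    {H : Fin 2 → ℕ+ → ℝ → L2 d} (hH : MemE2 k ρ H) {h β : ℕ → ℝ}
    (hh : ∀ ζ (n : ℕ+), normE k ρ (H ζ n) ≤ h n) (hβ : ∀ n, 0 ≤ β n)
    (hβs : Summable fun n => seqWt k ρ n * β n ^ 2)
    (hle : ∀ n, h n + C * (128 * ρ) * (β n + β 1 * β n +
      ∑ p ∈ antidiagonal n, β p.1 * β p.2) ≤ β n) :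
    ∃ b : Fin 2 → ℕ+ → ℝ → L2 d, MemE2 k ρ b ∧
      (∀ ζ n, ∀ t ∈ Ioo (-ρ) ρ, b ζ n t =
        opRhs L Q R (fun ζ' n' => ∫ σ in (0 : ℝ)..t, b ζ' n' σ) ζ n + H ζ n t) ∧
      ∀ b' : Fin 2 → ℕ+ → ℝ → L2 d, MemE2 k ρ b' →
        (∀ ζ n, ∀ t ∈ Ioo (-ρ) ρ, b' ζ n t =
          opRhs L Q R (fun ζ' n' => ∫ σ in (0 : ℝ)..t, b' ζ' n' σ) ζ n + H ζ n t) →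
        ∀ ζ n, ∀ t ∈ Ioo (-ρ) ρ, b' ζ n t = b ζ n t := by
  set η : ℕ → Fin 2 → ℕ+ → L2 d := fun ν ζ n => taylorCoeff (H ζ n) ν with hη
  have hηb : ∀ ζ (n : ℕ+), CoeffBound k ρ (fun ν => η ν ζ n) (h n) := by
    intro ζ n s hs ν
    obtain ⟨h1, h2⟩ := coeffBound_normE hd hk hρ ((hH ζ).1 n) s hs ν
    refine ⟨h1, h2.trans ?_⟩
    have := (wt_pos hρ hs.2 ν).le
    gcongr
    exact hh ζ n
  have hηs : ∀ ζ n, ∀ t ∈ Ioo (-ρ) ρ, HasSum (fun ν => t ^ ν • η ν ζ n) (H ζ n t) :=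
    fun ζ n t ht => hasSum_of_memE hd hk hρ ((hH ζ).1 n) ht
  set σ := solCoeff L Q R η with hσ
  have hσb : ∀ ζ (n : ℕ+), CoeffBound k ρ (fun ν => σ ν ζ n) (β n) :=
    solCoeff_bound hL hQ hR hC hρ hρ1 hηb hβ hle
  set b : Fin 2 → ℕ+ → ℝ → L2 d := fun ζ n t => ∑' ν, t ^ ν • σ ν ζ n with hb
  have hbs : ∀ ζ n, ∀ t ∈ Ioo (-ρ) ρ, HasSum (fun ν => t ^ ν • σ ν ζ n) (b ζ n t) := by
    intro ζ n t ht
    obtain ⟨s, hs, hst⟩ := exists_lt_mul_one_sub hρ ht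
    obtain ⟨U, -, hU⟩ := (hσb ζ n).exists_hasSum hd hk hρ hs hst
    exact hU.summable.hasSum
  have hbE : ∀ ζ n, MemE k ρ (b ζ n) ∧ normE k ρ (b ζ n) ≤ β n := fun ζ n =>
    memE_of_coeffBound hd hk hρ (hσb ζ n) (hβ n) (hbs ζ n)
  -- Stated for arbitrary coefficients because it serves twice: for the constructed function and for
  -- a competing solution.
  have hrhs : ∀ {τ : ℕ → Fin 2 → ℕ+ → L2 d} {M : Fin 2 → ℕ+ → ℝ} {c : Fin 2 → ℕ+ → ℝ → L2 d},
      (∀ ζ n, CoeffBound k ρ (fun ν => τ ν ζ n) (M ζ n)) →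
      (∀ ζ n, ∀ t ∈ Ioo (-ρ) ρ, HasSum (fun ν => t ^ ν • τ ν ζ n) (c ζ n t)) →
      ∀ ζ n, ∀ t ∈ Ioo (-ρ) ρ, HasSum
        (fun ν => t ^ ν • (opCoeff L Q R (intCoeff τ) ν + η ν) ζ n)
        (opRhs L Q R (fun ζ' n' => ∫ σ in (0 : ℝ)..t, c ζ' n' σ) ζ n + H ζ n t) := by
    intro τ M c hτ hc ζ n t ht
    refine ((hasSum_opRhs hL hQ hR hd hk hρ hτ hc ht ζ n).add (hηs ζ n t ht)).congr_fun
      fun ν => ?_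
    rw [Pi.add_apply, Pi.add_apply, smul_add]
  refine ⟨b, fun ζ => ⟨fun n => (hbE ζ n).1, ?_⟩, fun ζ n t ht => ?_, fun b' hb' hsol ζ n t ht => ?_⟩
  · refine Summable.of_nonneg_of_le (fun n => ?_) (fun n => ?_)
      (hβs.comp_injective PNat.coe_injective)
    · unfold seqTerm; positivity
    · have h1 := (hbE ζ n).2
      have h2 := normE_nonneg k ρ (b ζ n)
      simp only [Function.comp_apply, seqTerm, seqWt]
      gcongr
  · refine (hbs ζ n t ht).unique ?_
    refine (hrhs hσb hbs ζ n t ht).congr_fun fun ν => ?_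
    rw [hσ, ← solCoeff_eq]
  -- The norms of the components of `b'` give convergence of its series. Comparing coefficients on
  -- the two sides of the equation then yields the recursion, with no size condition on `b'`.
  · set τ : ℕ → Fin 2 → ℕ+ → L2 d := fun ν ζ n => taylorCoeff (b' ζ n) ν with hτ
    have hτb : ∀ ζ n, CoeffBound k ρ (fun ν => τ ν ζ n) (normE k ρ (b' ζ n)) := fun ζ n =>
      coeffBound_normE hd hk hρ ((hb' ζ).1 n)
    have hτs : ∀ ζ n, ∀ t ∈ Ioo (-ρ) ρ, HasSum (fun ν => t ^ ν • τ ν ζ n) (b' ζ n t) :=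
      fun ζ n t ht => hasSum_of_memE hd hk hρ ((hb' ζ).1 n) ht
    have hrec : ∀ ζ n, (fun ν => τ ν ζ n) =
        fun ν => (opCoeff L Q R (intCoeff τ) ν + η ν) ζ n := by
      intro ζ n
      refine eq_of_hasSum_pow_smul hρ (hτs ζ n) fun t ht => ?_
      rw [hsol ζ n t ht]
      exact hrhs hτb hτs ζ n t ht
    have hτσ : τ = σ := eq_solCoeff L Q R fun ν => by
      funext ζ n
      exact congrFun (hrec ζ n) ν
    refine (hτs ζ n t ht).unique ?_
    rw [hτσ]
    exact hbs ζ n t ht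

end

/-! ### The boundary system -/

/-- The bilinear operator `-∂_Θ D(u, v) - w F(∂_Θ u, ∂_Θ v)`. -/
def selfInt {d : ℕ} (S : BoundaryData d) (ζ : Fin 2) (u v : L2 d) : L2 d :=
  (-1 : ℂ) • dDir 0 1 (S.D ζ • mulL2 u v) +
    (-(S.w ζ : ℂ)) • fPer (S.δ₁ ζ) (S.δ₃ ζ) (dTheta u) (dTheta v)

/-- The bilinear operator `K ∂_Θ(u v)`. -/
def crossInt {d : ℕ} (S : BoundaryData d) (ζ : Fin 2) (u v : L2 d) : L2 d :=
  (S.K ζ : ℂ) • dDir 0 1 (mulL2 u v)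

theorem rhs_eq_opRhs {d : ℕ} (S : BoundaryData d) (a : Fin 2 → ℕ+ → L2 d) :
    S.rhs a = opRhs (fun ζ => dDir (S.v ζ) 0) (selfInt S) (crossInt S) a := by
  have real_smul : ∀ (r : ℝ) (u : L2 d), r • u = (r : ℂ) • u := fun r u =>
    (algebraMap_smul ℂ r u).symm
  funext ζ n
  unfold BoundaryData.rhs opRhs selfInt crossInt
  rw [real_smul, real_smul, ← Finset.smul_sum, dTan_eq, dTheta_eq, neg_one_smul, neg_smul]
  abel

theorem exists_loss_bounds {d : ℕ} (hd : 2 ≤ d) (S : BoundaryData d) {m : ℝ}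
    (hm : S.IsSmallDivisorExponent m) {k : ℕ} (hk : m + 2 + ((d : ℝ) + 1) / 2 < k) :
    ∃ C, 0 ≤ C ∧ (∀ ζ, LinLoss k C (dDir (S.v ζ) 0 : L2 d → L2 d)) ∧
      (∀ ζ, BilLoss k C (selfInt S ζ)) ∧ ∀ ζ, BilLoss k C (crossInt S ζ) := by
  obtain ⟨hm0, c, hc, hdiv⟩ := hm
  have hk1 : ((d : ℝ) + 1) / 2 + 2 < k := by linarith
  have hk2 : ((d : ℝ) + 1) / 2 < k := by linarith
  have hmul := bilBdd_mulL2 hd hk2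
  have hθ : LinLoss k _ (dDir 0 1 : L2 d → L2 d) := linLoss_dDir hd hk1 0 1
  have hθ0 : (0 : ℝ) ≤ ‖(0 : Tan d)‖ + |1| := by positivity
  have hL := fun ζ => linLoss_dDir hd hk1 (S.v ζ) 0
  have hQ := fun ζ => (((hmul.smul (S.D ζ)).comp_linLoss hθ hθ0).smul (-1)).add
    ((bilLoss_fPer hd hm0 hk hc.le (hdiv ζ)).smul (-(S.w ζ : ℂ)))
  have hR := fun ζ => ((hmul.comp_linLoss hθ hθ0).smul (S.K ζ : ℂ))
  have hsup : ∀ x : Fin 2 → ℝ, ∃ B, 0 ≤ B ∧ ∀ ζ, x ζ ≤ B := fun x =>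
    ⟨∑ ζ, |x ζ|, by positivity, fun ζ => (le_abs_self _).trans
      (Finset.single_le_sum (f := fun ζ => |x ζ|) (fun _ _ => abs_nonneg _) (Finset.mem_univ ζ))⟩
  obtain ⟨B₁, h₁, hB₁⟩ := hsup fun ζ => ‖S.v ζ‖ + |0|
  -- The constants left open here and in the next line are determined by unification with `hQ` and
  -- `hR` in the final term.
  obtain ⟨B₂, h₂, hB₂⟩ := hsup fun ζ => _
  obtain ⟨B₃, h₃, hB₃⟩ := hsup fun ζ => _
  exact ⟨B₁ + B₂ + B₃, by positivity, fun ζ => (hL ζ).mono (by linarith [hB₁ ζ]),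
    fun ζ => BilLoss.mono (hQ ζ) ((hB₂ ζ).trans (by linarith)),
    fun ζ => BilLoss.mono (hR ζ) ((hB₃ ζ).trans (by linarith))⟩

/-- The norms of the two components of an element of `𝐄_ρ²`, added and indexed by `ℕ`. -/
def normSum {d : ℕ} (k : ℕ) (ρ : ℝ) (H : Fin 2 → ℕ+ → ℝ → L2 d) (n : ℕ) : ℝ :=
  if h : 0 < n then normE k ρ (H 0 ⟨n, h⟩) + normE k ρ (H 1 ⟨n, h⟩) else 0

theorem normSum_pnat {d : ℕ} (k : ℕ) (ρ : ℝ) (H : Fin 2 → ℕ+ → ℝ → L2 d) (n : ℕ+) :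
    normSum k ρ H n = normE k ρ (H 0 n) + normE k ρ (H 1 n) := dif_pos n.2

theorem normSum_nonneg {d : ℕ} (k : ℕ) (ρ : ℝ) (H : Fin 2 → ℕ+ → ℝ → L2 d) (n : ℕ) :
    0 ≤ normSum k ρ H n := by
  unfold normSum
  split_ifs
  · exact add_nonneg (normE_nonneg _ _ _) (normE_nonneg _ _ _)
  · exact le_rfl

theorem normE_le_normSum {d : ℕ} (k : ℕ) (ρ : ℝ) (H : Fin 2 → ℕ+ → ℝ → L2 d) (ζ : Fin 2)
    (n : ℕ+) : normE k ρ (H ζ n) ≤ normSum k ρ H n := by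
  rw [normSum_pnat]
  have h0 := normE_nonneg k ρ (H 0 n)
  have h1 := normE_nonneg k ρ (H 1 n)
  fin_cases ζ
  · exact le_add_of_nonneg_right h1
  · exact le_add_of_nonneg_left h0

/-- One scalar sequence dominates both components, so a single majorant suffices for the coupled
system. The factor `2` is that of `(a + b)² ≤ 2 (a² + b²)`. -/
theorem tsum_normSum_le {d : ℕ} {k : ℕ} {ρ : ℝ} {H : Fin 2 → ℕ+ → ℝ → L2 d} (hH : MemE2 k ρ H) :
    (Summable fun n => seqWt k ρ n * normSum k ρ H n ^ 2) ∧
      ∑' n, seqWt k ρ n * normSum k ρ H n ^ 2 ≤ 2 * normE2 k ρ H ^ 2 := by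
  set f : ℕ → ℝ := fun n => seqWt k ρ n * normSum k ρ H n ^ 2 with hf
  have hnn : ∀ ζ (n : ℕ+), 0 ≤ seqTerm k ρ (H ζ) n := fun ζ n => by
    unfold seqTerm; positivity
  have hsupp : ∀ x ∉ Set.range ((↑) : ℕ+ → ℕ), f x = 0 := by
    intro x hx
    have h0 : ¬ 0 < x := fun h => hx ⟨⟨x, h⟩, rfl⟩
    simp only [hf, normSum, dif_neg h0]
    simp
  have hle : ∀ n : ℕ+, f n ≤ 2 * (seqTerm k ρ (H 0) n + seqTerm k ρ (H 1) n) := by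
    intro n
    have hw := seqWt_pos k ρ n
    simp only [hf, normSum_pnat]
    calc _ ≤ seqWt k ρ n * (2 * (normE k ρ (H 0 n) ^ 2 + normE k ρ (H 1 n) ^ 2)) := by
          gcongr
          nlinarith [sq_nonneg (normE k ρ (H 0 n) - normE k ρ (H 1 n))]
      _ = _ := by unfold seqTerm seqWt; ring
  have hs := ((hH 0).2.add (hH 1).2).mul_left 2
  have hs' : Summable fun n : ℕ+ => f n := Summable.of_nonneg_of_le
    (fun n => mul_nonneg (seqWt_pos _ _ _).le (sq_nonneg _)) hle hs
  refine ⟨(PNat.coe_injective.summable_iff hsupp).1 hs', ?_⟩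
  rw [← PNat.coe_injective.tsum_eq (f := f) fun x hx => by_contra fun h => hx (hsupp x h)]
  refine (hs'.tsum_le_tsum hle hs).trans_eq ?_
  rw [tsum_mul_left, (hH 0).2.tsum_add (hH 1).2, normE2, Real.sq_sqrt (by positivity), normESeq,
    normESeq, Real.sq_sqrt (tsum_nonneg (hnn 0)), Real.sq_sqrt (tsum_nonneg (hnn 1))]

end WeaklyStable

end

theorem proposition3p22 (d : ℕ) (hd : 2 ≤ d) (S : WeaklyStable.BoundaryData d)
    (m : ℝ) (hm : S.IsSmallDivisorExponent m)
    (k : ℕ) (hk : m + 2 + ((d : ℝ) + 1) / 2 < k) (M₀ : ℝ) (hM₀ : 0 < M₀) :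
    ∃ ρ ∈ Set.Ioo (0 : ℝ) 1, ∀ H : Fin 2 → ℕ+ → ℝ → WeaklyStable.L2 d,
      WeaklyStable.MemE2 k ρ H → WeaklyStable.normE2 k ρ H < M₀ →
      ∃ b : Fin 2 → ℕ+ → ℝ → WeaklyStable.L2 d,
        WeaklyStable.MemE2 k ρ b ∧ S.IsSolution ρ H b ∧
        ∀ b' : Fin 2 → ℕ+ → ℝ → WeaklyStable.L2 d,
          WeaklyStable.MemE2 k ρ b' → S.IsSolution ρ H b' →
          ∀ ζ n, ∀ t ∈ Set.Ioo (-ρ) ρ, b' ζ n t = b ζ n t := by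
  have hk2 : ((d : ℝ) + 1) / 2 < k := by linarith [hm.1]
  have hk1 : 1 ≤ k := by
    rw [← Nat.one_le_cast (α := ℝ)]
    have : (0 : ℝ) ≤ ((d : ℝ) + 1) / 2 := by positivity
    linarith [hm.1]
  obtain ⟨C, hC, hL, hQ, hR⟩ := WeaklyStable.exists_loss_bounds hd S hm hk
  -- The value of `A` matches the factor `2` in `tsum_normSum_le`.
  obtain ⟨ε₀, hε₀, hmaj⟩ := WeaklyStable.exists_majorant hk1 (A := 2 * M₀ ^ 2) (by positivity)
  -- The second bound ensures `C * (128 * ρ) ≤ ε₀`; the added `1` covers the case `C = 0`.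
  have hρ : 0 < min (1 / 2) (ε₀ / (128 * C + 1)) := by positivity
  set ρ := min (1 / 2) (ε₀ / (128 * C + 1)) with hρdef
  have hρ1 : ρ ≤ 1 / 2 := min_le_left _ _
  have hε : C * (128 * ρ) ≤ ε₀ := by
    have : ρ ≤ ε₀ / (128 * C + 1) := min_le_right _ _
    rw [le_div_iff₀ (by positivity)] at this
    linarith
  refine ⟨ρ, ⟨hρ, by linarith⟩, fun H hH hM => ?_⟩
  obtain ⟨hsum, hle⟩ := WeaklyStable.tsum_normSum_le hH
  have hM2 : 2 * WeaklyStable.normE2 k ρ H ^ 2 ≤ 2 * M₀ ^ 2 := by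
    have : 0 ≤ WeaklyStable.normE2 k ρ H := Real.sqrt_nonneg _
    gcongr
  obtain ⟨β, hβ, hβs, hβle⟩ := hmaj ρ (C * (128 * ρ)) hρ.le (by positivity) hε
    (WeaklyStable.normSum k ρ H) (WeaklyStable.normSum_nonneg k ρ H) (by simp [WeaklyStable.normSum])
    hsum (hle.trans hM2)
  obtain ⟨b, hb, hsol, huniq⟩ := WeaklyStable.exists_unique_solution_of_majorant hL hQ hR hd hk2 hC
    hρ (by linarith) hH (WeaklyStable.normE_le_normSum k ρ H) hβ hβs hβle
  refine ⟨b, hb, fun ζ n t ht => ?_, fun b' hb' hsol' => huniq b' hb' fun ζ n t ht => ?_⟩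
  · rw [WeaklyStable.rhs_eq_opRhs]
    exact hsol ζ n t ht
  · rw [← WeaklyStable.rhs_eq_opRhs]
    exact hsol' ζ n t ht
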